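/- Let $\mathbb K$ be an algebraically closed field of characteristic different from $2$; for each $a\in\mathbb K$ fix a square root $\sqrt a$. Put $\mathtt q(\iota)=\iota(\iota+1)$ and $\mathtt u_\pm(\iota)=\pm\sqrt{\mathtt q(\iota)}$. Let $n\ge 1$, $m\ge 0$, $\bullet\in\{\mathsf 0,\mathsf s\}$, $\underline Q=(Q_1,\dots,Q_m)\in\mathbb K^m$ and $Q_0=0$. **Algebra.** The affine Sergeev algebra is the superalgebra with even generators $s_1,\dots,s_{n-1},x_1,\dots,x_n$, odd generators $c_1,\dots,c_n$ and relations: $s_i^2=1$, $s_is_j=s_js_i$ ($|i-j|>1$), $s_is_{i+1}s_i=s_{i+1}s_is_{i+1}$; $x_ix_j=x_jx_i$; $c_i^2=1$, $c_ic_j=-c_jc_i$ ($i\ne j$); $s_ix_i=x_{i+1}s_i-(1+c_ic_{i+1})$, $s_ix_j=x_js_i$ ($j\ne i,i+1$); $s_ic_i=c_{i+1}s_i$, $s_ic_{i+1}=c_is_i$, $s_ic_j=c_js_i$ ($j\neq i,i+1$); $x_ic_i=-c_ix_i$, $x_ic_j=c_jx_i$ ($i\ne j$). The cyclotomic Sergeev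 algebra $\mathcal H$ is its quotient by the two-sided ideal generated by $g(x_1)$, where $g=\prod_{i=1}^m(x^2-\mathtt q(Q_i))$ if $\bullet=\mathsf 0$ and $g=x\prod_{i=1}^m(x^2-\mathtt q(Q_i))$ if $\bullet=\mathsf s$. **Combinatorics.** $\mathscr P^{\mathsf 0,m}_n$ is the set of $m$-multipartitions $(\lambda^{(1)},\dots,\lambda^{(m)})$ of $n$, and $\mathscr P^{\mathsf s,m}_n$ the set of $(\lambda^{(0)},\lambda^{(1)},\dots,\lambda^{(m)})$ of total size $n$ with $\lambda^{(0)}$ a strict partition (drawn as a shifted diagram) and the other $\lambda^{(l)}$ partitions. Boxes are $(i,j,l)$ (row, column, component), with residue $Q_l+j-i$. A tableau $\mathfrak t$ is a bijection from the boxes of $\underline\lambda$ to $[n]=\{1,\dots,n\}$; it is standard if its entries increase along rows and down columns, and $\mathrm{Std}(\underline\lambda)$ is the set of standard tableaux. $\mathrm{res}_{\mathfrak t}(k)$ is the residue of the box containing $k$, and $\mathrm{res}(\mathfrak t)=(\mathrm{res}_{\mathfrak t}(1),\dots,\mathrm{res}_{\mathfrak t}(n))$. $\mathfrak t^{\underline\lambda}$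 is the tableau filled by rows from the first component on, and $d_{\mathfrak t}\in\mathfrak S_n$ is defined by $\mathfrak t=d_{\mathfrak t}\mathfrak t^{\underline\lambda}$. Assume that $\underline Q$ is separate: $\mathtt q(\mathrm{res}_{\mathfrak s}(k))\ne\mathtt q(\mathrm{res}_{\mathfrak s}(k+1))$ for all $\underline\mu\in\mathscr P^{\bullet,m}_{n+1}$, $\mathfrak s\in\mathrm{Std}(\underline\mu)$ and $1\le k\le n$. Fix $\underline\lambda\in\mathscr P^{\bullet,m}_n$. Let $\mathcal D_{\mathfrak t}$ be the set of entries of $\mathfrak t$ in boxes $(a,a,0)$, write $\mathcal D_{\mathfrak t^{\underline\lambda}}=\{i_1<\dots<i_r\}$, so that $\mathcal D_{\mathfrak t}=d_{\mathfrak t}(\mathcal D_{\mathfrak t^{\underline\lambda}})$, and put $\mathcal{OD}_{\mathfrak t}=\{d_{\mathfrak t}(i_p): p \text{ odd}\}$. For $S\subseteq[n]$ let $\mathbb Z_2(S)$ be the set of $\beta\in\mathbb Z_2^n$ supported in $S$. For $\beta\in\mathbb Z_2^n$ let $c^\beta=c_1^{\beta_1}\cdots c_n^{\beta_n}$, $\nu_\beta(i)=(-1)^{\beta_i}$,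 $|\beta|=\sum_k\beta_k$, $|\beta|_{<i}=\sum_{k<i}\beta_k$, and similarly $|\beta|_{\le i},|\beta|_{>i},|\beta|_{\ge i}$; $e_i$ is the $i$-th standard vector of $\mathbb Z_2^n$, and $\mathfrak S_n$ permutes the coordinates of $\mathbb Z_2^n$. **The module.** For $\iota\in\mathbb K$ let $L(\iota)=\mathbb Kv\oplus\mathbb Kv'$ ($v$ even, $v'$ odd), where $x$ acts by $\mathtt u_+(\iota)$ on $v$ and by $\mathtt u_-(\iota)$ on $v'$ and $c$ exchanges $v$ and $v'$. For $\underline\iota\in\mathbb K^n$ let $L(\underline\iota)$ be any irreducible component, i.e. irreducible graded submodule under all $x_i,c_i$, of the super tensor product $L(\iota_1)\otimes\cdots\otimes L(\iota_n)$. For $\tau\in\mathfrak S_n$ let $L(\underline\iota)^\tau=\{z^\tau : z\in L(\underline\iota)\}$ with $x_iz^\tau=(x_{\tau^{-1}(i)}z)^\tau$ and $c_iz^\tau=(c_{\tau^{-1}(i)}z)^\tau$. Put $$D(\underline\lambda)=\bigoplus_{\mathfrak t\in\mathrm{Std}(\underline\lambda)}L(\mathrm{res}(\mathfrak t^{\underline\lambda}))^{d_{\mathfrak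 t}},$$ let $x_i,c_i$ act summand by summand, and let $s_i$ act by $s_iz^{d_{\mathfrak t}}=\Xi_iz^{d_{\mathfrak t}}+\Omega_iz^{s_id_{\mathfrak t}}$ if $s_i\mathfrak t$ is standard and by $s_iz^{d_{\mathfrak t}}=\Xi_iz^{d_{\mathfrak t}}$ otherwise, where $$\Xi_i=-\Big(\frac1{x_i-x_{i+1}}+c_ic_{i+1}\frac1{x_i+x_{i+1}}\Big),\qquad \Omega_i=\sqrt{1-\frac1{(x_i-x_{i+1})^2}-\frac1{(x_i+x_{i+1})^2}};$$ on each summand the operator under the root is a scalar $a$, and $\Omega_i$ is $\sqrt a$. Put $\mathtt u_{\mathfrak t,i}=\mathtt u_+(\mathrm{res}_{\mathfrak t}(i))$; then $\mathtt u_{\mathfrak t,i}\neq\pm\mathtt u_{\mathfrak t,i+1}$. Put $\mathfrak c_{\mathfrak t}(i)=1-\frac1{(\mathtt u_{\mathfrak t,i}-\mathtt u_{\mathfrak t,i+1})^2}-\frac1{(\mathtt u_{\mathfrak t,i}+\mathtt u_{\mathfrak t,i+1})^2}$ and $$\gamma_{\mathfrak t}=2^{-\lfloor r/2\rfloor}\prod_{k=1}^{\lfloor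 r/2\rfloor}\big(1+\sqrt{-1}\,c_{d_{\mathfrak t}(i_{2k-1})}c_{d_{\mathfrak t}(i_{2k})}\big)\quad(\text{factors in increasing order of }k).$$ **Statement.** These operators make $D(\underline\lambda)$ a simple $\mathcal H$-supermodule, and there are vectors $v_{\mathfrak t}\in L(\mathrm{res}(\mathfrak t^{\underline\lambda}))^{d_{\mathfrak t}}$, $\mathfrak t\in\mathrm{Std}(\underline\lambda)$, such that $$\bigsqcup_{\mathfrak t\in\mathrm{Std}(\underline\lambda)}\{c^{\beta}c^{\alpha}v_{\mathfrak t}\mid\beta\in\mathbb Z_2([n]\setminus\mathcal D_{\mathfrak t}),\ \alpha\in\mathbb Z_2(\mathcal{OD}_{\mathfrak t})\}$$ is a $\mathbb K$-basis of $D(\underline\lambda)$, the part belonging to $\mathfrak t$ is a basis of $L(\mathrm{res}(\mathfrak t^{\underline\lambda}))^{d_{\mathfrak t}}$, and for all such $\mathfrak t,\beta,\alpha$: 1. $x_i\,c^\beta c^\alpha v_{\mathfrak t}=\nu_\beta(i)\,\mathtt u_{\mathfrak t,i}\,c^\beta c^\alpha v_{\mathfrak t}$ for $i\in[n]$. 2.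 $\gamma_{\mathfrak t}v_{\mathfrak t}=v_{\mathfrak t}$. 3. For $i\in[n]$, $$c_i\,c^\beta c^\alpha v_{\mathfrak t}=\begin{cases}(-1)^{|\beta|_{<i}}c^{\beta+e_i}c^\alpha v_{\mathfrak t},& i\notin\mathcal D_{\mathfrak t},\\ (-1)^{|\beta|+|\alpha|_{<i}}c^\beta c^{\alpha+e_i}v_{\mathfrak t},& i=d_{\mathfrak t}(i_p),\ p\text{ odd},\\ -\sqrt{-1}\,(-1)^{|\beta|+|\alpha|_{\le j}}c^\beta c^{\alpha+e_j}v_{\mathfrak t},& i=d_{\mathfrak t}(i_p),\ p\text{ even},\ j=d_{\mathfrak t}(i_{p-1}).\end{cases}$$ 4. For $i\in[n-1]$, $$s_i\,c^\beta c^\alpha v_{\mathfrak t}=-\frac{c^\beta c^\alpha v_{\mathfrak t}}{\nu_\beta(i)\mathtt u_{\mathfrak t,i}-\nu_\beta(i+1)\mathtt u_{\mathfrak t,i+1}}-\frac{\mathcal R(i,\beta,\alpha,\mathfrak t)}{\nu_\beta(i)\mathtt u_{\mathfrak t,i}+\nu_\beta(i+1)\mathtt u_{\mathfrak t,i+1}}+\delta(s_i\mathfrak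 t)(-1)^{\beta_i\beta_{i+1}}\sqrt{\mathfrak c_{\mathfrak t}(i)}\,c^{s_i\cdot\beta}c^{s_i\cdot\alpha}v_{s_i\mathfrak t},$$ where $\delta(s_i\mathfrak t)$ is $1$ if $s_i\mathfrak t$ is standard and $0$ (the last term being absent) otherwise. Here $i,i+1$ are never both in $\mathcal D_{\mathfrak t}$, and $\mathcal R(i,\beta,\alpha,\mathfrak t)$ is - $(-1)^{\beta_i}c^{\beta+e_i+e_{i+1}}c^\alpha v_{\mathfrak t}$ if $i,i+1\notin\mathcal D_{\mathfrak t}$; - if $i=d_{\mathfrak t}(i_p)\in\mathcal D_{\mathfrak t}$ and $i+1\notin\mathcal D_{\mathfrak t}$: $(-1)^{1+|\beta|_{>i}+|\alpha|_{<i}}c^{\beta+e_{i+1}}c^{\alpha+e_i}v_{\mathfrak t}$ for $p$ odd, and $-\sqrt{-1}\,(-1)^{1+|\beta|_{>i}+|\alpha|_{\le j}}c^{\beta+e_{i+1}}c^{\alpha+e_j}v_{\mathfrak t}$ with $j=d_{\mathfrak t}(i_{p-1})$ for $p$ even; - if $i+1=d_{\mathfrak t}(i_p)\in\mathcal D_{\mathfrak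 t}$ and $i\notin\mathcal D_{\mathfrak t}$: $(-1)^{|\beta|_{\ge i}+|\alpha|_{<i+1}}c^{\beta+e_i}c^{\alpha+e_{i+1}}v_{\mathfrak t}$ for $p$ odd, and $-\sqrt{-1}\,(-1)^{|\beta|_{\ge i}+|\alpha|_{\le j}}c^{\beta+e_i}c^{\alpha+e_j}v_{\mathfrak t}$ with $j=d_{\mathfrak t}(i_{p-1})$ for $p$ even. -/

import Mathlib

noncomputable section

namespace Sergeev

/-! ## Signs and exponents in `ZMod 2` -/

/-- The sign `(-1)^a` for `a : ZMod 2`. -/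
def sgn (K : Type*) [Field K] (a : ZMod 2) : K := if a = 0 then 1 else -1

/-- The partial sums `|β|_{<i}`, `|β|_{≤i}`, `|β|_{>i}`, `|β|_{≥i}` and the total sum `|β|`. -/
def sumLT {n : ℕ} (β : Fin n → ZMod 2) (i : Fin n) : ZMod 2 :=
  ∑ k ∈ Finset.univ.filter (fun k => k < i), β k

def sumLE {n : ℕ} (β : Fin n → ZMod 2) (i : Fin n) : ZMod 2 :=
  ∑ k ∈ Finset.univ.filter (fun k => k ≤ i), β k

def sumGT {n : ℕ} (β : Fin n → ZMod 2) (i : Fin n) : ZMod 2 :=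
  ∑ k ∈ Finset.univ.filter (fun k => i < k), β k

def sumGE {n : ℕ} (β : Fin n → ZMod 2) (i : Fin n) : ZMod 2 :=
  ∑ k ∈ Finset.univ.filter (fun k => i ≤ k), β k

def sumAll {n : ℕ} (β : Fin n → ZMod 2) : ZMod 2 := ∑ k, β k

/-- The standard vector `e_i` of `(ZMod 2)^n`. -/
def stdVec {n : ℕ} (i : Fin n) : Fin n → ZMod 2 := Pi.single i 1

/-- For `i : Fin (n - 1)` (the index of a simple transposition), the two letters that it
exchanges. Letters are numbered from `0`. -/
def lo {n : ℕ} (i : Fin (n - 1)) : Fin n := ⟨i.1, by have := i.2; omega⟩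

def hi {n : ℕ} (i : Fin (n - 1)) : Fin n := ⟨i.1 + 1, by have := i.2; omega⟩

/-- The simple transposition `s_i`. -/
def simple {n : ℕ} (i : Fin (n - 1)) : Equiv.Perm (Fin n) := Equiv.swap (lo i) (hi i)

/-! ## The affine and cyclotomic Sergeev algebras -/

/-- The two families of cyclotomic polynomials and of shapes. -/
inductive Kind
  | zero
  | strict

/-- `q(ι) = ι (ι + 1)`. -/
def q {K : Type*} [Field K] (a : K) : K := a * (a + 1)

/-- The generators of the affine Sergeev algebra. -/
inductive Gen (n : ℕ)
  | s (i : Fin (n - 1))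
  | x (i : Fin n)
  | c (i : Fin n)

section Free

variable (K : Type*) [Field K] {n : ℕ}

abbrev fs (i : Fin (n - 1)) : FreeAlgebra K (Gen n) := FreeAlgebra.ι K (Gen.s i)

abbrev fx (i : Fin n) : FreeAlgebra K (Gen n) := FreeAlgebra.ι K (Gen.x i)

abbrev fc (i : Fin n) : FreeAlgebra K (Gen n) := FreeAlgebra.ι K (Gen.c i)

end Free

/-- The defining relations of the affine Sergeev algebra. -/
inductive AffRel (K : Type*) [Field K] (n : ℕ) :
    FreeAlgebra K (Gen n) → FreeAlgebra K (Gen n) → Prop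
  | s_sq (i : Fin (n - 1)) : AffRel K n (fs K i * fs K i) 1
  | s_comm (i j : Fin (n - 1)) (h : i.1 + 1 < j.1 ∨ j.1 + 1 < i.1) :
      AffRel K n (fs K i * fs K j) (fs K j * fs K i)
  | braid (i j : Fin (n - 1)) (h : i.1 + 1 = j.1) :
      AffRel K n (fs K i * fs K j * fs K i) (fs K j * fs K i * fs K j)
  | x_comm (i j : Fin n) : AffRel K n (fx K i * fx K j) (fx K j * fx K i)
  | c_sq (i : Fin n) : AffRel K n (fc K i * fc K i) 1
  | c_anti (i j : Fin n) (h : i ≠ j) : AffRel K n (fc K i * fc K j) (-(fc K j * fc K i))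
  | s_x (i : Fin (n - 1)) :
      AffRel K n (fs K i * fx K (lo i))
        (fx K (hi i) * fs K i - (1 + fc K (lo i) * fc K (hi i)))
  | s_x_of_ne (i : Fin (n - 1)) (j : Fin n) (h : j ≠ lo i) (h' : j ≠ hi i) :
      AffRel K n (fs K i * fx K j) (fx K j * fs K i)
  | s_c_lo (i : Fin (n - 1)) : AffRel K n (fs K i * fc K (lo i)) (fc K (hi i) * fs K i)
  | s_c_hi (i : Fin (n - 1)) : AffRel K n (fs K i * fc K (hi i)) (fc K (lo i) * fs K i)
  | s_c_of_ne (i : Fin (n - 1)) (j : Fin n) (h : j ≠ lo i) (h' : j ≠ hi i) :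
      AffRel K n (fs K i * fc K j) (fc K j * fs K i)
  | x_c (i : Fin n) : AffRel K n (fx K i * fc K i) (-(fc K i * fx K i))
  | x_c_of_ne (i j : Fin n) (h : i ≠ j) : AffRel K n (fx K i * fc K j) (fc K j * fx K i)

/-- The affine Sergeev algebra. -/
abbrev AffineSergeev (K : Type*) [Field K] (n : ℕ) := RingQuot (AffRel K n)

/-- The polynomial `∏ (x² - q(Q_i))`, respectively `x ∏ (x² - q(Q_i))`. -/
def cycPoly {K : Type*} [Field K] {m : ℕ} (b : Kind) (Q : Fin m → K) : Polynomial K :=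
  (match b with
    | Kind.zero => 1
    | Kind.strict => Polynomial.X) *
  ∏ i, (Polynomial.X ^ 2 - Polynomial.C (q (Q i)))

/-- The relation `g(x_1) = 0` in the affine Sergeev algebra. -/
inductive CycRel {K : Type*} [Field K] {m : ℕ} (b : Kind) (Q : Fin m → K) (n : ℕ) :
    AffineSergeev K n → AffineSergeev K n → Prop
  | mk (i : Fin n) (h : i.1 = 0) :
      CycRel b Q n
        (Polynomial.aeval (RingQuot.mkAlgHom K (AffRel K n) (fx K i)) (cycPoly b Q)) 0

/-- The cyclotomic Sergeev algebra, the quotient of the affine one by the two-sided ideal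
generated by `g(x_1)`. -/
abbrev CycSergeev {K : Type*} [Field K] {m : ℕ} (b : Kind) (Q : Fin m → K) (n : ℕ) :=
  RingQuot (CycRel b Q n)

section Generators

variable {K : Type*} [Field K] {m : ℕ} (b : Kind) (Q : Fin m → K) {n : ℕ}

/-- The image of a generator in the cyclotomic Sergeev algebra. -/
def gen (a : Gen n) : CycSergeev b Q n :=
  RingQuot.mkAlgHom K (CycRel b Q n) (RingQuot.mkAlgHom K (AffRel K n) (FreeAlgebra.ι K a))

def gs (i : Fin (n - 1)) : CycSergeev b Q n := gen b Q (Gen.s i)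

def gx (i : Fin n) : CycSergeev b Q n := gen b Q (Gen.x i)

def gc (i : Fin n) : CycSergeev b Q n := gen b Q (Gen.c i)

/-- The ordered monomial `c^β = c_1^{β_1} ⋯ c_n^{β_n}`. -/
def cMon (β : Fin n → ZMod 2) : CycSergeev b Q n :=
  (List.ofFn fun i : Fin n => gc b Q i ^ (β i).val).prod

end Generators

/-! ## Shapes and tableaux -/

/-- A shape with `n` boxes: a strict partition in component `0` (which is empty for
`Kind.zero`) and partitions in the components `1, …, m`. -/
structure Shape (b : Kind) (m n : ℕ) where
  strictPart : YoungDiagram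
  strict : ∀ i, strictPart.rowLen (i + 1) ≠ 0 →
    strictPart.rowLen (i + 1) < strictPart.rowLen i
  strictPart_eq : b = Kind.zero → strictPart = ⊥
  part : Fin m → YoungDiagram
  size : strictPart.card + ∑ l, (part l).card = n

/-- A box `(l, i, j)`: component `l`, row `i`, column `j`; rows and columns are numbered
from `0`. -/
abbrev Box (m : ℕ) := Fin (m + 1) × ℕ × ℕ

variable {b : Kind} {m n : ℕ}

/-- The boxes of a shape; row `i` of the strict partition is shifted by `i`. -/
def Shape.cells (μ : Shape b m n) : Finset (Box m) :=
  μ.strictPart.cells.image (fun c => ((0 : Fin (m + 1)), c.1, c.1 + c.2)) ∪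
    Finset.univ.biUnion (fun l : Fin m => (μ.part l).cells.image (fun c => (l.succ, c.1, c.2)))

theorem Shape.card_cells (μ : Shape b m n) : μ.cells.card = n := by
  rw [Shape.cells, Finset.card_union_of_disjoint, Finset.card_biUnion]
  · rw [Finset.card_image_of_injective]
    · refine Eq.trans ?_ μ.size
      congr 1
      refine Finset.sum_congr rfl fun l _ => ?_
      rw [Finset.card_image_of_injective]
      intro c d h
      simpa [Prod.ext_iff] using h
    · intro c d h
      simp only [Prod.mk.injEq, true_and] at h
      ext
      · exact h.1
      · have := h.1
        have := h.2
        omega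
  · intro l _ l' _ hl
    rw [Function.onFun, Finset.disjoint_left]
    intro x hx hx'
    simp only [Finset.mem_image] at hx hx'
    obtain ⟨c, -, rfl⟩ := hx
    obtain ⟨d, -, h⟩ := hx'
    simp only [Prod.mk.injEq, Fin.succ_inj] at h
    exact hl h.1.symm
  · rw [Finset.disjoint_left]
    intro x hx hx'
    simp only [Finset.mem_image, Finset.mem_biUnion] at hx hx'
    obtain ⟨c, -, rfl⟩ := hx
    obtain ⟨l, -, d, -, h⟩ := hx'
    simp only [Prod.mk.injEq] at h
    exact Fin.succ_ne_zero l h.1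

/-- A tableau: a bijection from the boxes to the letters. -/
abbrev Tab (μ : Shape b m n) := {x : Box m // x ∈ μ.cells} ≃ Fin n

/-- A tableau is standard if its entries increase along rows and down columns. -/
def IsStd {μ : Shape b m n} (t : Tab μ) : Prop :=
  (∀ (l : Fin (m + 1)) (i j : ℕ) (h : (l, i, j) ∈ μ.cells) (h' : (l, i, j + 1) ∈ μ.cells),
    t ⟨_, h⟩ < t ⟨_, h'⟩) ∧
  (∀ (l : Fin (m + 1)) (i j : ℕ) (h : (l, i, j) ∈ μ.cells) (h' : (l, i + 1, j) ∈ μ.cells),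
    t ⟨_, h⟩ < t ⟨_, h'⟩)

/-- The standard tableaux of a shape. -/
abbrev Std (μ : Shape b m n) := {t : Tab μ // IsStd t}

/-- Boxes in reading order: first by component, then by row, then by column. -/
def boxLex (m : ℕ) : Box m ↪ Fin (m + 1) ×ₗ ℕ ×ₗ ℕ :=
  ⟨fun x => toLex (x.1, toLex x.2), fun _ _ h => h⟩

/-- The tableau in which the letters are inserted consecutively by rows from the first
component on. -/
def initial (μ : Shape b m n) : Tab μ :=
  (Finset.equivMap (boxLex m) μ.cells).trans
    ((μ.cells.map (boxLex m)).orderIsoOfFin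
      ((Finset.card_map _).trans μ.card_cells)).symm.toEquiv

/-- The tableau `w t`. -/
def permTab {μ : Shape b m n} (w : Equiv.Perm (Fin n)) (t : Tab μ) : Tab μ := t.trans w

/-- The permutation `d` with `t = d t₀`, where `t₀` is the initial tableau. -/
def dperm {μ : Shape b m n} (t : Tab μ) : Equiv.Perm (Fin n) := (initial μ).symm.trans t

/-- The letters of a tableau on the diagonal of component `0`. -/
def diag {μ : Shape b m n} (t : Tab μ) : Finset (Fin n) :=
  Finset.univ.filter fun k => (t.symm k).1.1 = 0 ∧ (t.symm k).1.2.1 = (t.symm k).1.2.2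

/-- The number of boxes on the diagonal of component `0`. -/
def numDiag (μ : Shape b m n) : ℕ := (diag (initial μ)).card

/-- The letters `i_1 < i_2 < ⋯` of the initial tableau on the diagonal of component `0`, here
numbered from `0`: `diagSeq μ p` is `i_{p+1}`. -/
def diagSeq (μ : Shape b m n) : Fin (numDiag μ) ↪o Fin n :=
  (diag (initial μ)).orderEmbOfFin rfl

/-- The letter `d(i_{p+1})` of the tableau `t`. -/
def dSeq {μ : Shape b m n} (t : Tab μ) (p : ℕ) (hp : p < numDiag μ) : Fin n :=
  dperm t (diagSeq μ ⟨p, hp⟩)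

/-- The set `{d(i_1), d(i_3), d(i_5), …}`. -/
def oddDiag {μ : Shape b m n} (t : Tab μ) : Set (Fin n) :=
  {k | ∃ (p : ℕ) (hp : 2 * p < numDiag μ), k = dSeq t (2 * p) hp}

/-- The vectors of `(ZMod 2)^n` with support off the diagonal. -/
abbrev OffDiagVec {μ : Shape b m n} (t : Tab μ) :=
  {β : Fin n → ZMod 2 // ∀ k, β k ≠ 0 → k ∉ diag t}

/-- The vectors of `(ZMod 2)^n` with support in the set of odd diagonal letters. -/
abbrev OddDiagVec {μ : Shape b m n} (t : Tab μ) :=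
  {α : Fin n → ZMod 2 // ∀ k, α k ≠ 0 → k ∈ oddDiag t}

variable {K : Type*} [Field K]

/-- The residue `Q_l + j - i` of the box occupied by the letter `k`, where `Q_0 = 0`. -/
def res (Q : Fin m → K) {μ : Shape b m n} (t : Tab μ) (k : Fin n) : K :=
  (Fin.cons 0 Q : Fin (m + 1) → K) (t.symm k).1.1 + ((t.symm k).1.2.2 : K)
    - ((t.symm k).1.2.1 : K)

/-- The parameter `Q` is separate with respect to the shape `μ`. -/
def Separate (Q : Fin m → K) (μ : Shape b m n) : Prop :=
  ∀ t : Tab μ, IsStd t → ∀ i : Fin (n - 1), q (res Q t (lo i)) ≠ q (res Q t (hi i))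

/-! ## The modules `L(ι)`

Throughout, `rt : K → K` is the chosen square root function. -/

/-- `u_+(ι) = √(ι (ι + 1))`; the other root is `u_-(ι) = - u_+(ι)`. -/
def uPlus (rt : K → K) (a : K) : K := rt (q a)

/-- The underlying space of the tensor product `L(ι_1) ⊗ ⋯ ⊗ L(ι_n)`, by coordinates: the
basis vector `Pi.single β 1` stands for the pure tensor with `k`-th factor `v_k` (even) if
`β k = 0` and `v'_k = c_k v_k` (odd) if `β k = 1`. -/
abbrev TensorSpace (K : Type*) (n : ℕ) := (Fin n → ZMod 2) → K

/-- The action of `x_i`: on the `i`-th factor, by `u_+(ι_i)` on `v_i` and by `u_-(ι_i)` on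
`v'_i`. -/
def tx (rt : K → K) (ι : Fin n → K) (i : Fin n) : Module.End K (TensorSpace K n) :=
  (Pi.basisFun K (Fin n → ZMod 2)).constr K fun β =>
    (sgn K (β i) * uPlus rt (ι i)) • Pi.single β 1

/-- The action of `c_i`: it exchanges `v_i` and `v'_i` in the `i`-th factor, with the sign that
comes from moving the odd element `c_i` past the first factors. -/
def tc (K : Type*) [Field K] {n : ℕ} (i : Fin n) : Module.End K (TensorSpace K n) :=
  (Pi.basisFun K (Fin n → ZMod 2)).constr K fun β =>
    sgn K (sumLT β i) • Pi.single (β + stdVec i) 1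

/-- The parity operator, `1` on even and `-1` on odd vectors. As `2 ≠ 0`, a subspace is graded
if and only if it is stable under this operator. -/
def tpar (K : Type*) [Field K] (n : ℕ) : Module.End K (TensorSpace K n) :=
  (Pi.basisFun K (Fin n → ZMod 2)).constr K fun β => sgn K (sumAll β) • Pi.single β 1

/-- The graded subspaces of the tensor product that are stable under all `x_i` and `c_i`. -/
structure IsSubSuper (rt : K → K) (ι : Fin n → K) (W : Submodule K (TensorSpace K n)) :
    Prop where
  x_mem : ∀ i, ∀ z ∈ W, tx rt ι i z ∈ W
  c_mem : ∀ i, ∀ z ∈ W, tc K i z ∈ W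
  par_mem : ∀ z ∈ W, tpar K n z ∈ W

/-- `L(ι) = L(ι_1) ⊛ ⋯ ⊛ L(ι_n)`: an irreducible component (an irreducible graded submodule) of
the tensor product. -/
structure IrrComponent (rt : K → K) (ι : Fin n → K) where
  space : Submodule K (TensorSpace K n)
  isSub : IsSubSuper rt ι space
  ne_bot : space ≠ ⊥
  irred : ∀ W ≤ space, IsSubSuper rt ι W → W = ⊥ ∨ W = space

section Component

variable {rt : K → K} {ι : Fin n → K} (L : IrrComponent rt ι)

/-- The operators `x_i`, `c_i` and the parity operator on `L(ι)`. -/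
def IrrComponent.x (i : Fin n) : Module.End K L.space := (tx rt ι i).restrict (L.isSub.x_mem i)

def IrrComponent.c (i : Fin n) : Module.End K L.space := (tc K i).restrict (L.isSub.c_mem i)

def IrrComponent.par : Module.End K L.space := (tpar K n).restrict L.isSub.par_mem

/-- The operators `x_i`, `c_i` on the twist `L(ι)^w`; a vector `z^w` of the twist is written as
the vector `z` of `L(ι)`, so that `x_i z^w = (x_{w⁻¹(i)} z)^w`. -/
def IrrComponent.twx (w : Equiv.Perm (Fin n)) (i : Fin n) : Module.End K L.space :=
  L.x (w.symm i)

def IrrComponent.twc (w : Equiv.Perm (Fin n)) (i : Fin n) : Module.End K L.space :=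
  L.c (w.symm i)

open Classical in
/-- The square root of a scalar operator `a • 1` is `√a • 1`. -/
def opSqrt (rt : K → K) {M : Type*} [AddCommGroup M] [Module K M] (A : Module.End K M) :
    Module.End K M :=
  if h : ∃ a : K, A = a • (1 : Module.End K M) then rt h.choose • 1 else 0

/-- The operator `Ξ_i = -(1/(x_i - x_{i+1}) + c_i c_{i+1} 1/(x_i + x_{i+1}))` on `L(ι)^w`. -/
def IrrComponent.xi (w : Equiv.Perm (Fin n)) (i : Fin (n - 1)) : Module.End K L.space :=
  -(Ring.inverse (L.twx w (lo i) - L.twx w (hi i)) +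
    L.twc w (lo i) * L.twc w (hi i) * Ring.inverse (L.twx w (lo i) + L.twx w (hi i)))

/-- The operator `Ω_i = √(1 - 1/(x_i - x_{i+1})² - 1/(x_i + x_{i+1})²)` on `L(ι)^w`. -/
def IrrComponent.omega (w : Equiv.Perm (Fin n)) (i : Fin (n - 1)) : Module.End K L.space :=
  opSqrt rt (1 - Ring.inverse (L.twx w (lo i) - L.twx w (hi i)) ^ 2
    - Ring.inverse (L.twx w (lo i) + L.twx w (hi i)) ^ 2)

end Component

/-! ## The module `D(μ)` -/

section Module

variable {rt : K → K} {Q : Fin m → K} {μ : Shape b m n}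
  (L : IrrComponent rt (res Q (initial μ)))

/-- `D(μ)`, the direct sum of the twists `L(res t₀)^{d(t, t₀)}` over all standard tableaux `t`,
where `t₀` is the initial tableau. The vector `z^{d(t, t₀)}` is `Finsupp.single t z`. -/
abbrev DMod := Std μ →₀ L.space

/-- The operators `x_i` and `c_i` on `D(μ)`. -/
def dx (i : Fin n) : Module.End K (DMod L) :=
  Finsupp.lsum K fun t : Std μ => Finsupp.lsingle t ∘ₗ L.twx (dperm t.1) i

def dc (i : Fin n) : Module.End K (DMod L) :=
  Finsupp.lsum K fun t : Std μ => Finsupp.lsingle t ∘ₗ L.twc (dperm t.1) i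

/-- The parity operator on `D(μ)`. -/
def dpar : Module.End K (DMod L) :=
  Finsupp.lsum K fun t : Std μ => Finsupp.lsingle t ∘ₗ L.par

open Classical in
/-- The operator `s_i` on `D(μ)`: it sends `z^d` to `Ξ_i z^d + Ω_i z^{s_i d}` if `s_i t` is
standard and to `Ξ_i z^d` otherwise, where `d = d(t, t₀)`. -/
def ds (i : Fin (n - 1)) : Module.End K (DMod L) :=
  Finsupp.lsum K fun t : Std μ =>
    Finsupp.lsingle t ∘ₗ L.xi (dperm t.1) i +
      if h : IsStd (permTab (simple i) t.1) then
        Finsupp.lsingle (⟨permTab (simple i) t.1, h⟩ : Std μ) ∘ₗ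
          L.omega (dperm (permTab (simple i) t.1)) i
      else 0

/-- The algebra homomorphism `Φ` is the representation in which the generators act on `D(μ)` by
the operators above. -/
structure IsDRep (Φ : CycSergeev b Q n →ₐ[K] Module.End K (DMod L)) : Prop where
  map_x : ∀ i, Φ (gx b Q i) = dx L i
  map_c : ∀ i, Φ (gc b Q i) = dc L i
  map_s : ∀ i, Φ (gs b Q i) = ds L i

end Module

/-! ## Supermodules -/

/-- With the parity operator `P`, the representation `Φ` is a supermodule: `x_i` and `s_i` are
even, and `c_i` is odd. -/
structure IsSuperRep {Q : Fin m → K} {M : Type*} [AddCommGroup M] [Module K M]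
    (Φ : CycSergeev b Q n →ₐ[K] Module.End K M) (P : Module.End K M) : Prop where
  sq : P * P = 1
  even_x : ∀ i, P * Φ (gx b Q i) = Φ (gx b Q i) * P
  even_s : ∀ i, P * Φ (gs b Q i) = Φ (gs b Q i) * P
  odd_c : ∀ i, P * Φ (gc b Q i) = -(Φ (gc b Q i) * P)

/-- The supermodule is simple: it is nonzero and has no graded submodules but zero and itself. -/
structure IsSimpleSuper {Q : Fin m → K} {M : Type*} [AddCommGroup M] [Module K M]
    (Φ : CycSergeev b Q n →ₐ[K] Module.End K M) (P : Module.End K M) : Prop where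
  super : IsSuperRep Φ P
  nontrivial : Nontrivial M
  simple : ∀ W : Submodule K M, (∀ a, ∀ w ∈ W, Φ a w ∈ W) → (∀ w ∈ W, P w ∈ W) →
    W = ⊥ ∨ W = ⊤

/-! ## The basis vectors and the coefficients -/

/-- `u_{t,i} = u_+(res_t(i))`. -/
def uTab (rt : K → K) (Q : Fin m → K) {μ : Shape b m n} (t : Tab μ) (i : Fin n) : K :=
  uPlus rt (res Q t i)

/-- `𝔠_t(i) = 1 - 1/(u_{t,i} - u_{t,i+1})² - 1/(u_{t,i} + u_{t,i+1})²`. -/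
def cCoef (rt : K → K) (Q : Fin m → K) {μ : Shape b m n} (t : Tab μ) (i : Fin (n - 1)) : K :=
  1 - 1 / (uTab rt Q t (lo i) - uTab rt Q t (hi i)) ^ 2
    - 1 / (uTab rt Q t (lo i) + uTab rt Q t (hi i)) ^ 2

/-- The idempotent `γ_t = 2^{-⌊r/2⌋} ∏_k (1 + √-1 c_{d(i_{2k-1})} c_{d(i_{2k})})`, where `r` is
the number of diagonal boxes. -/
def gammaT (rt : K → K) (Q : Fin m → K) {μ : Shape b m n} (t : Tab μ) : CycSergeev b Q n :=
  ((2 : K)⁻¹ ^ (numDiag μ / 2)) •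
    (List.ofFn fun k : Fin (numDiag μ / 2) =>
      1 + rt (-1) • (gc b Q (dSeq t (2 * k.1) (by have := k.2; omega)) *
        gc b Q (dSeq t (2 * k.1 + 1) (by have := k.2; omega)))).prod

section Vectors

variable {rt : K → K} {Q : Fin m → K} {μ : Shape b m n}
  {L : IrrComponent rt (res Q (initial μ))}
  (Φ : CycSergeev b Q n →ₐ[K] Module.End K (DMod L)) (v : Std μ → L.space)

/-- The vector `c^β c^α v_t` of `D(μ)`. -/
def bvec (t : Std μ) (β α : Fin n → ZMod 2) : DMod L :=
  Φ (cMon b Q β * cMon b Q α) (Finsupp.single t (v t))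

/-- `RValue Φ v i β α t r` says that `r` is the vector `R(i, β, α, t)`, the expansion of
`c_i c_{i+1} c^β c^α v_t` in the basis; the constructors are the
cases of its definition, and at most one of them applies. As `dSeq` is numbered from `0`, the
letters `d(i_p)` with `p` odd are the `dSeq t (2 * p)`, and `dSeq t (2 * p)` precedes
`dSeq t (2 * p + 1)`. -/
inductive RValue (i : Fin (n - 1)) (β α : Fin n → ZMod 2) (t : Std μ) : DMod L → Prop
  | off (h : lo i ∉ diag t.1) (h' : hi i ∉ diag t.1) :
      RValue i β α t (sgn K (β (lo i)) • bvec Φ v t (β + stdVec (lo i) + stdVec (hi i)) α)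
  | lo_odd (p : ℕ) (hp : 2 * p < numDiag μ) (h : lo i = dSeq t.1 (2 * p) hp)
      (h' : hi i ∉ diag t.1) :
      RValue i β α t
        (sgn K (1 + sumGT β (lo i) + sumLT α (lo i)) •
          bvec Φ v t (β + stdVec (hi i)) (α + stdVec (lo i)))
  | lo_even (p : ℕ) (hp : 2 * p + 1 < numDiag μ) (h : lo i = dSeq t.1 (2 * p + 1) hp)
      (h' : hi i ∉ diag t.1) :
      RValue i β α t
        ((-rt (-1) * sgn K (1 + sumGT β (lo i) + sumLE α (dSeq t.1 (2 * p) (by omega)))) •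
          bvec Φ v t (β + stdVec (hi i)) (α + stdVec (dSeq t.1 (2 * p) (by omega))))
  | hi_odd (p : ℕ) (hp : 2 * p < numDiag μ) (h : hi i = dSeq t.1 (2 * p) hp)
      (h' : lo i ∉ diag t.1) :
      RValue i β α t
        (sgn K (sumGE β (lo i) + sumLT α (hi i)) •
          bvec Φ v t (β + stdVec (lo i)) (α + stdVec (hi i)))
  | hi_even (p : ℕ) (hp : 2 * p + 1 < numDiag μ) (h : hi i = dSeq t.1 (2 * p + 1) hp)
      (h' : lo i ∉ diag t.1) :
      RValue i β α t
        ((-rt (-1) * sgn K (sumGE β (lo i) + sumLE α (dSeq t.1 (2 * p) (by omega)))) •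
          bvec Φ v t (β + stdVec (lo i)) (α + stdVec (dSeq t.1 (2 * p) (by omega))))

open Classical in
/-- The vector `δ(s_i t) (-1)^{δ_β(i) δ_β(i+1)} √𝔠_t(i) c^{s_i β} c^{s_i α} v_{s_i t}`. -/
def swapTerm (i : Fin (n - 1)) (β α : Fin n → ZMod 2) (t : Std μ) : DMod L :=
  if h : IsStd (permTab (simple i) t.1) then
    (sgn K (β (lo i) * β (hi i)) * rt (cCoef rt Q t.1 i)) •
      bvec Φ v ⟨permTab (simple i) t.1, h⟩ (fun k => β ((simple i).symm k))
        (fun k => α ((simple i).symm k))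
  else 0

end Vectors

end Sergeev

end

open Sergeev

/-!
The proof rests on the numbers `q(res)` of the boxes, the eigenvalues of the `x_k²`.

Separateness is used in one form: if boxes `A` and then `B` can be added to a diagram of fewer than
`n` boxes, then `q(res A) ≠ q(res B)` (`q_boxRes_ne`), since some standard tableau with `n + 1` boxes
puts consecutive letters into `A` and `B`. Applied to neighbours of the boxes, it shows that `q(res)`
vanishes exactly on the diagonal of component `0` (`q_res_eq_zero_iff`), that the sequence of the
`q(res)` determines a standard tableau (`std_ext_of_q_res`), and that the scalar under the root in
`Ω_i` is nonzero if `s_i` exchanges two standard tableaux (`omegaSq_ne_zero`). It is zero if `s_i t`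
is not standard, for then the two letters lie in neighbouring boxes (`omegaSq_eq_zero`). Hence the
formula `s_i z = Ξ_i z + Ω_i z` needs no case distinction (`ds_emb`).

Put `A = q(res)`. The elements `C_a` and `Z_a = C_a X_a` all anticommute pairwise, with `C_a² = 1` and
`Z_a² = -A_a`, and `Ξ` is the product `-(A_a - A_b)⁻¹ (C_a - C_b) (Z_a - Z_b)` of two odd elements
(`xiOp`). This turns the relations for `Ξ` into short calculations. The braid relation follows from
a quadratic relation (`XCRel.xiOp_mul_xiOp`) if the outer two of the three scalars differ. If they
agree, no exchange is possible, and the position of the three boxes (`rigid_triple`) gives what is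
needed (`XCRel.braid_rigid`). So the operators define a representation (`exists_isDRep`).

For simplicity (`IsDRep.isSimpleSuper`), the `x_k²` separate the summands of `D(μ)`, each summand is
irreducible under the `x_k` and `c_k`, and the summands are connected by the invertible `Ω_i`, because
each standard tableau is reached from any other one by admissible exchanges (`forall_of_closed`).

For the basis, take a homogeneous vector `z` of `L(res t₀)` on which each `x_k` acts by `u_k` and which
is fixed by `√-1 c c'` for each pair `c`, `c'` of consecutive diagonal letters (`exists_isPolarized`).
It exists as these operators commute, have squares that are scalars, and are each negated by a `c_k`
that commutes with the others. The monomials `c^β c^α z` are joint eigenvectors, with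
different eigenvalues, of these operators and the parity, hence independent, and they span a submodule
(`IsPolarized.exists_basis`). All the `v_t` are the twists of the same `z`, so that the formulas for
the action are those for moving a `c_k` or a transposition through a monomial.
-/

noncomputable section

namespace Sergeev

/-! ### Diagrams as sets of boxes -/

section Diagrams

variable {b : Kind} {m n : ℕ}

/-- The boxes that may occur in a diagram: component `0` is present only for `Kind.strict`, and
there it is shifted, so that no box lies below the diagonal. -/
def ValidBox (b : Kind) (x : Box m) : Prop := x.1 = 0 → b ≠ Kind.zero ∧ x.2.1 ≤ x.2.2

/-- The right neighbour of a box. -/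
def rightBox (x : Box m) : Box m := (x.1, x.2.1, x.2.2 + 1)

/-- The lower neighbour of a box. -/
def downBox (x : Box m) : Box m := (x.1, x.2.1 + 1, x.2.2)

/-- A finite set of boxes that contains with each box its left and its upper neighbour, as far as
these are valid. -/
structure IsDiagram (b : Kind) (S : Finset (Box m)) : Prop where
  valid : ∀ x ∈ S, ValidBox b x
  right : ∀ x, ValidBox b x → rightBox x ∈ S → x ∈ S
  down : ∀ x, ValidBox b x → downBox x ∈ S → x ∈ S

theorem IsDiagram.union {S T : Finset (Box m)} (hS : IsDiagram b S) (hT : IsDiagram b T) :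
    IsDiagram b (S ∪ T) where
  valid x hx := (Finset.mem_union.1 hx).elim (hS.valid x) (hT.valid x)
  right x hx h := Finset.mem_union.2 ((Finset.mem_union.1 h).imp (hS.right x hx) (hT.right x hx))
  down x hx h := Finset.mem_union.2 ((Finset.mem_union.1 h).imp (hS.down x hx) (hT.down x hx))

theorem IsDiagram.insert_insert {S : Finset (Box m)} {A B : Box m}
    (hA : IsDiagram b (insert A S)) (hB : IsDiagram b (insert B S)) :
    IsDiagram b (insert B (insert A S)) := by
  have h := hB.union hA
  rwa [Finset.insert_union, Finset.union_eq_right.2 (Finset.subset_insert A S)] at h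

theorem Shape.mem_cells_zero (μ : Shape b m n) (i j : ℕ) :
    ((0 : Fin (m + 1)), i, j) ∈ μ.cells ↔ i ≤ j ∧ (i, j - i) ∈ μ.strictPart := by
  simp only [Shape.cells, Finset.mem_union, Finset.mem_image, Finset.mem_biUnion, Prod.mk.injEq,
    true_and, YoungDiagram.mem_cells, Prod.exists, Finset.mem_univ]
  constructor
  · rintro (⟨a, c, h, rfl, rfl⟩ | ⟨l, a, c, h, h0, _⟩)
    · simpa using h
    · exact absurd h0 (Fin.succ_ne_zero l)
  · rintro ⟨h, h'⟩
    exact Or.inl ⟨i, j - i, h', rfl, by omega⟩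

theorem Shape.mem_cells_succ (μ : Shape b m n) (l : Fin m) (i j : ℕ) :
    (l.succ, i, j) ∈ μ.cells ↔ (i, j) ∈ μ.part l := by
  simp only [Shape.cells, Finset.mem_union, Finset.mem_image, Finset.mem_biUnion, Prod.mk.injEq,
    true_and, YoungDiagram.mem_cells, Prod.exists, Finset.mem_univ, Fin.succ_inj]
  constructor
  · rintro (⟨a, c, h, h0, _⟩ | ⟨l', a, c, h, rfl, rfl, rfl⟩)
    · exact absurd h0.symm (Fin.succ_ne_zero l)
    · exact h
  · intro h
    exact Or.inr ⟨l, i, j, h, rfl, rfl, rfl⟩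

theorem Shape.isDiagram (μ : Shape b m n) : IsDiagram b μ.cells where
  valid := by
    rintro ⟨l, i, j⟩ hx (rfl : l = 0)
    rw [μ.mem_cells_zero] at hx
    refine ⟨fun hb => ?_, hx.1⟩
    rw [μ.strictPart_eq hb] at hx
    exact YoungDiagram.notMem_bot _ hx.2
  right := by
    rintro ⟨l, i, j⟩ hx h
    rcases Fin.eq_zero_or_eq_succ l with rfl | ⟨l, rfl⟩
    · have hij : i ≤ j := (hx rfl).2
      rw [rightBox, μ.mem_cells_zero] at h
      dsimp only at h
      rw [μ.mem_cells_zero]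
      exact ⟨hij, μ.strictPart.up_left_mem le_rfl (by omega) h.2⟩
    · rw [rightBox, μ.mem_cells_succ] at h
      rw [μ.mem_cells_succ]
      exact (μ.part l).up_left_mem le_rfl (Nat.le_succ j) h
  down := by
    rintro ⟨l, i, j⟩ hx h
    rcases Fin.eq_zero_or_eq_succ l with rfl | ⟨l, rfl⟩
    · rw [downBox, μ.mem_cells_zero] at h
      dsimp only at h
      rw [μ.mem_cells_zero]
      obtain ⟨h1, h2⟩ := h
      rw [YoungDiagram.mem_iff_lt_rowLen] at h2
      have h3 := μ.strict i (by omega)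
      refine ⟨by omega, ?_⟩
      rw [YoungDiagram.mem_iff_lt_rowLen]
      omega
    · rw [downBox, μ.mem_cells_succ] at h
      rw [μ.mem_cells_succ]
      exact (μ.part l).up_left_mem (Nat.le_succ i) le_rfl h

theorem exists_youngDiagram {X : Type*} (S : Finset X) {g : ℕ × ℕ → X}
    (hg : Function.Injective g) (hS : ∀ x y, y ≤ x → g x ∈ S → g y ∈ S) :
    ∃ Y : YoungDiagram, ∀ x, x ∈ Y ↔ g x ∈ S :=
  ⟨⟨S.preimage g hg.injOn, fun x y hyx hx => by
    simp only [Finset.coe_preimage, Set.mem_preimage, Finset.mem_coe] at hx ⊢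
    exact hS x y hyx hx⟩, fun x => by
    rw [← YoungDiagram.mem_cells]
    simp only [Finset.mem_preimage]⟩

/-- Every diagram is the set of boxes of a shape. -/
theorem IsDiagram.exists_shape {S : Finset (Box m)} (hS : IsDiagram b S) :
    ∃ ν : Shape b m S.card, ν.cells = S := by
  have row : ∀ (l : Fin (m + 1)) (i j k : ℕ), (l = 0 → i ≤ j) → j ≤ k → (l, i, k) ∈ S →
      (l, i, j) ∈ S := by
    intro l i j k hij hjk
    induction k, hjk using Nat.le_induction with
    | base => exact id
    | succ k hk ih =>
      intro h
      refine ih (hS.right (l, i, k) (fun hl => ⟨(hS.valid _ h hl).1, ?_⟩) h)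
      exact (hij hl).trans hk
  have col : ∀ (l : Fin (m + 1)) (i i' j : ℕ), i' ≤ i → (l, i, j) ∈ S → (l, i', j) ∈ S := by
    intro l i i' j hi
    induction i, hi using Nat.le_induction with
    | base => exact id
    | succ i hi ih =>
      intro h
      refine ih (hS.down (l, i, j) (fun hl => ⟨(hS.valid _ h hl).1, ?_⟩) h)
      have := (hS.valid _ h hl).2
      simp only at this ⊢
      omega
  obtain ⟨Y0, mem0⟩ := exists_youngDiagram S
      (g := fun x : ℕ × ℕ => ((0 : Fin (m + 1)), x.1, x.1 + x.2)) (by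
        rintro ⟨i, k⟩ ⟨i', k'⟩ h
        simp only [Prod.mk.injEq, true_and] at h
        ext <;> dsimp only <;> omega) (by
        rintro ⟨i, k⟩ ⟨i', k'⟩ ⟨hi, hk⟩ h
        dsimp only at hi hk h ⊢
        exact row _ _ _ (i + k) (fun _ => by omega) (by omega) (col _ _ _ _ hi h))
  have hY : ∀ l : Fin m, ∃ Y : YoungDiagram, ∀ x : ℕ × ℕ, x ∈ Y ↔ (l.succ, x.1, x.2) ∈ S :=
    fun l => exists_youngDiagram S
      (g := fun x : ℕ × ℕ => (l.succ, x.1, x.2)) (by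
        rintro ⟨i, k⟩ ⟨i', k'⟩ h
        simpa using h) (by
        rintro ⟨i, k⟩ ⟨i', k'⟩ ⟨hi, hk⟩ h
        exact row _ _ _ k (fun h0 => absurd h0 (Fin.succ_ne_zero l)) hk (col _ _ _ _ hi h))
  choose Y mem1 using hY
  let ν : Shape b m (Y0.card + ∑ l, (Y l).card) :=
    { strictPart := Y0
      strict := by
        intro i hi
        have h1 : (i + 1, Y0.rowLen (i + 1) - 1) ∈ Y0 := by
          rw [YoungDiagram.mem_iff_lt_rowLen]
          omega
        rw [mem0] at h1
        have h2 : (i, Y0.rowLen (i + 1)) ∈ Y0 := by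
          rw [mem0]
          have := col _ _ i _ (Nat.le_succ i) h1
          have e : i + 1 + (Y0.rowLen (i + 1) - 1) = i + Y0.rowLen (i + 1) := by omega
          rwa [e] at this
        rwa [YoungDiagram.mem_iff_lt_rowLen] at h2
      strictPart_eq := by
        intro hb
        refine le_bot_iff.1 fun x hx => ?_
        have := (mem0 x).1 hx
        exact absurd hb (hS.valid _ this rfl).1
      part := Y
      size := rfl }
  have hν : ν.cells = S := by
    ext ⟨l, i, j⟩
    rcases Fin.eq_zero_or_eq_succ l with rfl | ⟨l, rfl⟩
    · rw [ν.mem_cells_zero]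
      change _ ∧ _ ∈ Y0 ↔ _
      rw [mem0]
      dsimp only
      constructor
      · rintro ⟨h1, h2⟩
        rwa [Nat.add_sub_cancel' h1] at h2
      · intro h
        have := (hS.valid _ h rfl).2
        simp only at this
        rw [Nat.add_sub_cancel' this]
        exact ⟨this, h⟩
    · rw [ν.mem_cells_succ]
      exact mem1 l (i, j)
  have hc := ν.card_cells
  rw [hν] at hc
  rw [hc]
  exact ⟨ν, hν⟩

/-- A nonempty diagram can be enlarged, at the end of the first row of a component. -/
theorem IsDiagram.exists_superset {S : Finset (Box m)} (hS : IsDiagram b S) (hne : S.Nonempty)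
    {N : ℕ} (hN : S.card ≤ N) : ∃ T, S ⊆ T ∧ IsDiagram b T ∧ T.card = N := by
  induction N, hN using Nat.le_induction with
  | base => exact ⟨S, subset_rfl, hS, rfl⟩
  | succ N _ ih =>
    obtain ⟨T, hST, hT, hc⟩ := ih
    obtain ⟨⟨l, i, j⟩, hx⟩ := hne
    have hex : ∃ k, (l, 0, k) ∉ T := by
      by_contra! h
      have hinj : Function.Injective (fun k : ℕ => ((l, 0, k) : Box m)) := by
        intro a c h
        simpa using h
      exact Set.infinite_of_injective_forall_mem hinj (fun k => Finset.mem_coe.2 (h k))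
        T.finite_toSet
    classical
    have hk := Nat.find_spec hex
    have hmin := fun k => Nat.find_min hex (m := k)
    set k := Nat.find hex
    refine ⟨insert (l, 0, k) T, hST.trans (Finset.subset_insert _ _), ⟨?_, ?_, ?_⟩, ?_⟩
    · intro x hx'
      rcases Finset.mem_insert.1 hx' with rfl | hx'
      · exact fun hl => ⟨(hT.valid _ (hST hx) hl).1, Nat.zero_le _⟩
      · exact hT.valid x hx'
    · intro x hv hx'
      rcases Finset.mem_insert.1 hx' with h | hx'
      · obtain ⟨l', i', j'⟩ := x
        simp only [rightBox, Prod.mk.injEq] at h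
        obtain ⟨rfl, rfl, h⟩ := h
        exact Finset.mem_insert_of_mem (not_not.1 (hmin j' (by omega)))
      · exact Finset.mem_insert_of_mem (hT.right x hv hx')
    · intro x hv hx'
      rcases Finset.mem_insert.1 hx' with h | hx'
      · simp [downBox, Prod.ext_iff] at h
      · exact Finset.mem_insert_of_mem (hT.down x hv hx')
    · rw [Finset.card_insert_of_notMem hk, hc]

end Diagrams

/-! ### Tableaux from orderings of the boxes -/

section Sorting

variable {b : Kind} {m n : ℕ}

/-- The boxes of a shape can be numbered in the order of any injective key. -/
theorem exists_tab_of_key {α : Type*} [LinearOrder α] (μ : Shape b m n) (key : Box m ↪ α) :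
    ∃ t : Tab μ, ∀ x y, t x < t y ↔ key x.1 < key y.1 := by
  refine ⟨(Finset.equivMap key μ.cells).trans
    ((μ.cells.map key).orderIsoOfFin
      ((Finset.card_map _).trans μ.card_cells)).symm.toEquiv, fun x y => ?_⟩
  simp only [Equiv.trans_apply, RelIso.coe_fn_toEquiv, OrderIso.lt_iff_lt]
  exact Iff.rfl

theorem boxLex_lt_rightBox (x : Box m) : boxLex m x < boxLex m (rightBox x) := by
  change toLex (x.1, toLex x.2) < toLex (x.1, toLex (x.2.1, x.2.2 + 1))
  refine Prod.Lex.toLex_lt_toLex.2 (Or.inr ⟨rfl, Prod.Lex.toLex_lt_toLex.2 (Or.inr ⟨rfl, ?_⟩)⟩)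
  exact Nat.lt_succ_self _

theorem boxLex_lt_downBox (x : Box m) : boxLex m x < boxLex m (downBox x) := by
  change toLex (x.1, toLex x.2) < toLex (x.1, toLex (x.2.1 + 1, x.2.2))
  refine Prod.Lex.toLex_lt_toLex.2 (Or.inr ⟨rfl, Prod.Lex.toLex_lt_toLex.2 (Or.inl ?_)⟩)
  exact Nat.lt_succ_self _

theorem isStd_of_key {α : Type*} [LinearOrder α] {μ : Shape b m n} {t : Tab μ}
    {key : Box m ↪ α} (ht : ∀ x y, t x < t y ↔ key x.1 < key y.1)
    (hr : ∀ x ∈ μ.cells, rightBox x ∈ μ.cells → key x < key (rightBox x))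
    (hd : ∀ x ∈ μ.cells, downBox x ∈ μ.cells → key x < key (downBox x)) : IsStd t :=
  ⟨fun _ _ _ h h' => (ht _ _).2 (hr _ h h'), fun _ _ _ h h' => (ht _ _).2 (hd _ h h')⟩

theorem initial_lt_iff (μ : Shape b m n) (x y) :
    initial μ x < initial μ y ↔ boxLex m x.1 < boxLex m y.1 := by
  simp only [initial, Equiv.trans_apply, RelIso.coe_fn_toEquiv, OrderIso.lt_iff_lt]
  exact Iff.rfl

theorem isStd_initial (μ : Shape b m n) : IsStd (initial μ) :=
  isStd_of_key (initial_lt_iff μ) (fun x _ _ => boxLex_lt_rightBox x)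
    (fun x _ _ => boxLex_lt_downBox x)

/-- A diagram sorted by a level first and in reading order second. -/
def levelKey (m : ℕ) (f : Box m → ℕ) : Box m ↪ ℕ ×ₗ (Fin (m + 1) ×ₗ ℕ ×ₗ ℕ) :=
  ⟨fun x => toLex (f x, boxLex m x), fun x y h => by
    have := congrArg (fun z => (ofLex z).2) h
    exact (boxLex m).injective this⟩

theorem levelKey_lt {f : Box m → ℕ} {x y : Box m} (hf : f x ≤ f y)
    (h : boxLex m x < boxLex m y) : levelKey m f x < levelKey m f y := by
  rcases hf.lt_or_eq with hlt | heq
  · exact Prod.Lex.toLex_lt_toLex.2 (Or.inl hlt)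
  · exact Prod.Lex.toLex_lt_toLex.2 (Or.inr ⟨heq, h⟩)

end Sorting

/-! ### Consequences of separateness -/

section Separate

variable {b : Kind} {m n : ℕ} {K : Type*} [Field K] {Q : Fin m → K}

/-- The residue of a box. -/
def boxRes (Q : Fin m → K) (x : Box m) : K :=
  (Fin.cons 0 Q : Fin (m + 1) → K) x.1 + (x.2.2 : K) - (x.2.1 : K)

theorem res_eq_boxRes {μ : Shape b m n} (t : Tab μ) (k : Fin n) :
    res Q t k = boxRes Q (t.symm k).1 := rfl

theorem boxRes_rightBox (x : Box m) : boxRes Q (rightBox x) = boxRes Q x + 1 := by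
  simp only [boxRes, rightBox]; push_cast; ring

theorem boxRes_downBox (x : Box m) : boxRes Q (downBox x) = boxRes Q x - 1 := by
  simp only [boxRes, downBox]; push_cast; ring

/-- If `A` and then `B` can be added to a diagram, then `A` and `B` carry consecutive letters of
some standard tableau with `n + 1` boxes, and separateness applies to them. -/
theorem q_boxRes_ne (hsep : ∀ ν : Shape b m (n + 1), Separate Q ν) {S : Finset (Box m)}
    {A B : Box m} (hAS : A ∉ S) (hBS : B ∉ S) (hAB : A ≠ B) (hS : IsDiagram b S)
    (hA : IsDiagram b (insert A S)) (hB : IsDiagram b (insert B (insert A S)))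
    (hcard : S.card + 1 ≤ n) : q (boxRes Q A) ≠ q (boxRes Q B) := by
  classical
  have hBA : B ∉ insert A S := by simp [hBS, hAB.symm]
  obtain ⟨T, hsub, hT, hTc⟩ := hB.exists_superset (Finset.insert_nonempty _ _) (N := n + 1) (by
    rw [Finset.card_insert_of_notMem hBA, Finset.card_insert_of_notMem hAS]; omega)
  obtain ⟨ν, hν⟩ : ∃ ν : Shape b m (n + 1), ν.cells = T := by
    rw [← hTc]; exact hT.exists_shape
  -- sorting by this level puts `A` and `B` at consecutive places behind the boxes of `S`
  let f : Box m → ℕ := fun x => if x ∈ S then 0 else if x = A then 1 else if x = B then 2 else 3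
  have fA : f A = 1 := by simp [f, hAS]
  have fB : f B = 2 := by simp [f, hBS, hAB.symm]
  have f_le : ∀ x y, (y ∈ S → x ∈ S) → (y ∈ insert A S → x ∈ insert A S) →
      (y ∈ insert B (insert A S) → x ∈ insert B (insert A S)) → f x ≤ f y := by
    intro x y h0 h1 h2
    simp only [Finset.mem_insert] at h1 h2
    simp only [f]
    split_ifs <;> simp_all
  obtain ⟨t, ht⟩ := exists_tab_of_key ν (levelKey m f)
  have hstd : IsStd t := by
    refine isStd_of_key ht (fun x hx hx' => ?_) (fun x hx hx' => ?_)
    · have hv := hT.valid x (hν ▸ hx)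
      exact levelKey_lt (f_le _ _ (hS.right x hv) (hA.right x hv) (hB.right x hv))
        (boxLex_lt_rightBox x)
    · have hv := hT.valid x (hν ▸ hx)
      exact levelKey_lt (f_le _ _ (hS.down x hv) (hA.down x hv) (hB.down x hv))
        (boxLex_lt_downBox x)
  have hAν : A ∈ ν.cells := hν ▸ hsub (by simp)
  have hBν : B ∈ ν.cells := hν ▸ hsub (by simp)
  have hlt : t ⟨A, hAν⟩ < t ⟨B, hBν⟩ :=
    (ht _ _).2 (Prod.Lex.toLex_lt_toLex.2 (Or.inl (by rw [fA, fB]; norm_num)))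
  have hval : (t ⟨B, hBν⟩).val = (t ⟨A, hAν⟩).val + 1 := by
    by_contra hne
    have hlt' : (t ⟨A, hAν⟩).val < (t ⟨B, hBν⟩).val := hlt
    let k : Fin (n + 1) := ⟨(t ⟨A, hAν⟩).val + 1, by have := (t ⟨B, hBν⟩).2; omega⟩
    obtain ⟨x, hx⟩ := t.surjective k
    have h1 : t ⟨A, hAν⟩ < t x := by rw [hx]; exact Nat.lt_succ_self _
    have h2 : t x < t ⟨B, hBν⟩ := by rw [hx, Fin.lt_def]; simp only [k]; omega
    have k1 := (Prod.Lex.toLex_lt_toLex.1 ((ht _ _).1 h1))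
    have k2 := (Prod.Lex.toLex_lt_toLex.1 ((ht _ _).1 h2))
    simp only at k1 k2
    have hxA : x.1 ≠ A := by
      rintro h
      have : x = ⟨A, hAν⟩ := Subtype.ext h
      rw [this] at h1
      exact lt_irrefl _ h1
    have hxB : x.1 ≠ B := by
      rintro h
      have : x = ⟨B, hBν⟩ := Subtype.ext h
      rw [this] at h2
      exact lt_irrefl _ h2
    have fx : f x.1 = 0 ∨ f x.1 = 3 := by
      simp only [f, hxA, hxB, if_false]
      split_ifs <;> simp
    rw [fA] at k1
    rw [fB] at k2
    omega
  have key := hsep ν t hstd ⟨(t ⟨A, hAν⟩).val, by have := (t ⟨B, hBν⟩).2; simp; omega⟩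
  have e1 : lo (n := n + 1) ⟨(t ⟨A, hAν⟩).val, by have := (t ⟨B, hBν⟩).2; simp; omega⟩ =
    t ⟨A, hAν⟩ := rfl
  have e2 : hi (n := n + 1) ⟨(t ⟨A, hAν⟩).val, by have := (t ⟨B, hBν⟩).2; simp; omega⟩ =
    t ⟨B, hBν⟩ := Fin.ext hval.symm
  rw [e1, e2, res_eq_boxRes, res_eq_boxRes, Equiv.symm_apply_apply, Equiv.symm_apply_apply] at key
  exact key

theorem ne_rightBox (x : Box m) : x ≠ rightBox x := by simp [rightBox, Prod.ext_iff]

theorem ne_downBox (x : Box m) : x ≠ downBox x := by simp [downBox, Prod.ext_iff]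

theorem IsDiagram.erase {S : Finset (Box m)} {C : Box m} [DecidableEq (Box m)]
    (hS : IsDiagram b S)
    (hr : rightBox C ∉ S) (hd : downBox C ∉ S) : IsDiagram b (S.erase C) where
  valid x hx := hS.valid x (Finset.mem_of_mem_erase hx)
  right x hv hx := Finset.mem_erase.2 ⟨by
    rintro rfl
    exact hr (Finset.mem_of_mem_erase hx), hS.right x hv (Finset.mem_of_mem_erase hx)⟩
  down x hv hx := Finset.mem_erase.2 ⟨by
    rintro rfl
    exact hd (Finset.mem_of_mem_erase hx), hS.down x hv (Finset.mem_of_mem_erase hx)⟩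

/-- If `A` can be added to a diagram, then its right neighbour can be added next, unless the box
above `A`, which has the same residue as that neighbour, is removable. -/
theorem IsDiagram.rightBox_or {S : Finset (Box m)} {A : Box m} (hS : IsDiagram b S) (hAS : A ∉ S)
    (hA : IsDiagram b (insert A S)) :
    IsDiagram b (insert (rightBox A) (insert A S)) ∨
      ∃ C ∈ S, IsDiagram b (S.erase C) ∧ downBox C = A := by
  by_cases h : ∀ x, ValidBox b x → downBox x = rightBox A → x ∈ insert A S
  · left
    have hvA := hA.valid A (by simp)
    refine ⟨fun x hx => ?_, fun x hv hx => ?_, fun x hv hx => ?_⟩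
    · rcases Finset.mem_insert.1 hx with rfl | hx
      · exact fun h0 => ⟨(hvA h0).1, (hvA h0).2.trans (Nat.le_succ _)⟩
      · exact hA.valid x hx
    · rcases Finset.mem_insert.1 hx with h' | hx
      · have : x = A := by
          simpa [rightBox, Prod.ext_iff] using h'
        simp [this]
      · exact Finset.mem_insert_of_mem (hA.right x hv hx)
    · rcases Finset.mem_insert.1 hx with h' | hx
      · exact Finset.mem_insert_of_mem (h x hv h')
      · exact Finset.mem_insert_of_mem (hA.down x hv hx)
  · right
    push Not at h
    obtain ⟨⟨l, i, j⟩, hv, hx, hxS⟩ := h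
    obtain ⟨l', i', j'⟩ := A
    simp only [rightBox, downBox, Prod.mk.injEq] at hx
    obtain ⟨rfl, rfl, rfl⟩ := hx
    have hvC : ValidBox b (m := m) (l, i, j') := fun h0 => by
      refine ⟨(hv h0).1, ?_⟩
      have := (hA.valid _ (Finset.mem_insert_self _ _) h0).2
      simp only at this ⊢
      omega
    have hC := hA.down (l, i, j') hvC (Finset.mem_insert_self _ _)
    have hCS : (l, i, j') ∈ S := by
      rcases Finset.mem_insert.1 hC with h | h
      · simp at h
      · exact h
    exact ⟨(l, i, j'), hCS, hS.erase (fun h => hxS (Finset.mem_insert_of_mem h)) hAS, rfl⟩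

/-- If `A` can be added to a diagram and does not lie on the diagonal of component `0`, then its
lower neighbour can be added next, unless the box to the left of `A`, which has the same residue as
that neighbour, is removable. -/
theorem IsDiagram.downBox_or {S : Finset (Box m)} {A : Box m} (hS : IsDiagram b S) (hAS : A ∉ S)
    (hA : IsDiagram b (insert A S)) (hdiag : ¬ (A.1 = 0 ∧ A.2.1 = A.2.2)) :
    IsDiagram b (insert (downBox A) (insert A S)) ∨
      ∃ C ∈ S, IsDiagram b (S.erase C) ∧ rightBox C = A := by
  have hvA := hA.valid A (by simp)
  by_cases h : ∀ x, ValidBox b x → rightBox x = downBox A → x ∈ insert A S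
  · left
    refine ⟨fun x hx => ?_, fun x hv hx => ?_, fun x hv hx => ?_⟩
    · rcases Finset.mem_insert.1 hx with rfl | hx
      · refine fun h0 => ⟨(hvA h0).1, ?_⟩
        exact lt_of_le_of_ne (hvA h0).2 fun e => hdiag ⟨h0, e⟩
      · exact hA.valid x hx
    · rcases Finset.mem_insert.1 hx with h' | hx
      · exact Finset.mem_insert_of_mem (h x hv h')
      · exact Finset.mem_insert_of_mem (hA.right x hv hx)
    · rcases Finset.mem_insert.1 hx with h' | hx
      · have : x = A := by
          simpa [downBox, Prod.ext_iff] using h'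
        simp [this]
      · exact Finset.mem_insert_of_mem (hA.down x hv hx)
  · right
    push Not at h
    obtain ⟨⟨l, i, j⟩, hv, hx, hxS⟩ := h
    obtain ⟨l', i', j'⟩ := A
    simp only [rightBox, downBox, Prod.mk.injEq] at hx
    obtain ⟨rfl, rfl, rfl⟩ := hx
    have hvC : ValidBox b (m := m) (l, i', j) := fun h0 => by
      refine ⟨(hv h0).1, ?_⟩
      have := (hv h0).2
      simp only at this ⊢
      omega
    have hC := hA.right (l, i', j) hvC (Finset.mem_insert_self _ _)
    have hCS : (l, i', j) ∈ S := by
      rcases Finset.mem_insert.1 hC with h | h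
      · simp at h
      · exact h
    exact ⟨(l, i', j), hCS, hS.erase hAS (fun h => hxS (Finset.mem_insert_of_mem h)), rfl⟩

theorem q_eq_zero_iff (a : K) : q a = 0 ↔ a = 0 ∨ a = -1 := by
  rw [q, mul_eq_zero, ← eq_neg_iff_add_eq_zero]

/-- In a separate situation the number `q(res)` vanishes only on the diagonal of component `0`:
otherwise a neighbour of the box, of residue `-1` if the box has residue `0` and vice versa, could
carry a consecutive letter. -/
theorem q_boxRes_ne_zero (hsep : ∀ ν : Shape b m (n + 1), Separate Q ν) {S : Finset (Box m)}
    {A : Box m} (hS : IsDiagram b S) (hAS : A ∉ S) (hA : IsDiagram b (insert A S))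
    (hcard : S.card + 1 ≤ n) (hdiag : ¬ (A.1 = 0 ∧ A.2.1 = A.2.2)) : q (boxRes Q A) ≠ 0 := by
  classical
  have hvA := hA.valid A (by simp)
  have hremove : ∀ C ∈ S, IsDiagram b (S.erase C) → q (boxRes Q C) ≠ q (boxRes Q A) := by
    intro C hC hSC
    refine q_boxRes_ne hsep (Finset.notMem_erase _ _)
      (fun h => hAS (Finset.mem_of_mem_erase h)) (by rintro rfl; exact hAS hC) hSC ?_ ?_ ?_
    · rwa [Finset.insert_erase hC]
    · rwa [Finset.insert_erase hC]
    · rw [Finset.card_erase_of_mem hC]; omega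
  intro h0
  rcases (q_eq_zero_iff _).1 h0 with ha | ha
  · rcases hS.downBox_or hAS hA hdiag with h | ⟨C, hC, hSC, rfl⟩
    · have hnot : downBox A ∉ S := fun h' => hAS (hS.down A hvA h')
      refine q_boxRes_ne hsep hAS hnot (ne_downBox A) hS hA h hcard ?_
      rw [boxRes_downBox, h0, ha]
      simp [q]
    · refine hremove C hC hSC ?_
      rw [h0, q_eq_zero_iff]
      rw [boxRes_rightBox] at ha
      exact Or.inr (eq_neg_of_add_eq_zero_left ha)
  · rcases hS.rightBox_or hAS hA with h | ⟨C, hC, hSC, rfl⟩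
    · have hnot : rightBox A ∉ S := fun h' => hAS (hS.right A hvA h')
      refine q_boxRes_ne hsep hAS hnot (ne_rightBox A) hS hA h hcard ?_
      rw [boxRes_rightBox, h0, ha]
      simp [q]
    · refine hremove C hC hSC ?_
      rw [h0, q_eq_zero_iff]
      rw [boxRes_downBox] at ha
      left
      linear_combination ha

/-- Up to the symmetry `ι ↦ -1 - ι` of `q`, the left-hand side says that the residues `a` and `c`
differ by `1`. It is the condition for the scalar under the root in `Ω` to vanish. -/
theorem exceptional_iff (a c : K) :
    2 * (q a + q c) = (q a - q c) ^ 2 ↔ q c = q (a + 1) ∨ q c = q (a - 1) := by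
  have : (q a - q c) ^ 2 - 2 * (q a + q c) = (q c - q (a + 1)) * (q c - q (a - 1)) := by
    simp only [q]; ring
  rw [eq_comm, ← sub_eq_zero, this, mul_eq_zero, sub_eq_zero, sub_eq_zero]

/-- Two boxes that can be added to a diagram in either order do not have adjacent residues: if they
had, a neighbour of one of them, with the value of `q` that belongs to the other one, could be added
or removed next to it, against separateness. -/
theorem not_exceptional_of_addable (hsep : ∀ ν : Shape b m (n + 1), Separate Q ν)
    {S : Finset (Box m)} {A B : Box m} (hS : IsDiagram b S) (hAS : A ∉ S) (hBS : B ∉ S)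
    (hAB : A ≠ B) (hA : IsDiagram b (insert A S)) (hB : IsDiagram b (insert B S))
    (hcard : S.card + 2 ≤ n) :
    2 * (q (boxRes Q A) + q (boxRes Q B)) ≠ (q (boxRes Q A) - q (boxRes Q B)) ^ 2 := by
  classical
  have hvA := hA.valid A (by simp)
  have hremove : ∀ C ∈ S, IsDiagram b (S.erase C) → q (boxRes Q C) ≠ q (boxRes Q B) := by
    intro C hC hSC
    refine q_boxRes_ne hsep (Finset.notMem_erase _ _)
      (fun h => hBS (Finset.mem_of_mem_erase h)) (by rintro rfl; exact hBS hC) hSC ?_ ?_ ?_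
    · rwa [Finset.insert_erase hC]
    · rwa [Finset.insert_erase hC]
    · rw [Finset.card_erase_of_mem hC]; omega
  have hadd : ∀ D, (D ∈ insert B S → A ∈ insert B S) → D ≠ A → IsDiagram b (insert D (insert A S)) →
      q (boxRes Q B) ≠ q (boxRes Q D) := by
    intro D hD hDA h
    have hD' : D ∉ insert B S := fun h' => by
      have := hD h'
      simp [hAB, hAS] at this
    simp only [Finset.mem_insert, not_or] at hD'
    have hBA := hA.insert_insert hB
    refine q_boxRes_ne hsep (S := insert A S) (by simp [hBS, hAB.symm])
      (by simp [hD'.2, hDA]) (Ne.symm hD'.1) hA hBA (hBA.insert_insert h) ?_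
    rw [Finset.card_insert_of_notMem hAS]; omega
  rw [Ne, exceptional_iff]
  rintro (h | h)
  · rcases hS.rightBox_or hAS hA with h' | ⟨C, hC, hSC, rfl⟩
    · refine hadd _ (hB.right A hvA) (ne_rightBox A).symm h' ?_
      rw [boxRes_rightBox, h]
    · refine hremove C hC hSC ?_
      rw [h, boxRes_downBox, sub_add_cancel]
  · by_cases hdiag : A.1 = 0 ∧ A.2.1 = A.2.2
    · refine q_boxRes_ne hsep hAS hBS hAB hS hA (hA.insert_insert hB) (by omega) ?_
      rw [h]
      simp [boxRes, hdiag.1, hdiag.2, q]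
    · rcases hS.downBox_or hAS hA hdiag with h' | ⟨C, hC, hSC, rfl⟩
      · refine hadd _ (hB.down A hvA) (ne_downBox A).symm h' ?_
        rw [boxRes_downBox, h]
      · refine hremove C hC hSC ?_
        rw [h, boxRes_rightBox, add_sub_cancel_right]

end Separate

/-! ### Standard tableaux in the separate case -/

section Tableaux

variable {b : Kind} {m n : ℕ} {μ : Shape b m n}

theorem val_lo (i : Fin (n - 1)) : (lo i).val = i.val := rfl

theorem val_hi (i : Fin (n - 1)) : (hi i).val = i.val + 1 := rfl

theorem lo_lt_hi (i : Fin (n - 1)) : lo i < hi i := Nat.lt_succ_self i.val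

theorem lo_ne_hi (i : Fin (n - 1)) : lo i ≠ hi i := (lo_lt_hi i).ne

theorem simple_symm (i : Fin (n - 1)) : (simple i).symm = simple i := Equiv.symm_swap _ _

theorem simple_lo (i : Fin (n - 1)) : simple i (lo i) = hi i := Equiv.swap_apply_left _ _

theorem simple_hi (i : Fin (n - 1)) : simple i (hi i) = lo i := Equiv.swap_apply_right _ _

theorem simple_of_ne {i : Fin (n - 1)} {k : Fin n} (h : k ≠ lo i) (h' : k ≠ hi i) :
    simple i k = k := Equiv.swap_apply_of_ne_of_ne h h'

theorem simple_simple (i : Fin (n - 1)) (k : Fin n) : simple i (simple i k) = k :=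
  Equiv.swap_apply_self _ _ _

theorem permTab_symm_apply (w : Equiv.Perm (Fin n)) (t : Tab μ) (k : Fin n) :
    (permTab w t).symm k = t.symm (w.symm k) := rfl

theorem permTab_simple_permTab_simple (i : Fin (n - 1)) (t : Tab μ) :
    permTab (simple i) (permTab (simple i) t) = t := by
  ext x
  simp [permTab, simple_simple]

theorem dperm_symm_apply (t : Tab μ) (k : Fin n) :
    (dperm t).symm k = initial μ (t.symm k) := rfl

theorem dperm_permTab_symm (w : Equiv.Perm (Fin n)) (t : Tab μ) (k : Fin n) :
    (dperm (permTab w t)).symm k = (dperm t).symm (w.symm k) := rfl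

theorem mem_diag {t : Tab μ} {k : Fin n} :
    k ∈ diag t ↔ (t.symm k).1.1 = 0 ∧ (t.symm k).1.2.1 = (t.symm k).1.2.2 := by
  simp [diag]

theorem mem_diag_iff_initial {t : Tab μ} {k : Fin n} :
    k ∈ diag t ↔ (dperm t).symm k ∈ diag (initial μ) := by
  rw [mem_diag, mem_diag, dperm_symm_apply, Equiv.symm_apply_apply]

/-- The boxes that carry the first `k` letters. -/
def below (t : Tab μ) (k : ℕ) : Finset (Box m) :=
  (Finset.univ.filter fun j : Fin n => j.val < k).image fun j => (t.symm j).1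

theorem mem_below {t : Tab μ} {k : ℕ} {j : Fin n} : (t.symm j).1 ∈ below t k ↔ j.val < k := by
  simp only [below, Finset.mem_image, Finset.mem_filter, Finset.mem_univ, true_and]
  constructor
  · rintro ⟨j', h, e⟩
    have := t.symm.injective (Subtype.ext e)
    rwa [← this]
  · exact fun h => ⟨j, h, rfl⟩

theorem mem_below' {t : Tab μ} {k : ℕ} {x : Box m} (hx : x ∈ μ.cells) :
    x ∈ below t k ↔ (t ⟨x, hx⟩).val < k := by
  rw [← mem_below (t := t), Equiv.symm_apply_apply]

theorem below_subset (t : Tab μ) (k : ℕ) : below t k ⊆ μ.cells := by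
  intro x hx
  obtain ⟨j, -, rfl⟩ := Finset.mem_image.1 hx
  exact (t.symm j).2

theorem below_succ (t : Tab μ) (k : Fin n) :
    below t (k.val + 1) = insert (t.symm k).1 (below t k.val) := by
  ext x
  by_cases hx : x ∈ μ.cells
  · rw [Finset.mem_insert, mem_below' hx, mem_below' hx, Nat.lt_succ_iff_lt_or_eq, or_comm]
    refine or_congr ?_ Iff.rfl
    rw [← Fin.ext_iff, ← Equiv.eq_symm_apply, Subtype.ext_iff]
  · refine iff_of_false (fun h => hx (below_subset t _ h)) fun h => ?_
    rcases Finset.mem_insert.1 h with rfl | h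
    · exact hx (t.symm k).2
    · exact hx (below_subset t _ h)

theorem card_below_le (t : Tab μ) (k : ℕ) : (below t k).card ≤ k := by
  refine Finset.card_image_le.trans ?_
  have : (Finset.univ.filter fun j : Fin n => j.val < k).card =
      ((Finset.univ.filter fun j : Fin n => j.val < k).image Fin.val).card :=
    (Finset.card_image_of_injective _ Fin.val_injective).symm
  rw [this]
  refine (Finset.card_le_card (t := Finset.range k) ?_).trans_eq (Finset.card_range k)
  intro x hx
  obtain ⟨j, hj, rfl⟩ := Finset.mem_image.1 hx
  simpa using hj

theorem IsStd.isDiagram_below {t : Tab μ} (ht : IsStd t) (k : ℕ) : IsDiagram b (below t k) where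
  valid x hx := μ.isDiagram.valid x (below_subset t k hx)
  right x hv hx := by
    have h' := below_subset t k hx
    have h := μ.isDiagram.right x hv h'
    rw [mem_below' h'] at hx
    rw [mem_below' h]
    exact (Fin.lt_def.1 (ht.1 x.1 x.2.1 x.2.2 h h')).trans hx
  down x hv hx := by
    have h' := below_subset t k hx
    have h := μ.isDiagram.down x hv h'
    rw [mem_below' h'] at hx
    rw [mem_below' h]
    exact (Fin.lt_def.1 (ht.2 x.1 x.2.1 x.2.2 h h')).trans hx

theorem symm_notMem_below (t : Tab μ) (k : Fin n) : (t.symm k).1 ∉ below t k.val := fun h =>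
  lt_irrefl _ (mem_below.1 h)

theorem symm_ne_symm (t : Tab μ) {k l : Fin n} (h : k ≠ l) : (t.symm k).1 ≠ (t.symm l).1 :=
  fun e => h (t.symm.injective (Subtype.ext e))

/-- If exchanging two consecutive letters makes a standard tableau non-standard, then these
letters lie in neighbouring boxes. -/
theorem neighbour_of_not_isStd {t : Tab μ} (ht : IsStd t) {i : Fin (n - 1)}
    (hi' : ¬ IsStd (permTab (simple i) t)) :
    (t.symm (hi i)).1 = rightBox (t.symm (lo i)).1 ∨
      (t.symm (hi i)).1 = downBox (t.symm (lo i)).1 := by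
  have key : ∀ x y : {x // x ∈ μ.cells}, t x < t y → ¬ simple i (t x) < simple i (t y) →
      t x = lo i ∧ t y = hi i := by
    intro x y hlt hnot
    by_cases h1 : t x = lo i <;> by_cases h2 : t y = hi i
    · exact ⟨h1, h2⟩
    · exfalso
      have h3 : t y ≠ lo i := fun e => by rw [h1, e] at hlt; exact lt_irrefl _ hlt
      rw [h1, simple_lo, simple_of_ne h3 h2] at hnot
      rw [h1] at hlt
      simp only [Fin.lt_def, Fin.ext_iff, val_lo, val_hi] at *
      omega
    · exfalso
      have h3 : t x ≠ hi i := fun e => by rw [h2, e] at hlt; exact lt_irrefl _ hlt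
      rw [h2, simple_hi, simple_of_ne h1 h3] at hnot
      rw [h2] at hlt
      simp only [Fin.lt_def, Fin.ext_iff, val_lo, val_hi] at *
      omega
    · exfalso
      by_cases h3 : t x = hi i
      · have h4 : t y ≠ lo i := fun e => by
          rw [h3, e] at hlt; exact absurd hlt (lo_lt_hi i).not_gt
        rw [h3, simple_hi, simple_of_ne h4 h2] at hnot
        rw [h3] at hlt
        exact hnot ((lo_lt_hi i).trans hlt)
      · rw [simple_of_ne h1 h3] at hnot
        by_cases h4 : t y = lo i
        · rw [h4, simple_lo] at hnot
          rw [h4] at hlt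
          exact hnot (hlt.trans (lo_lt_hi i))
        · rw [simple_of_ne h4 h2] at hnot
          exact hnot hlt
  rw [IsStd, not_and_or] at hi'
  rcases hi' with h | h
  · push Not at h
    obtain ⟨l, r, c, h1, h2, h3⟩ := h
    obtain ⟨e1, e2⟩ := key _ _ (ht.1 l r c h1 h2) (not_lt.2 h3)
    left
    rw [← e1, ← e2, Equiv.symm_apply_apply, Equiv.symm_apply_apply]
    rfl
  · push Not at h
    obtain ⟨l, r, c, h1, h2, h3⟩ := h
    obtain ⟨e1, e2⟩ := key _ _ (ht.2 l r c h1 h2) (not_lt.2 h3)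
    right
    rw [← e1, ← e2, Equiv.symm_apply_apply, Equiv.symm_apply_apply]
    rfl

/-- A nonempty set of standard tableaux that is closed under admissible exchanges contains the
initial tableau `t₀`: among its tableaux `d t₀`, one that maximizes `∑ k d⁻¹(k)` is `t₀`. -/
theorem initial_of_closed {P : Std μ → Prop} (hP : ∃ t, P t)
    (hcl : ∀ t, P t → ∀ (i : Fin (n - 1)) (h : IsStd (permTab (simple i) t.1)),
      P ⟨permTab (simple i) t.1, h⟩) : P ⟨initial μ, isStd_initial μ⟩ := by
  classical
  let f : Std μ → ℤ := fun t => ∑ k : Fin n, (k.val : ℤ) * ((dperm t.1).symm k).val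
  obtain ⟨t0, ht0⟩ := hP
  obtain ⟨t, htP, hmax⟩ := (Finset.univ.filter P).exists_max_image f ⟨t0, by simpa using ht0⟩
  simp only [Finset.mem_filter, Finset.mem_univ, true_and] at htP hmax
  have hstep : ∀ i : Fin (n - 1), (dperm t.1).symm (lo i) < (dperm t.1).symm (hi i) := by
    intro i
    by_contra hnot
    have hgt : (dperm t.1).symm (hi i) < (dperm t.1).symm (lo i) :=
      lt_of_le_of_ne (not_lt.1 hnot) fun e => lo_ne_hi i ((dperm t.1).symm.injective e.symm)
    have hstd : IsStd (permTab (simple i) t.1) := by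
      by_contra hns
      have hgt' := hgt
      rw [dperm_symm_apply, dperm_symm_apply, initial_lt_iff] at hgt'
      rcases neighbour_of_not_isStd t.2 hns with h | h
      · rw [h] at hgt'
        exact absurd hgt' (boxLex_lt_rightBox _).not_gt
      · rw [h] at hgt'
        exact absurd hgt' (boxLex_lt_downBox _).not_gt
    have hle := hmax _ (hcl t htP i hstd)
    have e1 : f ⟨permTab (simple i) t.1, hstd⟩ =
        ∑ k : Fin n, ((simple i k).val : ℤ) * ((dperm t.1).symm k).val := by
      simp only [f, dperm_permTab_symm, simple_symm]
      refine Fintype.sum_equiv (simple i) _ _ fun k => ?_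
      rw [simple_simple]
    have e2 : f ⟨permTab (simple i) t.1, hstd⟩ - f t =
        ((dperm t.1).symm (lo i)).val - ((dperm t.1).symm (hi i)).val := by
      rw [e1, ← Finset.sum_sub_distrib,
        ← Finset.sum_subset (Finset.subset_univ {lo i, hi i}), Finset.sum_pair (lo_ne_hi i),
        simple_lo, simple_hi, val_lo, val_hi]
      · push_cast; ring
      · intro k _ hk
        simp only [Finset.mem_insert, Finset.mem_singleton, not_or] at hk
        rw [simple_of_ne hk.1 hk.2, sub_self]
    rw [Fin.lt_def] at hgt
    omega
  have hmono : StrictMono (dperm t.1).symm := by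
    obtain _ | n := n
    · exact fun x => x.elim0
    · rw [Fin.strictMono_iff_lt_succ]
      exact fun i => hstep i
  have hid : (dperm t.1).symm = 1 := by
    have h := Subsingleton.elim (hmono.orderIsoOfSurjective _ (dperm t.1).symm.surjective)
      (OrderIso.refl _)
    ext k
    exact congrArg (fun e : Fin n ≃o Fin n => (e k).val) h
  have : t = ⟨initial μ, isStd_initial μ⟩ := by
    refine Subtype.ext (Equiv.symm_bijective.injective (Equiv.ext fun k => ?_))
    have h := dperm_symm_apply t.1 k
    rw [hid, Equiv.Perm.one_apply] at h
    change t.1.symm k = (initial μ).symm k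
    rw [Equiv.eq_symm_apply, ← h]
  rwa [← this]

/-- The standard tableaux of a shape are connected by admissible exchanges. -/
theorem forall_of_closed {P : Std μ → Prop} (hP : ∃ t, P t)
    (hcl : ∀ t, P t → ∀ (i : Fin (n - 1)) (h : IsStd (permTab (simple i) t.1)),
      P ⟨permTab (simple i) t.1, h⟩) (t : Std μ) : P t := by
  by_contra ht
  refine initial_of_closed (P := fun t => ¬ P t) ⟨t, ht⟩ (fun t ht i h h' => ht ?_)
    (initial_of_closed hP hcl)
  have h2 : IsStd (permTab (simple i) (permTab (simple i) t.1)) := by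
    rw [permTab_simple_permTab_simple]; exact t.2
  have := hcl _ h' i h2
  simpa only [permTab_simple_permTab_simple] using this

variable {K : Type*} [Field K] {Q : Fin m → K}

theorem res_eq_res_initial (t : Tab μ) (k : Fin n) :
    res Q t k = res Q (initial μ) ((dperm t).symm k) := by
  rw [res_eq_boxRes, res_eq_boxRes, dperm_symm_apply, Equiv.symm_apply_apply]

theorem q_res_of_mem_diag {t : Tab μ} {k : Fin n} (h : k ∈ diag t) : q (res Q t k) = 0 := by
  rw [mem_diag] at h
  rw [res_eq_boxRes]
  simp [boxRes, h.1, h.2, q]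

section Separated

variable (hsep : ∀ ν : Shape b m (n + 1), Separate Q ν)
include hsep

theorem q_res_ne_zero {t : Tab μ} (ht : IsStd t) {k : Fin n} (h : k ∉ diag t) :
    q (res Q t k) ≠ 0 := by
  rw [mem_diag] at h
  refine q_boxRes_ne_zero hsep (ht.isDiagram_below k.val) (symm_notMem_below t k) ?_ ?_ h
  · rw [← below_succ]; exact ht.isDiagram_below _
  · have := card_below_le t k.val
    omega

theorem q_res_eq_zero_iff {t : Tab μ} (ht : IsStd t) {k : Fin n} :
    q (res Q t k) = 0 ↔ k ∈ diag t :=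
  ⟨fun h => by_contra fun h' => q_res_ne_zero hsep ht h' h, q_res_of_mem_diag⟩

theorem q_res_lo_ne_hi {t : Tab μ} (ht : IsStd t) (i : Fin (n - 1)) :
    q (res Q t (lo i)) ≠ q (res Q t (hi i)) := by
  have hh := below_succ t (hi i)
  rw [val_hi, ← val_lo, below_succ] at hh
  refine q_boxRes_ne hsep (symm_notMem_below t (lo i)) (fun h => ?_) (symm_ne_symm t (lo_ne_hi i))
    (ht.isDiagram_below _) ?_ ?_ ?_
  · have := mem_below.1 h
    rw [val_hi, val_lo] at this
    omega
  · rw [← below_succ]; exact ht.isDiagram_below _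
  · rw [← hh]; exact ht.isDiagram_below _
  · have := card_below_le t (lo i).val
    have := (lo i).2
    omega

theorem not_exceptional_of_isStd {t : Tab μ} (ht : IsStd t) {i : Fin (n - 1)}
    (ht' : IsStd (permTab (simple i) t)) :
    2 * (q (res Q t (lo i)) + q (res Q t (hi i))) ≠
      (q (res Q t (lo i)) - q (res Q t (hi i))) ^ 2 := by
  have e : below (permTab (simple i) t) (lo i).val = below t (lo i).val := by
    ext x
    by_cases hx : x ∈ μ.cells
    · rw [mem_below' hx, mem_below' hx]
      change (simple i (t ⟨x, hx⟩)).val < _ ↔ _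
      by_cases h1 : t ⟨x, hx⟩ = lo i
      · rw [h1, simple_lo, val_hi, val_lo]; omega
      · by_cases h2 : t ⟨x, hx⟩ = hi i
        · rw [h2, simple_hi, val_hi, val_lo]; omega
        · rw [simple_of_ne h1 h2]
    · exact iff_of_false (fun h => hx (below_subset _ _ h)) (fun h => hx (below_subset _ _ h))
  have e2 := below_succ (permTab (simple i) t) (lo i)
  rw [e, permTab_symm_apply, simple_symm, simple_lo] at e2
  refine not_exceptional_of_addable hsep (ht.isDiagram_below (lo i).val)
    (symm_notMem_below t (lo i)) (fun h => ?_) (symm_ne_symm t (lo_ne_hi i)) ?_ ?_ ?_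
  · have := mem_below.1 h
    rw [val_hi, val_lo] at this
    omega
  · rw [← below_succ]; exact ht.isDiagram_below _
  · rw [← e2]; exact ht'.isDiagram_below _
  · have := card_below_le t (lo i).val
    have := (hi i).2
    rw [val_hi] at this
    rw [val_lo] at *
    omega

omit hsep in
theorem exceptional_of_not_isStd {t : Tab μ} (ht : IsStd t) {i : Fin (n - 1)}
    (ht' : ¬ IsStd (permTab (simple i) t)) :
    2 * (q (res Q t (lo i)) + q (res Q t (hi i))) =
      (q (res Q t (lo i)) - q (res Q t (hi i))) ^ 2 := by
  rw [exceptional_iff, res_eq_boxRes, res_eq_boxRes]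
  rcases neighbour_of_not_isStd ht ht' with h | h
  · left; rw [h, boxRes_rightBox]
  · right; rw [h, boxRes_downBox]

/-- A standard tableau is determined by the sequence of the numbers `q(res)`: two tableaux with
the same sequence that differ for the first time in two boxes would allow to add both boxes
consecutively. -/
theorem std_ext_of_q_res {t t' : Std μ} (h : ∀ k, q (res Q t.1 k) = q (res Q t'.1 k)) : t = t' := by
  have key : ∀ k : ℕ, k ≤ n → ∀ j : Fin n, j.val < k → t.1.symm j = t'.1.symm j := by
    intro k
    induction k with
    | zero => intro _ j hj; omega
    | succ k ih =>
      intro hk j hj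
      rcases Nat.lt_succ_iff_lt_or_eq.1 hj with hj | hj
      · exact ih (by omega) j hj
      · have ih := ih (by omega)
        subst hj
        have e : below t.1 j.val = below t'.1 j.val := by
          refine Finset.image_congr fun l hl => ?_
          simp only [Finset.coe_filter, Finset.mem_univ, true_and, Set.mem_ofPred_eq] at hl
          exact congrArg _ (ih l hl)
        by_contra hne
        have hne' : (t.1.symm j).1 ≠ (t'.1.symm j).1 := fun e => hne (Subtype.ext e)
        have h1 := t.2.isDiagram_below (j.val + 1)
        have h2 := t'.2.isDiagram_below (j.val + 1)
        rw [below_succ] at h1 h2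
        rw [← e] at h2
        refine q_boxRes_ne hsep (symm_notMem_below t.1 j) (fun h => ?_) hne'
          (t.2.isDiagram_below j.val) h1 (h1.insert_insert h2) ?_ (h j)
        · rw [e] at h
          exact symm_notMem_below t'.1 j h
        · have := card_below_le t.1 j.val
          omega
  exact Subtype.ext (Equiv.symm_bijective.injective (Equiv.ext fun k => key n le_rfl k k.2))

omit hsep in
/-- Three consecutive letters no two neighbours of which can be exchanged, the outer ones with the
same value of `q(res)`: either their boxes form the hook on the shifted diagonal, or they form a
row or a column, and then the values `A`, `B`, `A` of `q(res)` satisfy `A + 3 B = 0`. -/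
theorem rigid_triple {t : Tab μ} (ht : IsStd t) {i j : Fin (n - 1)} (hij : i.val + 1 = j.val)
    (hi' : ¬ IsStd (permTab (simple i) t)) (hj' : ¬ IsStd (permTab (simple j) t))
    (h : q (res Q t (lo i)) = q (res Q t (hi j))) :
    (q (res Q t (lo i)) = 0 ∧ q (res Q t (hi j)) = 0) ∨
      q (res Q t (lo i)) + 3 * q (res Q t (hi i)) = 0 := by
  have ehl : lo j = hi i := Fin.ext hij.symm
  have h1 := neighbour_of_not_isStd ht hi'
  have h2 := neighbour_of_not_isStd ht hj'
  rw [ehl] at h2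
  set A := (t.symm (lo i)).1 with hA
  set B := (t.symm (hi i)).1 with hB
  set C := (t.symm (hi j)).1 with hC
  have hAm : A ∈ μ.cells := (t.symm (lo i)).2
  have hCm : C ∈ μ.cells := (t.symm (hi j)).2
  have hvA := μ.isDiagram.valid A hAm
  have tA : t ⟨A, hAm⟩ = lo i := t.apply_symm_apply _
  have tC : t ⟨C, hCm⟩ = hi j := t.apply_symm_apply _
  have hmid : ∀ D (hD : D ∈ μ.cells), t ⟨A, hAm⟩ < t ⟨D, hD⟩ → t ⟨D, hD⟩ < t ⟨C, hCm⟩ → D = B := by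
    intro D hD hlt hlt'
    rw [tA, Fin.lt_def, val_lo] at hlt
    rw [tC, Fin.lt_def, val_hi] at hlt'
    have : t ⟨D, hD⟩ = hi i := Fin.ext (by rw [val_hi]; omega)
    rw [hB, ← this, Equiv.symm_apply_apply]
  change q (boxRes Q A) = q (boxRes Q C) at h
  change (q (boxRes Q A) = 0 ∧ q (boxRes Q C) = 0) ∨ q (boxRes Q A) + 3 * q (boxRes Q B) = 0
  rcases h1 with h1 | h1 <;> rcases h2 with h2 | h2
  · right
    rw [h2, h1, boxRes_rightBox, boxRes_rightBox] at h
    rw [h1, boxRes_rightBox]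
    simp only [q] at *
    linear_combination (-(boxRes Q A) - 1) * h
  · left
    by_cases hv : ValidBox b (downBox A)
    · exfalso
      have hD : downBox A ∈ μ.cells := by
        refine μ.isDiagram.right _ hv ?_
        have : rightBox (downBox A) = C := by rw [h2, h1]; rfl
        rw [this]; exact hCm
      have hb := hmid _ hD (ht.2 A.1 A.2.1 A.2.2 hAm hD) (by
        have : C = rightBox (downBox A) := by rw [h2, h1]; rfl
        have hm : rightBox (downBox A) ∈ μ.cells := this ▸ hCm
        have h' := ht.1 A.1 (A.2.1 + 1) A.2.2 hD hm
        have e : (⟨C, hCm⟩ : {x // x ∈ μ.cells}) = ⟨_, hm⟩ := Subtype.ext this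
        rw [e]
        exact h')
      rw [h1] at hb
      simp [downBox, rightBox, Prod.ext_iff] at hb
    · have hd : A.1 = 0 ∧ A.2.1 = A.2.2 := by
        simp only [ValidBox, downBox] at hv
        push Not at hv
        obtain ⟨h0, h'⟩ := hv
        have := (hvA h0).2
        have := h' (hvA h0).1
        exact ⟨h0, by omega⟩
      have : q (boxRes Q A) = 0 := by simp [boxRes, hd.1, hd.2, q]
      exact ⟨this, h ▸ this⟩
  · exfalso
    have hv : ValidBox b (rightBox A) := fun h0 => ⟨(hvA h0).1, (hvA h0).2.trans (Nat.le_succ _)⟩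
    have hD : rightBox A ∈ μ.cells := by
      refine μ.isDiagram.down _ hv ?_
      have : downBox (rightBox A) = C := by rw [h2, h1]; rfl
      rw [this]; exact hCm
    have hb := hmid _ hD (ht.1 A.1 A.2.1 A.2.2 hAm hD) (by
      have : C = downBox (rightBox A) := by rw [h2, h1]; rfl
      have hm : downBox (rightBox A) ∈ μ.cells := this ▸ hCm
      have h' := ht.2 A.1 A.2.1 (A.2.2 + 1) hD hm
      have e : (⟨C, hCm⟩ : {x // x ∈ μ.cells}) = ⟨_, hm⟩ := Subtype.ext this
      rw [e]
      exact h')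
    rw [h1] at hb
    simp [downBox, rightBox, Prod.ext_iff] at hb
  · right
    rw [h2, h1, boxRes_downBox, boxRes_downBox] at h
    rw [h1, boxRes_downBox]
    simp only [q] at *
    linear_combination (boxRes Q A) * h

end Separated

end Tableaux

/-! ### The intertwining elements in a Clifford algebra -/

section Clifford

variable {K R I : Type*} [Field K] [Ring R] [Algebra K R]

/-- Elements `X i`, `C i` that satisfy the relations among the `x_i` and `c_i`, with the squares
of the `X i` equal to the scalars `A i`. -/
structure XCRel (A : I → K) (X C : I → R) : Prop where
  x_comm : ∀ i j, X i * X j = X j * X i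
  x_sq : ∀ i, X i * X i = A i • (1 : R)
  c_sq : ∀ i, C i * C i = 1
  c_anti : ∀ i j, i ≠ j → C i * C j = -(C j * C i)
  x_c : ∀ i, X i * C i = -(C i * X i)
  x_c_of_ne : ∀ i j, i ≠ j → X i * C j = C j * X i

/-- The element `(C a - C b) (C a X a - C b X b) = X a + X b + C a C b (X a - X b)`. -/
def yOp (X C : I → R) (a b : I) : R := (C a - C b) * (C a * X a - C b * X b)

/-- The element `-(1/(X a - X b) + C a C b 1/(X a + X b))`, in a form without inverses of elements
of the algebra. -/
def xiOp (A : I → K) (X C : I → R) (a b : I) : R := -(A a - A b)⁻¹ • yOp X C a b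

/-- The scalar under the root in the definition of `Ω`. -/
def omegaSq (A : I → K) (a b : I) : K := 1 - 2 * (A a + A b) / (A a - A b) ^ 2

theorem omegaSq_symm (A : I → K) (a b : I) : omegaSq A a b = omegaSq A b a := by
  rw [omegaSq, omegaSq, add_comm (A a), ← neg_sub (A b), neg_sq]

namespace XCRel

variable {A : I → K} {X C : I → R} (h : XCRel A X C)
include h

theorem z_sq (i : I) : (C i * X i) * (C i * X i) = -A i • (1 : R) := by
  calc (C i * X i) * (C i * X i) = C i * (X i * C i) * X i := by noncomm_ring
    _ = -((C i * C i) * (X i * X i)) := by rw [h.x_c]; noncomm_ring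
    _ = -A i • (1 : R) := by rw [h.c_sq, h.x_sq, one_mul, neg_smul]

theorem c_z (i j : I) : C i * (C j * X j) = -((C j * X j) * C i) := by
  by_cases hij : i = j
  · subst hij
    rw [mul_assoc, h.x_c]; noncomm_ring
  · rw [mul_assoc, h.x_c_of_ne j i (Ne.symm hij), ← mul_assoc, ← mul_assoc, h.c_anti i j hij,
      neg_mul]

theorem x_z_of_ne (i j : I) (hij : i ≠ j) : X i * (C j * X j) = (C j * X j) * X i := by
  rw [← mul_assoc, h.x_c_of_ne i j hij, mul_assoc, mul_assoc, h.x_comm]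

theorem z_anti (i j : I) (hij : i ≠ j) :
    (C i * X i) * (C j * X j) = -((C j * X j) * (C i * X i)) := by
  rw [mul_assoc, h.x_z_of_ne i j hij, ← mul_assoc, h.c_z, neg_mul, mul_assoc]

theorem yOp_eq (a b : I) (hab : a ≠ b) :
    yOp X C a b = X a + X b + C a * C b * (X a - X b) := by
  calc yOp X C a b = C a * C a * X a + C b * C b * X b - C a * C b * X b - C b * C a * X a := by
        rw [yOp]; noncomm_ring
    _ = _ := by rw [h.c_sq, h.c_sq, h.c_anti b a hab.symm]; noncomm_ring

omit h in
theorem yOp_symm (X C : I → R) (a b : I) : yOp X C b a = yOp X C a b := by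
  rw [yOp, yOp]; noncomm_ring

omit h in
theorem xiOp_symm (A : I → K) (X C : I → R) (a b : I) : xiOp A X C b a = -xiOp A X C a b := by
  rw [xiOp, xiOp, yOp_symm, ← neg_sub (A a), inv_neg, neg_neg, neg_smul, neg_neg]

/-- Two odd elements of the two families anticommute. -/
theorem subC_mul_subZ (a b c d : I) : (C a - C b) * (C c * X c - C d * X d) =
    -((C c * X c - C d * X d) * (C a - C b)) := by
  have h1 := h.c_z a c
  have h2 := h.c_z a d
  have h3 := h.c_z b c
  have h4 := h.c_z b d
  rw [sub_mul, mul_sub, mul_sub, h1, h2, h3, h4]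
  noncomm_ring

theorem subC_sq (a b : I) (hab : a ≠ b) : (C a - C b) * (C a - C b) = (2 : K) • (1 : R) := by
  rw [sub_mul, mul_sub, mul_sub, h.c_sq, h.c_sq, h.c_anti b a hab.symm, two_smul]
  noncomm_ring

theorem subZ_sq (a b : I) (hab : a ≠ b) : (C a * X a - C b * X b) * (C a * X a - C b * X b) =
    (-(A a + A b)) • (1 : R) := by
  rw [sub_mul, mul_sub, mul_sub, h.z_sq, h.z_sq, h.z_anti b a hab.symm]
  module

theorem subC_mul_subC (a b c : I) (hab : a ≠ b) (hac : a ≠ c) (hbc : b ≠ c) :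
    (C b - C c) * (C a - C b) = (-2 : K) • (1 : R) - (C a - C b) * (C b - C c) := by
  rw [sub_mul, mul_sub, mul_sub, sub_mul, mul_sub, mul_sub, h.c_sq, h.c_anti b a hab.symm,
    h.c_anti c a hac.symm, h.c_anti c b hbc.symm]
  module

theorem subZ_mul_subZ (a b c : I) (hab : a ≠ b) (hac : a ≠ c) (hbc : b ≠ c) :
    (C b * X b - C c * X c) * (C a * X a - C b * X b) =
      (2 * A b) • (1 : R) - (C a * X a - C b * X b) * (C b * X b - C c * X c) := by
  rw [sub_mul, mul_sub, mul_sub, sub_mul, mul_sub, mul_sub, h.z_sq, h.z_anti b a hab.symm,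
    h.z_anti c a hac.symm, h.z_anti c b hbc.symm]
  module

theorem yOp_sq (a b : I) (hab : a ≠ b) :
    yOp X C a b * yOp X C a b = (2 * (A a + A b)) • (1 : R) := by
  have h1 := h.subC_mul_subZ a b a b
  have h2 := h.subC_sq a b hab
  have h3 := h.subZ_sq a b hab
  simp only [yOp]
  set p := C a - C b
  set P := C a * X a - C b * X b
  calc p * P * (p * P) = p * (P * p) * P := by noncomm_ring
    _ = -((p * p) * (P * P)) := by rw [← neg_neg (P * p), ← h1]; noncomm_ring
    _ = _ := by rw [h2, h3]; simp only [smul_mul_smul_comm, one_mul]; module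

theorem xiOp_sq (a b : I) (hab : a ≠ b) :
    xiOp A X C a b * xiOp A X C a b = (2 * (A a + A b) / (A a - A b) ^ 2) • (1 : R) := by
  rw [xiOp, smul_mul_smul_comm, h.yOp_sq a b hab, smul_smul, div_eq_mul_inv, ← inv_pow]
  congr 1
  ring

/-- The quadratic relation behind the braid relation: with `p = C a - C b`, `q = C b - C c` and the
analogous `P`, `Q`, all three products are multiples of `2 + p q` by polynomials in `P Q`. -/
theorem yOp_mul_yOp (a b c : I) (hab : a ≠ b) (hac : a ≠ c) (hbc : b ≠ c) :
    (A a - A b) • (yOp X C a c * yOp X C b c) + (A b - A c) • (yOp X C a b * yOp X C a c) =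
      (A a - A c) • (yOp X C b c * yOp X C a b) := by
  have hpp := h.subC_sq a b hab
  have hqq := h.subC_sq b c hbc
  have hPP := h.subZ_sq a b hab
  have hQQ := h.subZ_sq b c hbc
  have hpq := h.subC_mul_subC a b c hab hac hbc
  have hPQ := h.subZ_mul_subZ a b c hab hac hbc
  have hP1 : (C a * X a - C c * X c) * (C b - C c) = -((C b - C c) * (C a * X a - C c * X c)) := by
    rw [h.subC_mul_subZ b c a c, neg_neg]
  have hP2 : (C a * X a - C b * X b) * (C a - C c) = -((C a - C c) * (C a * X a - C b * X b)) := by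
    rw [h.subC_mul_subZ a c a b, neg_neg]
  have hP3 : (C b * X b - C c * X c) * (C a - C b) = -((C a - C b) * (C b * X b - C c * X c)) := by
    rw [h.subC_mul_subZ a b b c, neg_neg]
  have e1 : C a - C c = (C a - C b) + (C b - C c) := by abel
  have e2 : C a * X a - C c * X c = (C a * X a - C b * X b) + (C b * X b - C c * X c) := by abel
  simp only [yOp]
  rw [e1] at hP2 ⊢
  rw [e2] at hP1 ⊢
  set p := C a - C b
  set q := C b - C c
  set P := C a * X a - C b * X b
  set Q := C b * X b - C c * X c
  have f1 : (p + q) * (P + Q) * (q * Q) =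
      -(((2 : K) • (1 : R) + p * q) * (P * Q - (A b + A c) • (1 : R))) := by
    calc (p + q) * (P + Q) * (q * Q) = (p + q) * ((P + Q) * q) * Q := by noncomm_ring
      _ = -((p * q + q * q) * (P * Q + Q * Q)) := by rw [hP1]; noncomm_ring
      _ = _ := by rw [hqq, hQQ, neg_smul, add_comm (p * q), sub_eq_add_neg]
  have f2 : p * P * ((p + q) * (P + Q)) =
      -(((2 : K) • (1 : R) + p * q) * (P * Q - (A a + A b) • (1 : R))) := by
    calc p * P * ((p + q) * (P + Q)) = p * (P * (p + q)) * (P + Q) := by noncomm_ring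
      _ = -((p * p + p * q) * (P * P + P * Q)) := by rw [hP2]; noncomm_ring
      _ = _ := by rw [hpp, hPP, neg_smul, neg_add_eq_sub]
  have f3 : q * Q * (p * P) = ((2 : K) • (1 : R) + p * q) * ((2 * A b) • (1 : R) - P * Q) := by
    calc q * Q * (p * P) = q * (Q * p) * P := by noncomm_ring
      _ = -((q * p) * (Q * P)) := by rw [hP3]; noncomm_ring
      _ = _ := by rw [hpq, hPQ, ← neg_mul, neg_sub, neg_smul, sub_neg_eq_add, add_comm]
  rw [f1, f2, f3]
  simp only [mul_sub, mul_smul_comm, mul_one]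
  module

theorem xiOp_mul_xiOp (a b c : I) (hab : A a ≠ A b) (hac : A a ≠ A c) (hbc : A b ≠ A c) :
    xiOp A X C a c * xiOp A X C b c + xiOp A X C a b * xiOp A X C a c =
      xiOp A X C b c * xiOp A X C a b := by
  have key := h.yOp_mul_yOp a b c (fun e => hab (congrArg A e)) (fun e => hac (congrArg A e))
    (fun e => hbc (congrArg A e))
  have h1 := sub_ne_zero.2 hab
  have h2 := sub_ne_zero.2 hac
  have h3 := sub_ne_zero.2 hbc
  simp only [xiOp, smul_mul_smul_comm]
  have e := congrArg (fun z => ((A a - A b)⁻¹ * (A a - A c)⁻¹ * (A b - A c)⁻¹) • z) key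
  simp only [smul_add, smul_smul] at e
  convert e using 2
  · congr 1; field_simp
  · congr 1; field_simp
  · field_simp

/-- The companion of `xiOp_mul_xiOp` obtained by exchanging `a` and `c`. -/
theorem xiOp_mul_xiOp' (a b c : I) (hab : A a ≠ A b) (hac : A a ≠ A c) (hbc : A b ≠ A c) :
    xiOp A X C a c * xiOp A X C a b + xiOp A X C b c * xiOp A X C a c =
      xiOp A X C a b * xiOp A X C b c := by
  have := h.xiOp_mul_xiOp c b a hbc.symm hac.symm hab.symm
  rw [xiOp_symm A X C a c, xiOp_symm A X C a b, xiOp_symm A X C b c] at this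
  simpa only [neg_mul_neg] using this

/-- The diagonal coefficient of the braid relation. -/
theorem braid_generic (a b c : I) (hab : A a ≠ A b) (hac : A a ≠ A c) (hbc : A b ≠ A c) :
    xiOp A X C a b * xiOp A X C b c * xiOp A X C a b + omegaSq A a b • xiOp A X C a c =
      xiOp A X C b c * xiOp A X C a b * xiOp A X C b c + omegaSq A b c • xiOp A X C a c := by
  have h1 := h.xiOp_mul_xiOp a b c hab hac hbc
  have h2 := h.xiOp_mul_xiOp' a b c hab hac hbc
  have h3 := h.xiOp_sq a b (fun e => hab (congrArg A e))
  have h4 := h.xiOp_sq b c (fun e => hbc (congrArg A e))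
  rw [omegaSq, omegaSq]
  set x := xiOp A X C a b
  set y := xiOp A X C b c
  set z := xiOp A X C a c
  set s := 2 * (A a + A b) / (A a - A b) ^ 2
  set r := 2 * (A b + A c) / (A b - A c) ^ 2
  have e1 : x * y * x = x * z * y + s • z := by
    rw [mul_assoc, ← h1, mul_add, ← mul_assoc, ← mul_assoc, h3, smul_one_mul]
  have e2 : y * x * y = y * z * x + r • z := by
    rw [mul_assoc, ← h2, mul_add, ← mul_assoc, ← mul_assoc, h4, smul_one_mul]
  have e3 : y * x * y = x * z * y + r • z := by
    rw [← h1, add_mul, mul_assoc z, h4, mul_smul_one, add_comm]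
  rw [e1, e3]
  module

/-- The diagonal coefficient of the braid relation for a triple in which the outer scalars
agree. -/
theorem braid_rigid (a b c : I) (hab : a ≠ b) (hac : a ≠ c) (hbc : b ≠ c) (hA : A a = A c)
    (h0 : X a = 0 ∧ X c = 0 ∨ A a + 3 * A b = 0) :
    xiOp A X C a b * xiOp A X C b c * xiOp A X C a b =
      xiOp A X C b c * xiOp A X C a b * xiOp A X C b c := by
  have hpp := h.subC_sq a b hab
  have hqq := h.subC_sq b c hbc
  have hPP := h.subZ_sq a b hab
  have hQQ := h.subZ_sq b c hbc
  have hpq := h.subC_mul_subC a b c hab hac hbc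
  have hPQ := h.subZ_mul_subZ a b c hab hac hbc
  have a1 := h.subC_mul_subZ a b a b
  have a2 := h.subC_mul_subZ a b b c
  have a3 := h.subC_mul_subZ b c a b
  have a4 := h.subC_mul_subZ b c b c
  have hsum : (A a + 3 * A b) • ((C a * X a - C b * X b) + (C b * X b - C c * X c)) = 0 := by
    rcases h0 with ⟨ha, hc⟩ | h0
    · rw [ha, hc]; simp
    · rw [h0, zero_smul]
  simp only [xiOp, yOp, smul_mul_smul_comm]
  set p := C a - C b
  set q := C b - C c
  set P := C a * X a - C b * X b
  set Q := C b * X b - C c * X c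
  have f1 : p * P * (q * Q) * (p * P) = -((p * q * p) * (P * Q * P)) := by
    calc p * P * (q * Q) * (p * P) = p * (P * q) * (Q * p) * P := by noncomm_ring
      _ = p * q * (P * p) * Q * P := by
        rw [← neg_neg (P * q), ← a3, ← neg_neg (Q * p), ← a2]; noncomm_ring
      _ = _ := by rw [← neg_neg (P * p), ← a1]; noncomm_ring
  have f2 : q * Q * (p * P) * (q * Q) = -((q * p * q) * (Q * P * Q)) := by
    calc q * Q * (p * P) * (q * Q) = q * (Q * p) * (P * q) * Q := by noncomm_ring
      _ = q * p * (Q * q) * P * Q := by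
        rw [← neg_neg (P * q), ← a3, ← neg_neg (Q * p), ← a2]; noncomm_ring
      _ = _ := by rw [← neg_neg (Q * q), ← a4]; noncomm_ring
  have g1 : p * q * p = (-2 : K) • (p + q) := by
    rw [mul_assoc, hpq, mul_sub, ← mul_assoc, hpp, mul_smul_one, smul_one_mul]; module
  have g2 : q * p * q = (-2 : K) • (p + q) := by
    rw [hpq, sub_mul, mul_assoc, hqq, smul_one_mul, mul_smul_one]; module
  have g3 : P * Q * P = (2 * A b) • P + (A a + A b) • Q := by
    rw [mul_assoc, hPQ, mul_sub, ← mul_assoc, hPP, mul_smul_one, smul_one_mul]; module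
  have g4 : Q * P * Q = (2 * A b) • Q + (A b + A c) • P := by
    rw [hPQ, sub_mul, mul_assoc, hQQ, smul_one_mul, mul_smul_one]; module
  have hzero : (p * q * p) * (P * Q * P) + (q * p * q) * (Q * P * Q) = 0 := by
    rw [g1, g2, ← mul_add, g3, g4, ← hA]
    have : (2 * A b) • P + (A a + A b) • Q + ((2 * A b) • Q + (A b + A a) • P) =
        (A a + 3 * A b) • (P + Q) := by module
    rw [this, hsum, mul_zero]
  rw [f1, f2, eq_neg_of_add_eq_zero_left hzero, ← hA, ← neg_sub (A a) (A b)]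
  simp only [inv_neg]
  module

theorem xiOp_mul_x (a b : I) (hab : A a ≠ A b) :
    xiOp A X C a b * X a = X b * xiOp A X C a b - (1 + C a * C b) := by
  have hne : a ≠ b := fun e => hab (congrArg A e)
  have hcc : X b * (C a * C b) = -(C a * C b * X b) := by
    rw [← mul_assoc, h.x_c_of_ne b a hne.symm, mul_assoc, h.x_c, mul_neg, ← mul_assoc]
  have e : yOp X C a b * X a = X b * yOp X C a b + (A a - A b) • (1 + C a * C b) := by
    rw [h.yOp_eq a b hne, add_mul, add_mul, mul_assoc, sub_mul, h.x_sq, mul_add, mul_add,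
      h.x_sq, ← mul_assoc (X b) (C a * C b), hcc, neg_mul, mul_assoc (C a * C b), mul_sub, mul_sub,
      mul_sub, h.x_sq]
    simp only [mul_smul_one]
    module
  rw [xiOp, smul_mul_assoc, e, smul_add, smul_smul, mul_smul_comm, neg_mul,
    inv_mul_cancel₀ (sub_ne_zero.2 hab), neg_one_smul]
  exact (sub_eq_add_neg _ _).symm

theorem xiOp_mul_c (a b : I) :
    xiOp A X C a b * C a = C b * xiOp A X C a b := by
  have e : yOp X C a b * C a = C b * yOp X C a b := by
    have h1 : (C a * X a - C b * X b) * C a = -(C a * (C a * X a - C b * X b)) := by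
      rw [sub_mul, mul_sub, h.c_z a a, h.c_z a b]; abel
    rw [yOp, mul_assoc, h1, mul_neg, ← mul_assoc, ← mul_assoc, ← neg_mul]
    congr 1
    rw [sub_mul, mul_sub, h.c_sq, h.c_sq]; abel
  rw [xiOp, smul_mul_assoc, e, mul_smul_comm]

theorem xiOp_mul_c' (a b : I) :
    xiOp A X C a b * C b = C a * xiOp A X C a b := by
  have := h.xiOp_mul_c b a
  rwa [xiOp_symm, neg_mul, mul_neg, neg_inj] at this

theorem commute_xiOp_x (a b j : I) (ha : j ≠ a) (hb : j ≠ b) :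
    Commute (xiOp A X C a b) (X j) := by
  have h1 : ∀ i, j ≠ i → Commute (C i) (X j) := fun i hi => (h.x_c_of_ne j i hi).symm
  have h2 : ∀ i, Commute (X i) (X j) := fun i => h.x_comm i j
  exact (((h1 a ha).sub_left (h1 b hb)).mul_left
    (((h1 a ha).mul_left (h2 a)).sub_left ((h1 b hb).mul_left (h2 b)))).smul_left _

theorem commute_xiOp_c (a b j : I) (ha : j ≠ a) (hb : j ≠ b) :
    Commute (xiOp A X C a b) (C j) := by
  have h1 : ∀ i, j ≠ i → C i * C j = -(C j * C i) := fun i hi => h.c_anti i j hi.symm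
  have h2 : (C a - C b) * C j = -(C j * (C a - C b)) := by
    rw [sub_mul, mul_sub, h1 a ha, h1 b hb]; abel
  have h3 : (C a * X a - C b * X b) * C j = -(C j * (C a * X a - C b * X b)) := by
    rw [sub_mul, mul_sub, h.c_z j a, h.c_z j b]; abel
  have : Commute (yOp X C a b) (C j) := by
    rw [Commute, SemiconjBy, yOp, mul_assoc, h3, mul_neg, ← mul_assoc, h2, neg_mul, neg_neg,
      mul_assoc]
  exact this.smul_left _

omit h in
theorem commute_xiOp_of_odd {P : R} (hx : ∀ i, P * X i = X i * P) (hc : ∀ i, P * C i = -(C i * P))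
    (a b : I) : Commute P (xiOp A X C a b) := by
  have h1 : P * (C a - C b) = -((C a - C b) * P) := by
    rw [mul_sub, sub_mul, hc, hc]; abel
  have h2 : ∀ i, P * (C i * X i) = -((C i * X i) * P) := fun i => by
    rw [← mul_assoc, hc, neg_mul, mul_assoc, hx, mul_assoc]
  have h3 : P * (C a * X a - C b * X b) = -((C a * X a - C b * X b) * P) := by
    rw [mul_sub, sub_mul, h2, h2]; abel
  refine Commute.smul_right ?_ _
  rw [Commute, SemiconjBy, yOp, ← mul_assoc, h1, neg_mul, mul_assoc, h3, mul_neg, neg_neg,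
    mul_assoc]

theorem commute_xiOp_xiOp (a b c d : I) (hac : c ≠ a) (hbc : c ≠ b) (had : d ≠ a) (hbd : d ≠ b) :
    Commute (xiOp A X C a b) (xiOp A X C c d) := by
  have c1 := h.commute_xiOp_c a b c hac hbc
  have c2 := h.commute_xiOp_c a b d had hbd
  have x1 := h.commute_xiOp_x a b c hac hbc
  have x2 := h.commute_xiOp_x a b d had hbd
  exact ((c1.sub_right c2).mul_right ((c1.mul_right x1).sub_right (c2.mul_right x2))).smul_right _

omit h in
theorem inverse_eq_of_mul {u v : R} {s : K} (hs : s ≠ 0) (h1 : u * v = s • (1 : R))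
    (h2 : v * u = s • (1 : R)) : Ring.inverse u = s⁻¹ • v := by
  let U : Rˣ := ⟨u, s⁻¹ • v, by rw [mul_smul_comm, h1, smul_smul, inv_mul_cancel₀ hs, one_smul],
    by rw [smul_mul_assoc, h2, smul_smul, inv_mul_cancel₀ hs, one_smul]⟩
  exact Ring.inverse_unit U

theorem x_add_mul_x_sub (a b : I) : (X a + X b) * (X a - X b) = (A a - A b) • (1 : R) := by
  rw [add_mul, mul_sub, mul_sub, h.x_sq, h.x_sq, h.x_comm b a]; module

theorem x_sub_mul_x_add (a b : I) : (X a - X b) * (X a + X b) = (A a - A b) • (1 : R) := by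
  rw [sub_mul, mul_add, mul_add, h.x_sq, h.x_sq, h.x_comm b a]; module

theorem inverse_sub (a b : I) (hab : A a ≠ A b) :
    Ring.inverse (X a - X b) = (A a - A b)⁻¹ • (X a + X b) :=
  inverse_eq_of_mul (sub_ne_zero.2 hab) (h.x_sub_mul_x_add a b) (h.x_add_mul_x_sub a b)

theorem inverse_add (a b : I) (hab : A a ≠ A b) :
    Ring.inverse (X a + X b) = (A a - A b)⁻¹ • (X a - X b) :=
  inverse_eq_of_mul (sub_ne_zero.2 hab) (h.x_add_mul_x_sub a b) (h.x_sub_mul_x_add a b)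

theorem xiOp_eq_inverse (a b : I) (hab : A a ≠ A b) :
    -(Ring.inverse (X a - X b) + C a * C b * Ring.inverse (X a + X b)) = xiOp A X C a b := by
  rw [h.inverse_sub a b hab, h.inverse_add a b hab, xiOp, h.yOp_eq a b fun e => hab (congrArg A e),
    mul_smul_comm, ← smul_add, neg_smul]

theorem omega_eq_inverse (a b : I) (hab : A a ≠ A b) :
    1 - Ring.inverse (X a - X b) ^ 2 - Ring.inverse (X a + X b) ^ 2 = omegaSq A a b • (1 : R) := by
  rw [h.inverse_sub a b hab, h.inverse_add a b hab, smul_pow, smul_pow, sub_sub, ← smul_add]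
  have : (X a + X b) ^ 2 + (X a - X b) ^ 2 = (2 * (A a + A b)) • (1 : R) := by
    have e : (X a + X b) ^ 2 + (X a - X b) ^ 2 = (2 : K) • (X a * X a + X b * X b) := by
      rw [two_smul]; noncomm_ring
    rw [e, h.x_sq, h.x_sq]; module
  rw [this, omegaSq, sub_smul, one_smul, smul_smul, div_eq_mul_inv, ← inv_pow]
  congr 2
  ring

end XCRel

end Clifford

/-! ### Operators on the tensor product and on its irreducible components -/

section Tensor

variable {K : Type*} [Field K]

theorem sgn_zero : sgn K 0 = 1 := if_pos rfl

theorem sgn_one : sgn K 1 = -1 := if_neg one_ne_zero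

theorem zmod_two_cases (a : ZMod 2) : a = 0 ∨ a = 1 := by
  revert a; decide

theorem sgn_add (a c : ZMod 2) : sgn K (a + c) = sgn K a * sgn K c := by
  have h11 : (1 : ZMod 2) + 1 = 0 := by decide
  rcases zmod_two_cases a with rfl | rfl <;> rcases zmod_two_cases c with rfl | rfl <;>
    simp [sgn_zero, sgn_one, h11]

theorem sgn_mul_self (a : ZMod 2) : sgn K a * sgn K a = 1 := by
  rcases zmod_two_cases a with rfl | rfl <;> simp [sgn_zero, sgn_one]

theorem sgn_add_one (a : ZMod 2) : sgn K (a + 1) = -sgn K a := by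
  rw [sgn_add, sgn_one, mul_neg_one]

variable {n : ℕ}

theorem vec_add_self (β : Fin n → ZMod 2) : β + β = 0 := by
  ext k; exact CharTwo.add_self_eq_zero _

theorem add_stdVec_add_stdVec (β : Fin n → ZMod 2) (i : Fin n) :
    β + stdVec i + stdVec i = β := by
  rw [add_assoc, vec_add_self, add_zero]

theorem sumLT_add (β γ : Fin n → ZMod 2) (i : Fin n) :
    sumLT (β + γ) i = sumLT β i + sumLT γ i := Finset.sum_add_distrib

theorem sumLT_stdVec_of_lt {i j : Fin n} (h : j < i) : sumLT (stdVec j) i = 1 := by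
  rw [sumLT, stdVec, Finset.sum_pi_single']
  simp [h]

theorem sumLT_stdVec_of_le {i j : Fin n} (h : i ≤ j) : sumLT (stdVec j) i = 0 := by
  rw [sumLT, stdVec, Finset.sum_pi_single']
  simp [h]

theorem sumAll_add (β γ : Fin n → ZMod 2) : sumAll (β + γ) = sumAll β + sumAll γ :=
  Finset.sum_add_distrib

theorem sumAll_stdVec (i : Fin n) : sumAll (stdVec i) = 1 := by
  rw [sumAll, stdVec, Finset.sum_pi_single']
  simp

theorem stdVec_self (i : Fin n) : stdVec i i = 1 := Pi.single_eq_same _ _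

theorem stdVec_of_ne {i j : Fin n} (h : j ≠ i) : stdVec i j = 0 := Pi.single_eq_of_ne h _

variable {rt : K → K} {ι : Fin n → K}

theorem tx_single (i : Fin n) (β : Fin n → ZMod 2) :
    tx rt ι i (Pi.single β 1) = (sgn K (β i) * uPlus rt (ι i)) • Pi.single β 1 := by
  have := (Pi.basisFun K (Fin n → ZMod 2)).constr_basis K (fun β =>
    (sgn K (β i) * uPlus rt (ι i)) • (Pi.single β 1 : TensorSpace K n)) β
  rwa [Pi.basisFun_apply] at this

theorem tc_single (i : Fin n) (β : Fin n → ZMod 2) :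
    tc K i (Pi.single β 1) = sgn K (sumLT β i) • Pi.single (β + stdVec i) 1 := by
  have := (Pi.basisFun K (Fin n → ZMod 2)).constr_basis K (fun β =>
    sgn K (sumLT β i) • (Pi.single (β + stdVec i) 1 : TensorSpace K n)) β
  rwa [Pi.basisFun_apply] at this

theorem tpar_single (β : Fin n → ZMod 2) :
    tpar K n (Pi.single β 1) = sgn K (sumAll β) • Pi.single β 1 := by
  have := (Pi.basisFun K (Fin n → ZMod 2)).constr_basis K (fun β =>
    sgn K (sumAll β) • (Pi.single β 1 : TensorSpace K n)) β
  rwa [Pi.basisFun_apply] at this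

theorem tensor_ext {f g : Module.End K (TensorSpace K n)}
    (h : ∀ β, f (Pi.single β 1) = g (Pi.single β 1)) : f = g :=
  (Pi.basisFun K (Fin n → ZMod 2)).ext fun β => by rw [Pi.basisFun_apply, h]

theorem xcRel_tensor (hrt : ∀ a : K, rt a ^ 2 = a) :
    XCRel (fun i => q (ι i)) (tx rt ι) (tc K (n := n)) where
  x_comm i j := tensor_ext fun β => by
    simp only [Module.End.mul_apply, tx_single, map_smul, smul_smul]
    rw [mul_comm]
  x_sq i := tensor_ext fun β => by
    simp only [Module.End.mul_apply, tx_single, map_smul, smul_smul, LinearMap.smul_apply,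
      Module.End.one_apply]
    rw [mul_mul_mul_comm, sgn_mul_self, one_mul, uPlus, ← sq, hrt]
  c_sq i := tensor_ext fun β => by
    simp only [Module.End.mul_apply, tc_single, map_smul, smul_smul, Module.End.one_apply]
    rw [sumLT_add, sumLT_stdVec_of_le le_rfl, add_zero, sgn_mul_self, one_smul,
      add_stdVec_add_stdVec]
  c_anti i j hij := tensor_ext fun β => by
    simp only [Module.End.mul_apply, tc_single, map_smul, smul_smul, LinearMap.neg_apply,
      sumLT_add, add_assoc, add_comm (stdVec j) (stdVec i), ← neg_smul]
    congr 1
    rcases lt_or_gt_of_ne hij with h | h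
    · rw [sumLT_stdVec_of_lt h, sumLT_stdVec_of_le h.le, add_zero, sgn_add_one]; ring
    · rw [sumLT_stdVec_of_lt h, sumLT_stdVec_of_le h.le, add_zero, sgn_add_one]; ring
  x_c i := tensor_ext fun β => by
    simp only [Module.End.mul_apply, tc_single, tx_single, map_smul, smul_smul,
      LinearMap.neg_apply, ← neg_smul]
    rw [Pi.add_apply, stdVec_self, sgn_add_one]
    congr 1; ring
  x_c_of_ne i j hij := tensor_ext fun β => by
    simp only [Module.End.mul_apply, tc_single, tx_single, map_smul, smul_smul]
    rw [Pi.add_apply, stdVec_of_ne hij, add_zero, mul_comm]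

theorem tpar_sq : tpar K n * tpar K n = 1 := tensor_ext fun β => by
  simp only [Module.End.mul_apply, tpar_single, map_smul, smul_smul, Module.End.one_apply,
    sgn_mul_self, one_smul]

theorem tpar_mul_tx (i : Fin n) : tpar K n * tx rt ι i = tx rt ι i * tpar K n :=
  tensor_ext fun β => by
    simp only [Module.End.mul_apply, tpar_single, tx_single, map_smul, smul_smul, mul_comm]

theorem tpar_mul_tc (i : Fin n) : tpar K n * tc K i = -(tc K i * tpar K n) :=
  tensor_ext fun β => by
    simp only [Module.End.mul_apply, tpar_single, tc_single, map_smul, smul_smul,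
      LinearMap.neg_apply, ← neg_smul]
    rw [sumAll_add, sumAll_stdVec, sgn_add_one]
    congr 1; ring

theorem tx_eq_zero (hrt : ∀ a : K, rt a ^ 2 = a) {i : Fin n} (h : q (ι i) = 0) :
    tx rt ι i = 0 := by
  have h0 : uPlus rt (ι i) = 0 := by
    rw [uPlus, h]
    exact pow_eq_zero_iff two_ne_zero |>.1 (hrt 0)
  exact tensor_ext fun β => by simp [tx_single, h0]

variable (L : IrrComponent rt ι)

theorem IrrComponent.xcRel (hrt : ∀ a : K, rt a ^ 2 = a) :
    XCRel (fun i => q (ι i)) L.x L.c where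
  x_comm i j := LinearMap.ext fun z => Subtype.ext
    (LinearMap.congr_fun ((xcRel_tensor (ι := ι) hrt).x_comm i j) z.1)
  x_sq i := LinearMap.ext fun z => Subtype.ext
    (LinearMap.congr_fun ((xcRel_tensor (ι := ι) hrt).x_sq i) z.1)
  c_sq i := LinearMap.ext fun z => Subtype.ext
    (LinearMap.congr_fun ((xcRel_tensor (ι := ι) hrt).c_sq i) z.1)
  c_anti i j hij := LinearMap.ext fun z => Subtype.ext
    (LinearMap.congr_fun ((xcRel_tensor (ι := ι) hrt).c_anti i j hij) z.1)
  x_c i := LinearMap.ext fun z => Subtype.ext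
    (LinearMap.congr_fun ((xcRel_tensor (ι := ι) hrt).x_c i) z.1)
  x_c_of_ne i j hij := LinearMap.ext fun z => Subtype.ext
    (LinearMap.congr_fun ((xcRel_tensor (ι := ι) hrt).x_c_of_ne i j hij) z.1)

theorem IrrComponent.par_sq : L.par * L.par = 1 := LinearMap.ext fun z => Subtype.ext
  (LinearMap.congr_fun tpar_sq z.1)

theorem IrrComponent.par_mul_x (i : Fin n) : L.par * L.x i = L.x i * L.par :=
  LinearMap.ext fun z => Subtype.ext (LinearMap.congr_fun (tpar_mul_tx (rt := rt) (ι := ι) i) z.1)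

theorem IrrComponent.par_mul_c (i : Fin n) : L.par * L.c i = -(L.c i * L.par) :=
  LinearMap.ext fun z => Subtype.ext (LinearMap.congr_fun (tpar_mul_tc i) z.1)

theorem IrrComponent.x_eq_zero (hrt : ∀ a : K, rt a ^ 2 = a) {i : Fin n} (h : q (ι i) = 0) :
    L.x i = 0 := LinearMap.ext fun z => Subtype.ext (LinearMap.congr_fun (tx_eq_zero hrt h) z.1)

theorem IrrComponent.nontrivial : Nontrivial L.space :=
  Submodule.nontrivial_iff_ne_bot.2 L.ne_bot

/-- A nonzero subspace of an irreducible component that is stable under the `x_i`, the `c_i` and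
the parity is everything. -/
theorem IrrComponent.eq_top {W : Submodule K L.space} (hx : ∀ i, ∀ z ∈ W, L.x i z ∈ W)
    (hc : ∀ i, ∀ z ∈ W, L.c i z ∈ W) (hp : ∀ z ∈ W, L.par z ∈ W) (hne : W ≠ ⊥) : W = ⊤ := by
  have hle : W.map L.space.subtype ≤ L.space := Submodule.map_subtype_le _ _
  have hsub : IsSubSuper rt ι (W.map L.space.subtype) :=
    { x_mem := by
        rintro i _ ⟨z, hz, rfl⟩
        exact ⟨_, hx i z hz, rfl⟩
      c_mem := by
        rintro i _ ⟨z, hz, rfl⟩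
        exact ⟨_, hc i z hz, rfl⟩
      par_mem := by
        rintro _ ⟨z, hz, rfl⟩
        exact ⟨_, hp z hz, rfl⟩ }
  rcases L.irred _ hle hsub with h | h
  · refine absurd (Submodule.map_injective_of_injective L.space.injective_subtype ?_) hne
    rw [h, Submodule.map_bot]
  · refine Submodule.eq_top_iff'.2 fun z => ?_
    have hz : (z : TensorSpace K n) ∈ W.map L.space.subtype := by rw [h]; exact z.2
    obtain ⟨w, hw, e⟩ := hz
    rwa [← Subtype.ext e]

theorem opSqrt_smul_one {M : Type*} [AddCommGroup M] [Module K M] [Nontrivial M] (a : K) :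
    opSqrt rt (a • (1 : Module.End K M)) = rt a • 1 := by
  have hex : ∃ c : K, a • (1 : Module.End K M) = c • (1 : Module.End K M) := ⟨a, rfl⟩
  rw [opSqrt, dif_pos hex]
  have h := hex.choose_spec
  rw [← smul_left_injective K (one_ne_zero (α := Module.End K M)) h]

theorem IrrComponent.xi_eq (hrt : ∀ a : K, rt a ^ 2 = a) (w : Equiv.Perm (Fin n))
    (i : Fin (n - 1)) (h : q (ι (w.symm (lo i))) ≠ q (ι (w.symm (hi i)))) :
    L.xi w i = xiOp (fun i => q (ι i)) L.x L.c (w.symm (lo i)) (w.symm (hi i)) :=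
  (L.xcRel hrt).xiOp_eq_inverse _ _ h

theorem IrrComponent.omega_eq (hrt : ∀ a : K, rt a ^ 2 = a) (w : Equiv.Perm (Fin n))
    (i : Fin (n - 1)) (h : q (ι (w.symm (lo i))) ≠ q (ι (w.symm (hi i)))) :
    L.omega w i = rt (omegaSq (fun i => q (ι i)) (w.symm (lo i)) (w.symm (hi i))) • 1 := by
  have := L.nontrivial
  rw [← opSqrt_smul_one, ← (L.xcRel hrt).omega_eq_inverse _ _ h]
  rfl

end Tensor

/-! ### The operators on the direct sum of the twists -/

section Action

variable {b : Kind} {m n : ℕ} {K : Type*} [Field K] {rt : K → K} {Q : Fin m → K} {μ : Shape b m n}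
  (L : IrrComponent rt (res Q (initial μ)))

/-- The numbers `q(res)` of the letters of the initial tableau. -/
def qInit (Q : Fin m → K) (μ : Shape b m n) (a : Fin n) : K := q (res Q (initial μ) a)

/-- The letter of the initial tableau in the box of the letter `k` of `t`. -/
def pos (t : Tab μ) (k : Fin n) : Fin n := (dperm t).symm k

theorem pos_injective (t : Tab μ) : Function.Injective (pos t) := (dperm t).symm.injective

theorem pos_permTab (i : Fin (n - 1)) (t : Tab μ) (k : Fin n) :
    pos (permTab (simple i) t) k = pos t (simple i k) := by
  rw [pos, dperm_permTab_symm, simple_symm, pos]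

theorem qInit_pos (t : Tab μ) (k : Fin n) : qInit Q μ (pos t k) = q (res Q t k) := by
  rw [qInit, res_eq_res_initial t, pos]

open Classical in
/-- The vector `z^{d(t, t₀)}` of `D(μ)`, and zero if the tableau `t` is not standard. -/
def emb (t : Tab μ) : L.space →ₗ[K] DMod L :=
  if h : IsStd t then Finsupp.lsingle ⟨t, h⟩ else 0

theorem emb_of_isStd {t : Tab μ} (h : IsStd t) (z : L.space) :
    emb L t z = Finsupp.single ⟨t, h⟩ z := by
  rw [emb, dif_pos h]; rfl

theorem emb_of_not_isStd {t : Tab μ} (h : ¬ IsStd t) (z : L.space) : emb L t z = 0 := by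
  rw [emb, dif_neg h]; rfl

theorem single_eq_emb (t : Std μ) (z : L.space) :
    (Finsupp.single t z : DMod L) = emb L t.1 z := (emb_of_isStd L t.2 z).symm

variable {L} in
theorem dmod_ext {f g : Module.End K (DMod L)}
    (h : ∀ t : Tab μ, IsStd t → ∀ z, f (emb L t z) = g (emb L t z)) : f = g := by
  refine Finsupp.lhom_ext fun t z => ?_
  rw [single_eq_emb]
  exact h t.1 t.2 z

theorem dx_emb (i : Fin n) (t : Tab μ) (z : L.space) :
    dx L i (emb L t z) = emb L t (L.x (pos t i) z) := by
  by_cases h : IsStd t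
  · rw [emb_of_isStd L h, emb_of_isStd L h, dx, Finsupp.lsum_single]; rfl
  · rw [emb_of_not_isStd L h, emb_of_not_isStd L h, map_zero]

theorem dc_emb (i : Fin n) (t : Tab μ) (z : L.space) :
    dc L i (emb L t z) = emb L t (L.c (pos t i) z) := by
  by_cases h : IsStd t
  · rw [emb_of_isStd L h, emb_of_isStd L h, dc, Finsupp.lsum_single]; rfl
  · rw [emb_of_not_isStd L h, emb_of_not_isStd L h, map_zero]

theorem dpar_emb (t : Tab μ) (z : L.space) : dpar L (emb L t z) = emb L t (L.par z) := by
  by_cases h : IsStd t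
  · rw [emb_of_isStd L h, emb_of_isStd L h, dpar, Finsupp.lsum_single]; rfl
  · rw [emb_of_not_isStd L h, emb_of_not_isStd L h, map_zero]

variable (hrt : ∀ a : K, rt a ^ 2 = a) (hsep : ∀ ν : Shape b m (n + 1), Separate Q ν)

include hsep in
theorem qInit_pos_ne {t : Tab μ} (ht : IsStd t) (i : Fin (n - 1)) :
    qInit Q μ (pos t (lo i)) ≠ qInit Q μ (pos t (hi i)) := by
  rw [qInit_pos, qInit_pos]
  exact q_res_lo_ne_hi hsep ht i

include hsep in
/-- The scalar under the root vanishes where the exchange leads out of the standard tableaux. -/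
theorem omegaSq_eq_zero {t : Tab μ} (ht : IsStd t) {i : Fin (n - 1)}
    (ht' : ¬ IsStd (permTab (simple i) t)) :
    omegaSq (qInit Q μ) (pos t (lo i)) (pos t (hi i)) = 0 := by
  have h := qInit_pos_ne hsep ht i
  have h2 := exceptional_of_not_isStd (Q := Q) ht ht'
  rw [← qInit_pos, ← qInit_pos] at h2
  rw [omegaSq, h2, div_self (pow_ne_zero 2 (sub_ne_zero.2 h)), sub_self]

include hsep in
theorem omegaSq_ne_zero {t : Tab μ} (ht : IsStd t) {i : Fin (n - 1)}
    (ht' : IsStd (permTab (simple i) t)) :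
    omegaSq (qInit Q μ) (pos t (lo i)) (pos t (hi i)) ≠ 0 := by
  have h := qInit_pos_ne hsep ht i
  have h2 := not_exceptional_of_isStd (Q := Q) hsep ht ht'
  rw [← qInit_pos, ← qInit_pos] at h2
  intro h0
  rw [omegaSq, sub_eq_zero, eq_div_iff (pow_ne_zero 2 (sub_ne_zero.2 h)), one_mul] at h0
  exact h2 h0.symm

include hrt in
theorem rt_zero : rt 0 = 0 := pow_eq_zero_iff two_ne_zero |>.1 (hrt 0)

include hrt hsep in
/-- The action of `s_i`. Since the root vanishes between standard and non-standard tableaux, the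
formula needs no case distinction. -/
theorem ds_emb (i : Fin (n - 1)) (t : Tab μ) (z : L.space) :
    ds L i (emb L t z) =
      emb L t (xiOp (qInit Q μ) L.x L.c (pos t (lo i)) (pos t (hi i)) z) +
        rt (omegaSq (qInit Q μ) (pos t (lo i)) (pos t (hi i))) •
          emb L (permTab (simple i) t) z := by
  by_cases ht : IsStd t
  · have hne := qInit_pos_ne hsep ht i
    rw [emb_of_isStd L ht, ds, Finsupp.lsum_single, LinearMap.add_apply]
    congr 1
    · rw [L.xi_eq hrt _ _ hne, emb_of_isStd L ht]
      rfl
    · by_cases ht' : IsStd (permTab (simple i) t)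
      · rw [dif_pos ht', emb_of_isStd L ht']
        have hs : L.omega (dperm (permTab (simple i) t)) i =
            rt (omegaSq (qInit Q μ) (pos t (lo i)) (pos t (hi i))) • 1 := by
          rw [L.omega_eq hrt _ _ (qInit_pos_ne hsep ht' i)]
          change rt (omegaSq (qInit Q μ) (pos (permTab (simple i) t) (lo i))
            (pos (permTab (simple i) t) (hi i))) • _ = _
          rw [pos_permTab, pos_permTab, simple_lo, simple_hi, omegaSq_symm]
        rw [hs, LinearMap.comp_apply, LinearMap.smul_apply, Module.End.one_apply, map_smul]
        rfl
      · rw [dif_neg ht', emb_of_not_isStd L ht', smul_zero]; rfl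
  · rw [emb_of_not_isStd L ht, emb_of_not_isStd L ht, map_zero, zero_add]
    by_cases ht' : IsStd (permTab (simple i) t)
    · have h0 := omegaSq_eq_zero hsep ht' (i := i)
        (by rwa [permTab_simple_permTab_simple])
      rw [pos_permTab, pos_permTab, simple_lo, simple_hi, omegaSq_symm] at h0
      rw [h0, rt_zero hrt, zero_smul]
    · rw [emb_of_not_isStd L ht', smul_zero]

include hrt hsep in
theorem ds_sq (i : Fin (n - 1)) : ds L i * ds L i = 1 := dmod_ext fun t ht z => by
  have hX : XCRel (qInit Q μ) L.x L.c := L.xcRel hrt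
  have hne := qInit_pos_ne hsep ht i
  have hsq := LinearMap.congr_fun (hX.xiOp_sq (pos t (lo i)) (pos t (hi i))
    fun e => hne (congrArg _ e)) z
  simp only [Module.End.mul_apply, ds_emb L hrt hsep, map_add, map_smul, pos_permTab, simple_lo,
    simple_hi, permTab_simple_permTab_simple, Module.End.one_apply,
    omegaSq_symm _ (pos t (hi i)) (pos t (lo i))]
  rw [XCRel.xiOp_symm _ _ _ (pos t (lo i)) (pos t (hi i))]
  rw [Module.End.mul_apply] at hsq
  rw [LinearMap.neg_apply, map_neg, hsq, smul_add, smul_smul, ← sq, hrt, LinearMap.smul_apply, Module.End.one_apply,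
    map_smul, omegaSq]
  module

include hrt hsep in
theorem ds_comm (i j : Fin (n - 1)) (hij : i.1 + 1 < j.1 ∨ j.1 + 1 < i.1) :
    ds L i * ds L j = ds L j * ds L i := dmod_ext fun t ht z => by
  have hX : XCRel (qInit Q μ) L.x L.c := L.xcRel hrt
  have h1 : lo i ≠ lo j := fun e => by rw [Fin.ext_iff, val_lo, val_lo] at e; omega
  have h2 : lo i ≠ hi j := fun e => by rw [Fin.ext_iff, val_lo, val_hi] at e; omega
  have h3 : hi i ≠ lo j := fun e => by rw [Fin.ext_iff, val_hi, val_lo] at e; omega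
  have h4 : hi i ≠ hi j := fun e => by rw [Fin.ext_iff, val_hi, val_hi] at e; omega
  have hperm : permTab (simple i) (permTab (simple j) t) =
      permTab (simple j) (permTab (simple i) t) := by
    refine Equiv.ext fun x => ?_
    change simple i (simple j (t x)) = simple j (simple i (t x))
    have : (simple i).Disjoint (simple j) := by
      intro k
      by_cases hk : k = lo j
      · left; rw [hk]; exact simple_of_ne h1.symm h3.symm
      · by_cases hk' : k = hi j
        · left; rw [hk']; exact simple_of_ne h2.symm h4.symm
        · right; exact simple_of_ne hk hk'
    exact Equiv.congr_fun this.commute (t x)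
  have hcomm := LinearMap.congr_fun ((hX.commute_xiOp_xiOp (pos t (lo i)) (pos t (hi i))
    (pos t (lo j)) (pos t (hi j)) (fun e => h1.symm (pos_injective t e))
    (fun e => h3.symm (pos_injective t e)) (fun e => h2.symm (pos_injective t e))
    (fun e => h4.symm (pos_injective t e))).eq) z
  simp only [Module.End.mul_apply] at hcomm
  simp only [Module.End.mul_apply, ds_emb L hrt hsep, map_add, map_smul, pos_permTab,
    simple_of_ne h1 h2, simple_of_ne h3 h4, simple_of_ne h1.symm h3.symm,
    simple_of_ne h2.symm h4.symm, hperm]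
  rw [hcomm]
  module

include hrt hsep in
theorem ds_braid (i j : Fin (n - 1)) (hij : i.1 + 1 = j.1) :
    ds L i * ds L j * ds L i = ds L j * ds L i * ds L j := dmod_ext fun t ht z => by
  have hX : XCRel (qInit Q μ) L.x L.c := L.xcRel hrt
  have ehl : lo j = hi i := Fin.ext hij.symm
  have h1 : lo i ≠ hi j := fun e => by rw [Fin.ext_iff, val_lo, val_hi] at e; omega
  have h2 : hi i ≠ hi j := fun e => by rw [Fin.ext_iff, val_hi, val_hi] at e; omega
  have h3 := lo_ne_hi i
  have s1 : simple i (hi j) = hi j := simple_of_ne h1.symm h2.symm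
  have s2 : simple j (lo i) = lo i := simple_of_ne (by rw [ehl]; exact h3) h1
  have s3 : simple j (hi i) = hi j := by rw [← ehl]; exact simple_lo j
  have s4 : simple j (hi j) = hi i := by rw [← ehl]; exact simple_hi j
  have hperm : permTab (simple i) (permTab (simple j) (permTab (simple i) t)) =
      permTab (simple j) (permTab (simple i) (permTab (simple j) t)) := by
    refine Equiv.ext fun x => ?_
    change simple i (simple j (simple i (t x))) = simple j (simple i (simple j (t x)))
    by_cases e1 : t x = lo i
    · rw [e1, simple_lo, s3, s1, s2, simple_lo, s3]
    · by_cases e2 : t x = hi i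
      · rw [e2, simple_hi, s2, simple_lo, s3, s1, s4]
      · by_cases e3 : t x = hi j
        · rw [e3, s1, s4, simple_hi, s2]
        · have e4 : t x ≠ lo j := by rwa [ehl]
          rw [simple_of_ne e1 e2, simple_of_ne e4 e3, simple_of_ne e1 e2, simple_of_ne e4 e3]
  have hab := qInit_pos_ne hsep ht i
  have hbc := qInit_pos_ne hsep ht j
  rw [ehl] at hbc
  simp only [Module.End.mul_apply, ds_emb L hrt hsep, map_add, map_smul, pos_permTab, ehl,
    simple_lo, simple_hi, s1, s2, s3, s4, hperm, permTab_simple_permTab_simple]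
  have nab : pos t (lo i) ≠ pos t (hi i) := fun e => hab (congrArg _ e)
  have nbc : pos t (hi i) ≠ pos t (hi j) := fun e => hbc (congrArg _ e)
  have nac : pos t (lo i) ≠ pos t (hi j) := fun e => h1 (pos_injective t e)
  by_cases hac : qInit Q μ (pos t (lo i)) = qInit Q μ (pos t (hi j))
  · -- here no exchange is possible, and only the coefficient of `t` itself remains
    have hi' : ¬ IsStd (permTab (simple i) t) := fun h => by
      refine qInit_pos_ne hsep h j ?_
      rw [pos_permTab, pos_permTab, ehl, simple_hi, s1, hac]
    have hj' : ¬ IsStd (permTab (simple j) t) := fun h => by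
      refine qInit_pos_ne hsep h i ?_
      rw [pos_permTab, pos_permTab, s2, s3, hac]
    have w1 := omegaSq_eq_zero hsep ht hi'
    have w2 := omegaSq_eq_zero hsep ht hj'
    rw [ehl] at w2
    have hrig := rigid_triple (Q := Q) ht hij hi' hj' (by rw [← qInit_pos, ← qInit_pos, hac])
    simp only [← qInit_pos] at hrig
    have hbr := LinearMap.congr_fun (hX.braid_rigid _ _ _ nab nac nbc hac (hrig.imp_left
      fun h => ⟨L.x_eq_zero hrt h.1, L.x_eq_zero hrt h.2⟩)) z
    simp only [Module.End.mul_apply] at hbr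
    rw [w1, w2, rt_zero hrt, hbr]
    simp only [zero_smul, add_zero]
  · have g := congrArg (emb L t) (LinearMap.congr_fun (hX.braid_generic _ _ _ hab hac hbc) z)
    have g1 := congrArg (emb L (permTab (simple i) t))
      (LinearMap.congr_fun (hX.xiOp_mul_xiOp _ _ _ hab hac hbc) z)
    have g2 := congrArg (emb L (permTab (simple j) t))
      (LinearMap.congr_fun (hX.xiOp_mul_xiOp' _ _ _ hab hac hbc) z)
    rw [← hrt (omegaSq _ (pos t (lo i)) (pos t (hi i))),
      ← hrt (omegaSq _ (pos t (hi i)) (pos t (hi j)))] at g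
    rw [omegaSq_symm _ (pos t (hi i)) (pos t (lo i)), omegaSq_symm _ (pos t (hi j)) (pos t (hi i)),
      XCRel.xiOp_symm _ _ _ (pos t (lo i)) (pos t (hi i)),
      XCRel.xiOp_symm _ _ _ (pos t (hi i)) (pos t (hi j))]
    simp only [Module.End.mul_apply, LinearMap.add_apply, LinearMap.smul_apply, map_add,
      map_smul, LinearMap.neg_apply, map_neg] at g g1 g2 ⊢
    generalize hr1 : rt (omegaSq (qInit Q μ) (pos t (lo i)) (pos t (hi i))) = r1 at *
    generalize hr2 : rt (omegaSq (qInit Q μ) (pos t (hi i)) (pos t (hi j))) = r2 at *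
    generalize hr3 : rt (omegaSq (qInit Q μ) (pos t (lo i)) (pos t (hi j))) = r3 at *
    linear_combination (norm := module) g - r1 • g1 + r2 • g2

end Action

/-! ### The representation and its simplicity -/

section Representation

variable {b : Kind} {m n : ℕ} {K : Type*} [Field K] {rt : K → K} {Q : Fin m → K} {μ : Shape b m n}
  (L : IrrComponent rt (res Q (initial μ)))
  (hrt : ∀ a : K, rt a ^ 2 = a) (hsep : ∀ ν : Shape b m (n + 1), Separate Q ν)

/-- The letter `1` lies in the first box of a component. -/
theorem IsStd.first_box {t : Tab μ} (ht : IsStd t) {k : Fin n} (hk : k.val = 0) :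
    (t.symm k).1.2 = (0, 0) := by
  have hd := ht.isDiagram_below 1
  have hmem : ∀ x ∈ below t 1, x = (t.symm k).1 := by
    intro x hx
    have h := below_succ t k
    rw [hk] at h
    rw [h] at hx
    rcases Finset.mem_insert.1 hx with h | h
    · exact h
    · exfalso
      obtain ⟨j, hj, -⟩ := Finset.mem_image.1 h
      simp at hj
  have hx : (t.symm k).1 ∈ below t 1 := mem_below.2 (by omega)
  generalize (t.symm k).1 = x at hmem hx
  obtain ⟨l, i, j⟩ := x
  have hv := hd.valid _ hx
  obtain _ | i := i
  · obtain _ | j := j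
    · rfl
    · have := hmem _ (hd.right (l, 0, j) (fun h0 => ⟨(hv h0).1, Nat.zero_le _⟩) hx)
      simp at this
  · have := hmem _ (hd.down (l, i, j) (fun h0 => ⟨(hv h0).1, by
      have := (hv h0).2
      simp only at this ⊢
      omega⟩) hx)
    simp at this

theorem aeval_sq_sub_apply {M : Type*} [AddCommGroup M] [Module K M] {f : Module.End K M} {a : K}
    {v : M} (h : f (f v) = a • v) :
    Polynomial.aeval f (Polynomial.X ^ 2 - Polynomial.C a) v = 0 := by
  rw [map_sub, map_pow, Polynomial.aeval_X, Polynomial.aeval_C, sq, LinearMap.sub_apply,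
    Module.End.mul_apply, h, Module.algebraMap_end_apply, sub_self]

include hrt in
/-- The cyclotomic relation: the box of the letter `1` has residue `Q_l`, so that `x_1` acts on the
summand by a root of a factor of the polynomial. -/
theorem aeval_dx_cycPoly {k : Fin n} (hk : k.val = 0) :
    Polynomial.aeval (dx L k) (cycPoly b Q) = 0 := dmod_ext fun t ht z => by
  have hX : XCRel (qInit Q μ) L.x L.c := L.xcRel hrt
  have hbox := ht.first_box hk
  have hq : qInit Q μ (pos t k) = q (boxRes Q (t.symm k).1) := by
    rw [qInit_pos, res_eq_boxRes]
  have hvalid := μ.isDiagram.valid _ (t.symm k).2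
  have key : ∀ p : Polynomial K, p ∣ cycPoly b Q →
      Polynomial.aeval (dx L k) p (emb L t z) = 0 →
      Polynomial.aeval (dx L k) (cycPoly b Q) (emb L t z) = (0 : Module.End K (DMod L)) (emb L t z) := by
    rintro p ⟨r, hr⟩ h
    rw [hr, mul_comm, map_mul, Module.End.mul_apply, h, map_zero, LinearMap.zero_apply]
  generalize (t.symm k).1 = x at hbox hq hvalid
  obtain ⟨l, ij⟩ := x
  dsimp only at hbox
  subst hbox
  rcases Fin.eq_zero_or_eq_succ l with rfl | ⟨l, rfl⟩
  · refine key Polynomial.X ?_ ?_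
    · cases b with
      | zero => exact absurd rfl (hvalid rfl).1
      | strict => exact dvd_mul_right _ _
    · rw [Polynomial.aeval_X, dx_emb, L.x_eq_zero hrt, LinearMap.zero_apply, map_zero]
      change qInit Q μ (pos t k) = 0
      rw [hq]
      simp [boxRes, q]
  · refine key (Polynomial.X ^ 2 - Polynomial.C (q (Q l))) ?_ ?_
    · exact (Finset.dvd_prod_of_mem _ (Finset.mem_univ l)).mul_left _
    · have h2 := LinearMap.congr_fun (hX.x_sq (pos t k)) z
      rw [Module.End.mul_apply] at h2
      refine aeval_sq_sub_apply (M := DMod L) ?_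
      rw [dx_emb, dx_emb, h2, hq, LinearMap.smul_apply, Module.End.one_apply, map_smul]
      simp [boxRes]

/-- The operator by which a generator acts on `D(μ)`. -/
def genOp : Gen n → Module.End K (DMod L)
  | Gen.s i => ds L i
  | Gen.x i => dx L i
  | Gen.c i => dc L i

theorem apply_eq_neg_one_smul {M : Type*} [AddCommGroup M] [Module K M] {f g : Module.End K M}
    (h : f = -g) (z : M) : f z = (-1 : K) • g z := by
  rw [h, LinearMap.neg_apply, neg_one_smul]

/-- The defining relations for a family of operators on an abstract module. They contain no
subtraction, and negation is the scalar `-1`, which is the form that is checked on `D(μ)`. -/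
theorem lift_eq_of_affRel {M : Type*} [AddCommGroup M] [Module K M] (f : Gen n → Module.End K M)
    (s_sq : ∀ i, f (.s i) * f (.s i) = 1)
    (s_comm : ∀ i j : Fin (n - 1), i.1 + 1 < j.1 ∨ j.1 + 1 < i.1 →
      f (.s i) * f (.s j) = f (.s j) * f (.s i))
    (braid : ∀ i j : Fin (n - 1), i.1 + 1 = j.1 →
      f (.s i) * f (.s j) * f (.s i) = f (.s j) * f (.s i) * f (.s j))
    (x_comm : ∀ i j, f (.x i) * f (.x j) = f (.x j) * f (.x i))
    (c_sq : ∀ i, f (.c i) * f (.c i) = 1)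
    (c_anti : ∀ i j, i ≠ j → f (.c i) * f (.c j) = (-1 : K) • (f (.c j) * f (.c i)))
    (s_x : ∀ i, f (.s i) * f (.x (lo i)) + (1 + f (.c (lo i)) * f (.c (hi i))) =
      f (.x (hi i)) * f (.s i))
    (s_x_of_ne : ∀ i j, j ≠ lo i → j ≠ hi i → f (.s i) * f (.x j) = f (.x j) * f (.s i))
    (s_c_lo : ∀ i, f (.s i) * f (.c (lo i)) = f (.c (hi i)) * f (.s i))
    (s_c_hi : ∀ i, f (.s i) * f (.c (hi i)) = f (.c (lo i)) * f (.s i))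
    (s_c_of_ne : ∀ i j, j ≠ lo i → j ≠ hi i → f (.s i) * f (.c j) = f (.c j) * f (.s i))
    (x_c : ∀ i, f (.x i) * f (.c i) = (-1 : K) • (f (.c i) * f (.x i)))
    (x_c_of_ne : ∀ i j, i ≠ j → f (.x i) * f (.c j) = f (.c j) * f (.x i))
    {g g' : FreeAlgebra K (Gen n)} (h : AffRel K n g g') :
    FreeAlgebra.lift K f g = FreeAlgebra.lift K f g' := by
  simp only [neg_one_smul] at c_anti x_c
  cases h <;> simp only [map_mul, map_add, map_sub, map_neg, map_one, FreeAlgebra.lift_ι_apply]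
  case s_sq i => exact s_sq i
  case s_comm i j h => exact s_comm i j h
  case braid i j h => exact braid i j h
  case x_comm i j => exact x_comm i j
  case c_sq i => exact c_sq i
  case c_anti i j h => exact c_anti i j h
  case s_x i => exact eq_sub_of_add_eq (s_x i)
  case s_x_of_ne i j h h' => exact s_x_of_ne i j h h'
  case s_c_lo i => exact s_c_lo i
  case s_c_hi i => exact s_c_hi i
  case s_c_of_ne i j h h' => exact s_c_of_ne i j h h'
  case x_c i => exact x_c i
  case x_c_of_ne i j h => exact x_c_of_ne i j h

include hrt hsep in
theorem genOp_affRel {f g : FreeAlgebra K (Gen n)} (h : AffRel K n f g) :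
    FreeAlgebra.lift K (genOp L) f = FreeAlgebra.lift K (genOp L) g := by
  have hX : XCRel (qInit Q μ) L.x L.c := L.xcRel hrt
  refine lift_eq_of_affRel (M := DMod L) (genOp L) ?s_sq ?s_comm ?braid ?x_comm ?c_sq ?c_anti ?s_x
    ?s_x_of_ne ?s_c_lo ?s_c_hi ?s_c_of_ne ?x_c ?x_c_of_ne h
  case' s_sq => intro i
  case' s_comm => intro i j h
  case' braid => intro i j h
  case' x_comm => intro i j
  case' c_sq => intro i
  case' c_anti => intro i j h
  case' s_x => intro i
  case' s_x_of_ne => intro i j h h'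
  case' s_c_lo => intro i
  case' s_c_hi => intro i
  case' s_c_of_ne => intro i j h h'
  case' x_c => intro i
  case' x_c_of_ne => intro i j h
  all_goals simp only [genOp]
  case s_sq => exact ds_sq L hrt hsep i
  case s_comm => exact ds_comm L hrt hsep i j h
  case braid => exact ds_braid L hrt hsep i j h
  case x_comm =>
    refine dmod_ext fun t ht z => ?_
    simp only [Module.End.mul_apply, dx_emb]
    have e := LinearMap.congr_fun (hX.x_comm (pos t i) (pos t j)) z
    simp only [Module.End.mul_apply] at e
    rw [e]
  case c_sq =>
    refine dmod_ext fun t ht z => ?_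
    simp only [Module.End.mul_apply, dc_emb]
    have e := LinearMap.congr_fun (hX.c_sq (pos t i)) z
    rw [Module.End.mul_apply] at e
    rw [e]
    rfl
  case c_anti =>
    refine dmod_ext fun t ht z => ?_
    simp only [Module.End.mul_apply, dc_emb, LinearMap.smul_apply, ← (emb L t).map_smul]
    have e : L.c (pos t i) (L.c (pos t j) z) = (-1 : K) • L.c (pos t j) (L.c (pos t i) z) :=
      apply_eq_neg_one_smul (M := L.space) (hX.c_anti _ _ fun e => h (pos_injective t e)) z
    rw [e]
  case x_c =>
    refine dmod_ext fun t ht z => ?_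
    simp only [Module.End.mul_apply, dc_emb, dx_emb, LinearMap.smul_apply, ← (emb L t).map_smul]
    have e : L.x (pos t i) (L.c (pos t i) z) = (-1 : K) • L.c (pos t i) (L.x (pos t i) z) :=
      apply_eq_neg_one_smul (M := L.space) (hX.x_c (pos t i)) z
    rw [e]
  case x_c_of_ne =>
    refine dmod_ext fun t ht z => ?_
    simp only [Module.End.mul_apply, dc_emb, dx_emb]
    have e := LinearMap.congr_fun (hX.x_c_of_ne _ _ fun e => h (pos_injective t e)) z
    simp only [Module.End.mul_apply] at e
    rw [e]
  case s_x =>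
    refine dmod_ext fun t ht z => ?_
    have e := congrArg (emb L t)
      (LinearMap.congr_fun (add_eq_of_eq_sub (hX.xiOp_mul_x _ _ (qInit_pos_ne hsep ht i))) z)
    simp only [Module.End.mul_apply, LinearMap.add_apply, Module.End.one_apply, map_add] at e
    simp only [Module.End.mul_apply, dc_emb, dx_emb, ds_emb L hrt hsep,
      LinearMap.add_apply, Module.End.one_apply, map_add, map_smul, pos_permTab, simple_hi]
    rw [← e]
    abel
  case s_x_of_ne =>
    refine dmod_ext fun t ht z => ?_
    have e := LinearMap.congr_fun (hX.commute_xiOp_x (pos t (lo i)) (pos t (hi i)) (pos t j)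
      (fun e => h (pos_injective t e)) (fun e => h' (pos_injective t e))).eq z
    simp only [Module.End.mul_apply] at e
    simp only [Module.End.mul_apply, dx_emb, ds_emb L hrt hsep, map_add, map_smul, pos_permTab,
      simple_of_ne h h', e]
  case s_c_lo =>
    refine dmod_ext fun t ht z => ?_
    have e := LinearMap.congr_fun (hX.xiOp_mul_c (pos t (lo i)) (pos t (hi i))) z
    simp only [Module.End.mul_apply] at e
    simp only [Module.End.mul_apply, dc_emb, ds_emb L hrt hsep, map_add, map_smul, pos_permTab,
      simple_hi, e]
  case s_c_hi =>
    refine dmod_ext fun t ht z => ?_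
    have e := LinearMap.congr_fun (hX.xiOp_mul_c' (pos t (lo i)) (pos t (hi i))) z
    simp only [Module.End.mul_apply] at e
    simp only [Module.End.mul_apply, dc_emb, ds_emb L hrt hsep, map_add, map_smul, pos_permTab,
      simple_lo, e]
  case s_c_of_ne =>
    refine dmod_ext fun t ht z => ?_
    have e := LinearMap.congr_fun (hX.commute_xiOp_c (pos t (lo i)) (pos t (hi i)) (pos t j)
      (fun e => h (pos_injective t e)) (fun e => h' (pos_injective t e))).eq z
    simp only [Module.End.mul_apply] at e
    simp only [Module.End.mul_apply, dc_emb, ds_emb L hrt hsep, map_add, map_smul, pos_permTab,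
      simple_of_ne h h', e]

include hrt hsep in
/-- The operators define a representation of the cyclotomic Sergeev algebra. -/
theorem exists_isDRep : ∃ Φ : CycSergeev b Q n →ₐ[K] Module.End K (DMod L), IsDRep L Φ := by
  let φ : AffineSergeev K n →ₐ[K] Module.End K (DMod L) :=
    RingQuot.liftAlgHom K ⟨FreeAlgebra.lift K (genOp L), fun _ _ => genOp_affRel L hrt hsep⟩
  have hφ : ∀ a, φ (RingQuot.mkAlgHom K (AffRel K n) (FreeAlgebra.ι K a)) = genOp L a := by
    intro a
    rw [RingQuot.liftAlgHom_mkAlgHom_apply, FreeAlgebra.lift_ι_apply]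
  let Φ : CycSergeev b Q n →ₐ[K] Module.End K (DMod L) :=
    RingQuot.liftAlgHom K ⟨φ, by
      rintro _ _ ⟨k, hk⟩
      rw [map_zero, ← Polynomial.aeval_algHom_apply, hφ]
      exact aeval_dx_cycPoly L hrt hk⟩
  have hΦ : ∀ a, Φ (gen b Q a) = genOp L a := by
    intro a
    rw [gen, RingQuot.liftAlgHom_mkAlgHom_apply, hφ]
  exact ⟨Φ, fun i => hΦ _, fun i => hΦ _, fun i => hΦ _⟩

theorem dx_sq_apply (k : Fin n) (hrt : ∀ a : K, rt a ^ 2 = a) (w : DMod L) (t : Std μ) :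
    dx L k (dx L k w) t = q (res Q t.1 k) • w t := by
  induction w using Finsupp.induction_linear with
  | zero => simp
  | add f g hf hg => simp only [map_add, Finsupp.add_apply, hf, hg, smul_add]
  | single t' z =>
    have h2 := LinearMap.congr_fun ((L.xcRel hrt).x_sq (pos t'.1 k)) z
    rw [Module.End.mul_apply] at h2
    rw [single_eq_emb, dx_emb, dx_emb, h2]
    change emb L t'.1 (qInit Q μ (pos t'.1 k) • z) t = _
    rw [← single_eq_emb, ← single_eq_emb]
    by_cases h : t' = t
    · subst h
      rw [Finsupp.single_eq_same, Finsupp.single_eq_same, ← qInit_pos]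
    · rw [Finsupp.single_eq_of_ne (Ne.symm h), Finsupp.single_eq_of_ne (Ne.symm h), smul_zero]

include hrt hsep in
/-- The squares of the `x_k` separate the summands of `D(μ)`, so that a subspace that is stable
under the `x_k` contains the components of its elements. -/
theorem emb_apply_mem {W : Submodule K (DMod L)} (hW : ∀ k, ∀ w ∈ W, dx L k w ∈ W) {w : DMod L}
    (hw : w ∈ W) (t : Std μ) : emb L t.1 (w t) ∈ W := by
  classical
  have key : ∀ F : Finset (Std μ), t ∉ F → ∃ w' ∈ W, w' t = w t ∧ ∀ t' ∈ F, w' t' = 0 := by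
    intro F
    induction F using Finset.induction_on with
    | empty => exact fun _ => ⟨w, hw, rfl, by simp⟩
    | insert t1 F ht1 ih =>
      intro ht
      simp only [Finset.mem_insert, not_or] at ht
      obtain ⟨w', hw', e, h0⟩ := ih ht.2
      obtain ⟨k, hk⟩ : ∃ k, q (res Q t.1 k) ≠ q (res Q t1.1 k) := by
        by_contra! h
        exact ht.1 (std_ext_of_q_res hsep h)
      refine ⟨(q (res Q t.1 k) - q (res Q t1.1 k))⁻¹ •
        (dx L k (dx L k w') + (-q (res Q t1.1 k)) • w'),
        W.smul_mem _ (W.add_mem (hW _ _ (hW _ _ hw')) (W.smul_mem _ hw')), ?_, ?_⟩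
      · rw [Finsupp.smul_apply, Finsupp.add_apply, dx_sq_apply L k hrt, Finsupp.smul_apply, e,
          ← add_smul, ← sub_eq_add_neg, smul_smul, inv_mul_cancel₀ (sub_ne_zero.2 hk), one_smul]
      · intro t' ht'
        rw [Finsupp.smul_apply, Finsupp.add_apply, dx_sq_apply L k hrt, Finsupp.smul_apply]
        rcases Finset.mem_insert.1 ht' with rfl | ht'
        · rw [neg_smul, add_neg_cancel, smul_zero]
        · rw [h0 t' ht', smul_zero, smul_zero, add_zero, smul_zero]
  obtain ⟨w', hw', e, h0⟩ := key (Finset.univ.erase t) (Finset.notMem_erase _ _)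
  have : emb L t.1 (w t) = w' := by
    rw [← single_eq_emb, ← e]
    ext1 t'
    by_cases h : t' = t
    · subst h; rw [Finsupp.single_eq_same]
    · rw [Finsupp.single_eq_of_ne h, h0 t' (Finset.mem_erase.2 ⟨h, Finset.mem_univ _⟩)]
  rwa [this]

/-- The conditions for a supermodule, with negation written as the scalar `-1`. -/
theorem isSuperRep_of {M : Type*} [AddCommGroup M] [Module K M]
    {Φ : CycSergeev b Q n →ₐ[K] Module.End K M} {P : Module.End K M} (sq : P * P = 1)
    (even_x : ∀ i, P * Φ (gx b Q i) = Φ (gx b Q i) * P)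
    (even_s : ∀ i, P * Φ (gs b Q i) = Φ (gs b Q i) * P)
    (odd_c : ∀ i, P * Φ (gc b Q i) = (-1 : K) • (Φ (gc b Q i) * P)) : IsSuperRep Φ P :=
  ⟨sq, even_x, even_s, fun i => by rw [odd_c, neg_one_smul]⟩

variable {L}

include hrt hsep in
theorem IsDRep.isSuperRep {Φ : CycSergeev b Q n →ₐ[K] Module.End K (DMod L)} (hΦ : IsDRep L Φ) :
    IsSuperRep (M := DMod L) Φ (dpar L) := by
  refine isSuperRep_of (M := DMod L) ?sq ?even_x ?even_s ?odd_c
  case sq =>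
    refine dmod_ext fun t ht z => ?_
    simp only [Module.End.mul_apply, dpar_emb]
    have e := LinearMap.congr_fun L.par_sq z
    rw [Module.End.mul_apply] at e
    rw [e]
    rfl
  case even_x =>
    intro i
    rw [hΦ.map_x]
    refine dmod_ext fun t ht z => ?_
    simp only [Module.End.mul_apply, dpar_emb, dx_emb]
    have e := LinearMap.congr_fun (L.par_mul_x (pos t i)) z
    simp only [Module.End.mul_apply] at e
    rw [e]
  case even_s =>
    intro i
    rw [hΦ.map_s]
    refine dmod_ext fun t ht z => ?_
    have hp := XCRel.commute_xiOp_of_odd (A := qInit Q μ) (P := L.par) (X := L.x) (C := L.c)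
      L.par_mul_x L.par_mul_c
    have e := LinearMap.congr_fun (hp (pos t (lo i)) (pos t (hi i))).eq z
    simp only [Module.End.mul_apply] at e
    simp only [Module.End.mul_apply, dpar_emb, ds_emb L hrt hsep, map_add, map_smul, e]
  case odd_c =>
    intro i
    rw [hΦ.map_c]
    refine dmod_ext fun t ht z => ?_
    simp only [Module.End.mul_apply, dpar_emb, dc_emb, LinearMap.smul_apply, ← (emb L t).map_smul]
    have e : L.par (L.c (pos t i) z) = (-1 : K) • L.c (pos t i) (L.par z) :=
      apply_eq_neg_one_smul (M := L.space) (L.par_mul_c (pos t i)) z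
    rw [e]

theorem dmod_eq_sum (w : DMod L) : w = w.sum fun t z => emb L t.1 z := by
  conv_lhs => rw [← Finsupp.sum_single w]
  exact Finsupp.sum_congr fun t _ => single_eq_emb L t _

include hrt hsep in
theorem IsDRep.isSimpleSuper {Φ : CycSergeev b Q n →ₐ[K] Module.End K (DMod L)}
    (hΦ : IsDRep L Φ) : IsSimpleSuper (M := DMod L) Φ (dpar L) where
  super := hΦ.isSuperRep hrt hsep
  nontrivial := by
    have := L.nontrivial
    have : Nonempty (Std μ) := ⟨⟨initial μ, isStd_initial μ⟩⟩
    infer_instance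
  simple W hW hP := by
    have hx : ∀ k, ∀ w ∈ W, dx L k w ∈ W := fun k w hw => by
      rw [← hΦ.map_x]; exact hW _ w hw
    have hc : ∀ k, ∀ w ∈ W, dc L k w ∈ W := fun k w hw => by
      rw [← hΦ.map_c]; exact hW _ w hw
    have hs : ∀ k, ∀ w ∈ W, ds L k w ∈ W := fun k w hw => by
      rw [← hΦ.map_s]; exact hW _ w hw
    by_cases hbot : W = ⊥
    · exact Or.inl hbot
    right
    have htop : ∀ t : Std μ, (∃ z ≠ 0, emb L t.1 z ∈ W) → W.comap (emb L t.1) = ⊤ := by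
      rintro t ⟨z, hz, hzW⟩
      refine L.eq_top (fun i y hy => ?_) (fun i y hy => ?_) (fun y hy => ?_) ?_
      · have := hx (dperm t.1 i) _ hy
        rwa [dx_emb, pos, Equiv.symm_apply_apply] at this
      · have := hc (dperm t.1 i) _ hy
        rwa [dc_emb, pos, Equiv.symm_apply_apply] at this
      · have := hP _ hy
        rwa [dpar_emb] at this
      · intro h
        have : z ∈ W.comap (emb L t.1) := hzW
        rw [h] at this
        exact hz ((Submodule.mem_bot K).1 this)
    have hall : ∀ t : Std μ, ∃ z ≠ 0, emb L t.1 z ∈ W := by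
      refine forall_of_closed (P := fun t : Std μ => ∃ z ≠ 0, emb L t.1 z ∈ W) ?_ ?_
      · obtain ⟨w, hw, hne⟩ := (Submodule.ne_bot_iff _).1 hbot
        obtain ⟨t, ht⟩ := Finsupp.ne_iff.1 hne
        exact ⟨t, w t, ht, emb_apply_mem L hrt hsep hx hw t⟩
      · rintro t ⟨z, hz, hzW⟩ i hi'
        refine ⟨z, hz, ?_⟩
        have h1 := hs i _ hzW
        rw [ds_emb L hrt hsep] at h1
        have h2 : emb L t.1 (xiOp (qInit Q μ) L.x L.c (pos t.1 (lo i)) (pos t.1 (hi i)) z) ∈ W := by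
          change _ ∈ W.comap (emb L t.1)
          rw [htop t ⟨z, hz, hzW⟩]
          trivial
        have h3 := (Submodule.add_mem_iff_right (M := DMod L) W h2).1 h1
        have hne : rt (omegaSq (qInit Q μ) (pos t.1 (lo i)) (pos t.1 (hi i))) ≠ 0 := fun h0 => by
          refine omegaSq_ne_zero (μ := μ) hsep t.2 hi' ?_
          rw [← hrt (omegaSq _ _ _), h0, zero_pow two_ne_zero]
        exact (W.smul_mem_iff hne).1 h3
    refine Submodule.eq_top_iff'.2 fun w => ?_
    rw [dmod_eq_sum w]
    refine W.sum_mem fun t _ => ?_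
    change _ ∈ W.comap (emb L t.1)
    rw [htop t (hall t)]
    trivial

end Representation

/-! ### Ordered monomials in anticommuting involutions -/

section Monomials

variable {K R : Type*} [Field K] [Ring R] [Algebra K R] {n : ℕ}

/-- The ordered monomial `C_1^{β_1} ⋯ C_n^{β_n}`. -/
def mon (C : Fin n → R) (β : Fin n → ZMod 2) : R := (List.ofFn fun i => C i ^ (β i).val).prod

theorem mon_zero (C : Fin n → R) : mon C 0 = 1 := by
  simp [mon]

theorem mon_succ (C : Fin (n + 1) → R) (β : Fin (n + 1) → ZMod 2) :
    mon C β = C 0 ^ (β 0).val * mon (fun i => C i.succ) (fun i => β i.succ) := by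
  rw [mon, List.ofFn_succ, List.prod_cons, mon]

theorem sumLT_eq (β : Fin n → ZMod 2) (i : Fin n) : sumLT β i = ∑ k, if k < i then β k else 0 :=
  Finset.sum_filter _ _

theorem sumLT_succ (β : Fin (n + 1) → ZMod 2) (i : Fin n) :
    sumLT β i.succ = β 0 + sumLT (fun k => β k.succ) i := by
  rw [sumLT_eq, Fin.sum_univ_succ, sumLT_eq]
  simp

theorem sumLT_zero (β : Fin (n + 1) → ZMod 2) : sumLT β 0 = 0 := by
  rw [sumLT_eq]; simp

theorem sumLE_eq (β : Fin n → ZMod 2) (i : Fin n) : sumLE β i = sumLT β i + β i := by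
  rw [sumLT_eq, sumLE, Finset.sum_filter, ← Fintype.sum_ite_eq i β, ← Finset.sum_add_distrib]
  refine Finset.sum_congr rfl fun k _ => ?_
  rcases lt_trichotomy k i with h | h | h
  · rw [if_pos h.le, if_pos h, if_neg h.ne', add_zero]
  · rw [if_pos h.le, if_neg h.not_lt, if_pos h.symm, zero_add]
  · rw [if_neg h.not_ge, if_neg h.not_gt, if_neg h.ne, add_zero]

theorem sumAll_eq (β : Fin n → ZMod 2) (i : Fin n) : sumAll β = sumLE β i + sumGT β i := by
  rw [sumAll, sumLE, sumGT, ← Finset.sum_filter_add_sum_filter_not Finset.univ (fun k => k ≤ i)]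
  simp only [not_le]

theorem sumAll_eq' (β : Fin n → ZMod 2) (i : Fin n) : sumAll β = sumLT β i + sumGE β i := by
  rw [sumAll, sumLT, sumGE, ← Finset.sum_filter_add_sum_filter_not Finset.univ (fun k => k < i)]
  simp only [not_lt]

theorem c_mul_mon {C : Fin n → R} (hsq : ∀ i, C i * C i = 1)
    (hanti : ∀ i j, i ≠ j → C i * C j = -(C j * C i)) (β : Fin n → ZMod 2) (i : Fin n) :
    C i * mon C β = sgn K (sumLT β i) • mon C (β + stdVec i) := by
  induction n with
  | zero => exact i.elim0
  | succ n ih =>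
    rw [mon_succ, mon_succ]
    refine Fin.cases ?_ (fun j => ?_) i
    · have h1 : (fun k : Fin n => (β + stdVec (0 : Fin (n + 1))) k.succ) = fun k => β k.succ := by
        ext k
        rw [Pi.add_apply, stdVec_of_ne (Fin.succ_ne_zero k), add_zero]
      rw [h1, sumLT_zero, sgn_zero, one_smul, ← mul_assoc, Pi.add_apply, stdVec_self]
      congr 1
      rcases zmod_two_cases (β 0) with h | h <;> rw [h]
      · simp [ZMod.val_one]
      · have h11 : (1 : ZMod 2) + 1 = 0 := by decide
        rw [h11]
        simp [ZMod.val_one, hsq]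
    · have h1 : (fun k : Fin n => (β + stdVec j.succ) k.succ) =
          (fun k => β k.succ) + stdVec j := by
        ext k
        rw [Pi.add_apply, Pi.add_apply]
        by_cases h : k = j
        · rw [h, stdVec_self, stdVec_self]
        · rw [stdVec_of_ne h, stdVec_of_ne (fun e => h (Fin.succ_injective _ e))]
      rw [h1, sumLT_succ, sgn_add, Pi.add_apply, stdVec_of_ne (Fin.succ_ne_zero j).symm, add_zero]
      have h2 : C j.succ * C 0 ^ (β 0).val = sgn K (β 0) • (C 0 ^ (β 0).val * C j.succ) := by
        rcases zmod_two_cases (β 0) with h | h <;> rw [h]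
        · simp [sgn_zero]
        · simp [ZMod.val_one, sgn_one, hanti j.succ 0 (Fin.succ_ne_zero j)]
      rw [← mul_assoc, h2, smul_mul_assoc, mul_assoc,
        ih (C := fun i => C i.succ) (fun i => hsq _)
          (fun i j hij => hanti _ _ fun e => hij (Fin.succ_injective _ e)), mul_smul_comm, smul_smul]

theorem mon_add_stdVec {C : Fin n → R} (hsq : ∀ i, C i * C i = 1)
    (hanti : ∀ i j, i ≠ j → C i * C j = -(C j * C i)) (β : Fin n → ZMod 2) (i : Fin n) :
    mon C (β + stdVec i) = sgn K (sumLT β i) • (C i * mon C β) := by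
  rw [c_mul_mon (K := K) hsq hanti, smul_smul, sgn_mul_self, one_smul]

/-- Induction on vectors over `ZMod 2` by adding standard vectors. -/
theorem vec_induction {p : (Fin n → ZMod 2) → Prop} (h0 : p 0)
    (hstep : ∀ β i, p β → p (β + stdVec i)) (β : Fin n → ZMod 2) : p β := by
  have key : ∀ (s : Finset (Fin n)) (β : Fin n → ZMod 2), (∀ i ∉ s, β i = 0) → p β := by
    intro s
    induction s using Finset.induction_on with
    | empty =>
      intro β hβ
      have : β = 0 := funext fun i => hβ i (Finset.notMem_empty i)
      rwa [this]
    | insert a s ha ih =>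
      intro β hβ
      rcases zmod_two_cases (β a) with h | h
      · refine ih β fun i hi => ?_
        by_cases e : i = a
        · rwa [e]
        · exact hβ i (by simp [e, hi])
      · rw [← add_stdVec_add_stdVec β a]
        refine hstep _ _ (ih _ fun i hi => ?_)
        rw [Pi.add_apply]
        by_cases e : i = a
        · rw [e, h, stdVec_self]; decide
        · rw [hβ i (by simp [e, hi]), stdVec_of_ne e, add_zero]
  exact key Finset.univ β fun i hi => absurd (Finset.mem_univ i) hi

/-- An element that commutes or anticommutes with each of the `C_k` does so with their
monomials. -/
theorem mul_mon {C : Fin n → R} (hsq : ∀ i, C i * C i = 1)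
    (hanti : ∀ i j, i ≠ j → C i * C j = -(C j * C i)) {Y : R} {ε : Fin n → ZMod 2}
    (hY : ∀ k, Y * C k = sgn K (ε k) • (C k * Y)) (β : Fin n → ZMod 2) :
    Y * mon C β = sgn K (∑ k, ε k * β k) • (mon C β * Y) := by
  refine vec_induction (p := fun β => Y * mon C β = sgn K (∑ k, ε k * β k) • (mon C β * Y))
    ?_ (fun β i ih => ?_) β
  · simp [mon_zero, sgn_zero]
  · have hs : ∑ k, ε k * (β + stdVec i) k = (∑ k, ε k * β k) + ε i := by
      simp only [Pi.add_apply, mul_add, Finset.sum_add_distrib]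
      congr 1
      rw [Finset.sum_eq_single i, stdVec_self, mul_one]
      · intro k _ hk
        rw [stdVec_of_ne hk, mul_zero]
      · exact fun h => absurd (Finset.mem_univ i) h
    rw [mon_add_stdVec (K := K) hsq hanti, mul_smul_comm, ← mul_assoc, hY, smul_mul_assoc, mul_assoc,
      ih, hs, sgn_add, smul_mul_assoc, mul_smul_comm, mul_assoc]
    module

theorem c_mul_mon_comm {C : Fin n → R} (hsq : ∀ i, C i * C i = 1)
    (hanti : ∀ i j, i ≠ j → C i * C j = -(C j * C i)) (β : Fin n → ZMod 2) {i : Fin n}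
    (hi : β i = 0) : C i * mon C β = sgn K (sumAll β) • (mon C β * C i) := by
  have h := mul_mon (K := K) hsq hanti (Y := C i) (ε := fun k => if k = i then 0 else 1)
    (fun k => by
      by_cases hk : k = i
      · rw [if_pos hk, sgn_zero, one_smul, hk]
      · rw [if_neg hk, sgn_one, neg_one_smul, hanti i k (Ne.symm hk)]) β
  rw [h, sumAll]
  congr 2
  refine Finset.sum_congr rfl fun k _ => ?_
  by_cases hk : k = i
  · rw [hk, hi, mul_zero]
  · rw [if_neg hk, one_mul]

theorem sumLT_hi (β : Fin n → ZMod 2) (i : Fin (n - 1)) :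
    sumLT β (hi i) = sumLT β (lo i) + β (lo i) := by
  rw [← sumLE_eq, sumLT, sumLE]
  refine Finset.sum_congr (Finset.filter_congr fun k _ => ?_) fun _ _ => rfl
  rw [Fin.lt_def, Fin.le_def, val_hi, val_lo, Nat.lt_succ_iff]

theorem sumLT_comp_simple_of_lt (β : Fin n → ZMod 2) (i : Fin (n - 1)) {k : Fin n}
    (h : k ≤ lo i ∨ hi i < k) : sumLT (fun j => β (simple i j)) k = sumLT β k := by
  rw [sumLT_eq, sumLT_eq]
  refine Fintype.sum_equiv (simple i) _ _ fun j => ?_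
  congr 1
  rw [eq_iff_iff]
  by_cases h1 : j = lo i
  · rw [h1, simple_lo]
    simp only [Fin.lt_def, Fin.le_def, val_lo, val_hi] at *
    omega
  · by_cases h2 : j = hi i
    · rw [h2, simple_hi]
      simp only [Fin.lt_def, Fin.le_def, val_lo, val_hi] at *
      omega
    · rw [simple_of_ne h1 h2]

/-- Exchanging two consecutive letters in a monomial. -/
theorem mon_comp_simple {C : Fin n → R} (hsq : ∀ i, C i * C i = 1)
    (hanti : ∀ i j, i ≠ j → C i * C j = -(C j * C i)) (i : Fin (n - 1)) (β : Fin n → ZMod 2) :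
    mon (fun k => C (simple i k)) (fun k => β (simple i k)) =
      sgn K (β (lo i) * β (hi i)) • mon C β := by
  refine vec_induction (p := fun β => mon (fun k => C (simple i k)) (fun k => β (simple i k)) =
      sgn K (β (lo i) * β (hi i)) • mon C β) ?_ (fun β k ih => ?_) β
  · have : (fun k => (0 : Fin n → ZMod 2) (simple i k)) = 0 := rfl
    rw [this, mon_zero, mon_zero, Pi.zero_apply, zero_mul, sgn_zero, one_smul]
  · have e : (fun j => (β + stdVec k) (simple i j)) =
        (fun j => β (simple i j)) + stdVec (simple i k) := by
      ext j
      rw [Pi.add_apply, Pi.add_apply]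
      by_cases hj : simple i j = k
      · rw [hj, ← hj, simple_simple, stdVec_self, stdVec_self]
      · rw [stdVec_of_ne hj, stdVec_of_ne]
        rintro rfl
        exact hj (simple_simple i k)
    have e2 : sgn K (sumLT (fun j => β (simple i j)) (simple i k)) * sgn K (β (lo i) * β (hi i)) =
        sgn K ((β + stdVec k) (lo i) * (β + stdVec k) (hi i)) * sgn K (sumLT β k) := by
      rw [← sgn_add, ← sgn_add, Pi.add_apply, Pi.add_apply]
      congr 1
      by_cases h1 : k = lo i
      · rw [h1, simple_lo, sumLT_hi, sumLT_comp_simple_of_lt β i (Or.inl le_rfl), simple_lo,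
          stdVec_self, stdVec_of_ne (lo_ne_hi i).symm]
        ring
      · by_cases h2 : k = hi i
        · have h11 : β (lo i) + β (lo i) = 0 := CharTwo.add_self_eq_zero _
          rw [h2, simple_hi, sumLT_hi, sumLT_comp_simple_of_lt β i (Or.inl le_rfl),
            stdVec_self, stdVec_of_ne (lo_ne_hi i)]
          linear_combination -h11
        · rw [simple_of_ne h1 h2, stdVec_of_ne (Ne.symm h1), stdVec_of_ne (Ne.symm h2), add_zero,
            add_zero, add_comm, sumLT_comp_simple_of_lt β i]
          simp only [Fin.lt_def, Fin.le_def, Fin.ext_iff, val_lo, val_hi] at *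
          omega
    rw [e, mon_add_stdVec (K := K) (C := fun k => C (simple i k)) (fun _ => hsq _)
      (fun a c hac => hanti _ _ fun e => hac ((simple i).injective e)), ih,
      mon_add_stdVec (K := K) hsq hanti, simple_simple, mul_smul_comm, smul_smul, smul_smul, e2]

end Monomials

/-! ### Joint eigenvectors -/

section Eigenvectors

variable {K M : Type*} [Field K] [AddCommGroup M] [Module K M]

/-- Joint eigenvectors with pairwise different systems of eigenvalues are linearly independent. -/
theorem linearIndependent_of_joint_eigenvectors {I J : Type*} {w : I → M} (hw : ∀ i, w i ≠ 0)
    (T : J → Module.End K M) (χ : I → J → K) (hT : ∀ i j, T j (w i) = χ i j • w i)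
    (hχ : Function.Injective χ) : LinearIndependent K w := by
  classical
  rw [linearIndependent_iff']
  intro s
  induction s using Finset.induction_on with
  | empty => exact fun _ _ i hi => absurd hi (Finset.notMem_empty i)
  | insert a s ha ih =>
    intro g hg
    have hs : ∀ c ∈ s, g c = 0 := by
      intro c hc
      have hne : c ≠ a := by rintro rfl; exact ha hc
      obtain ⟨j, hj⟩ := Function.ne_iff.1 fun e => hne (hχ e)
      have h1 : ∑ i ∈ s, (g i * (χ i j - χ a j)) • w i = 0 := by
        rw [Finset.sum_insert ha] at hg
        have h2 := congrArg (T j) hg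
        rw [map_add, map_smul, hT, map_zero, map_sum] at h2
        have h3 : ∑ i ∈ s, (g i * (χ i j - χ a j)) • w i =
            ∑ i ∈ s, T j (g i • w i) - χ a j • ∑ i ∈ s, g i • w i := by
          rw [Finset.smul_sum, ← Finset.sum_sub_distrib]
          refine Finset.sum_congr rfl fun i _ => ?_
          rw [map_smul, hT]
          module
        rw [h3, eq_neg_of_add_eq_zero_right h2, eq_neg_of_add_eq_zero_right hg]
        module
      have := ih _ h1 c hc
      exact (mul_eq_zero.1 this).resolve_right (sub_ne_zero.2 hj)
    intro i hi
    rcases Finset.mem_insert.1 hi with rfl | hi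
    · rw [Finset.sum_insert ha, Finset.sum_eq_zero fun c hc => by rw [hs c hc, zero_smul],
        add_zero] at hg
      exact (smul_eq_zero.1 hg).resolve_right (hw _)
    · exact hs i hi

/-- If the commuting operators `T j` have the squares `(τ j)²` and each `T j` is turned into its
negative by an involution `F j` that commutes with the other ones, then a homogeneous vector can be
moved to a joint eigenvector with the eigenvalues `τ j`. -/
theorem exists_joint_eigenvector {J : Type*} [Fintype J] (T F : J → Module.End K M) (τ : J → K)
    (P : Module.End K M) (hsq : ∀ j z, T j (T j z) = (τ j * τ j) • z)
    (hT : ∀ i j z, T i (T j z) = T j (T i z)) (hF : ∀ j z, F j (F j z) = z)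
    (hTF : ∀ j z, T j (F j z) = -F j (T j z)) (hTF' : ∀ i j, i ≠ j → ∀ z, T i (F j z) = F j (T i z))
    (hPT : ∀ j z, P (T j z) = T j (P z)) (hPF : ∀ j z, P (F j z) = -F j (P z)) {z : M} (hz : z ≠ 0)
    (hPz : P z = z ∨ P z = -z) :
    ∃ z : M, z ≠ 0 ∧ (P z = z ∨ P z = -z) ∧ ∀ j, T j z = τ j • z := by
  classical
  have key : ∀ s : Finset J, ∃ z : M, z ≠ 0 ∧ (P z = z ∨ P z = -z) ∧ ∀ j ∈ s, T j z = τ j • z := by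
    intro s
    induction s using Finset.induction_on with
    | empty => exact ⟨z, hz, hPz, fun j hj => absurd hj (Finset.notMem_empty j)⟩
    | insert a s ha ih =>
      obtain ⟨z, hz, hPz, hs⟩ := ih
      by_cases h0 : T a z + τ a • z = 0
      · have h1 : T a z = -(τ a • z) := eq_neg_of_add_eq_zero_left h0
        refine ⟨F a z, fun h => hz (by rw [← hF a z, h, map_zero]), ?_, fun j hj => ?_⟩
        · rcases hPz with h | h
          · right; rw [hPF, h]
          · left; rw [hPF, h, map_neg, neg_neg]
        · rcases Finset.mem_insert.1 hj with rfl | hj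
          · rw [hTF, h1, map_neg, neg_neg, map_smul]
          · rw [hTF' j a (fun e => ha (e ▸ hj)), hs j hj, map_smul]
      · refine ⟨_, h0, ?_, fun j hj => ?_⟩
        · rcases hPz with h | h
          · left; rw [map_add, hPT, map_smul, h]
          · right; rw [map_add, hPT, map_smul, h, map_neg, smul_neg, neg_add]
        · rcases Finset.mem_insert.1 hj with rfl | hj
          · rw [map_add, hsq, map_smul, smul_add, smul_smul, add_comm]
          · rw [map_add, hT, hs j hj, map_smul, map_smul, hs j hj, smul_add]
            congr 1
            rw [smul_comm]
  obtain ⟨z, h1, h2, h3⟩ := key Finset.univ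
  exact ⟨z, h1, h2, fun j => h3 j (Finset.mem_univ j)⟩

end Eigenvectors

/-! ### The basis generated by a polarized vector -/

section Polarized

variable {K M : Type*} [Field K] [AddCommGroup M] [Module K M] {n r : ℕ}

/-- A vector `z` on which the `X i` act by `u i`, and which is fixed by all
`i₀ C_{d(2k)} C_{d(2k+1)}`, where `i₀² = -1` and `d(0), d(1), …` are the indices with `u i = 0`. -/
structure IsPolarized (A u : Fin n → K) (X C : Fin n → Module.End K M) (i₀ : K)
    (d : ∀ p, p < r → Fin n) (z : M) : Prop where
  rel : XCRel A X C
  i₀_sq : i₀ * i₀ = -1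
  inj : ∀ p hp p' hp', d p hp = d p' hp' → p = p'
  u_eq_zero_iff : ∀ i, u i = 0 ↔ ∃ p hp, i = d p hp
  x_apply : ∀ i, X i z = u i • z
  pair : ∀ k (hk : 2 * k + 1 < r), i₀ • C (d (2 * k) (by omega)) (C (d (2 * k + 1) hk) z) = z

/-- The operator `i₀ C_{d(2k)} C_{d(2k+1)}`. -/
def pairOp (C : Fin n → Module.End K M) (i₀ : K) (d : ∀ p, p < r → Fin n) (k : ℕ)
    (hk : 2 * k + 1 < r) : Module.End K M :=
  i₀ • (C (d (2 * k) (by omega)) * C (d (2 * k + 1) hk))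

section PairOp

variable {A : Fin n → K} {X C : Fin n → Module.End K M} {i₀ : K} {d : ∀ p, p < r → Fin n}
  (hrel : XCRel A X C) (hinj : ∀ p hp p' hp', d p hp = d p' hp' → p = p')
include hrel hinj

theorem pairOp_mul_c (k : ℕ) (hk : 2 * k + 1 < r) (l : Fin n) :
    pairOp C i₀ d k hk * C l =
      sgn K ((if l = d (2 * k) (by omega) then 1 else 0) + if l = d (2 * k + 1) hk then 1 else 0) •
        (C l * pairOp C i₀ d k hk) := by
  have hne : d (2 * k) (by omega) ≠ d (2 * k + 1) hk := fun e => by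
    have := hinj _ _ _ _ e; omega
  rw [pairOp, smul_mul_assoc, mul_smul_comm, smul_comm (sgn K _)]
  congr 1
  generalize d (2 * k) _ = a at *
  generalize d (2 * k + 1) _ = c at *
  by_cases h1 : l = a
  · subst h1
    rw [if_pos rfl, if_neg hne, add_zero, sgn_one, neg_one_smul, mul_assoc,
      hrel.c_anti c l hne.symm, mul_neg]
  · by_cases h2 : l = c
    · subst h2
      rw [if_pos rfl, if_neg h1, zero_add, sgn_one, neg_one_smul, ← mul_assoc,
        hrel.c_anti l a h1, neg_mul, neg_neg]
    · rw [if_neg h1, if_neg h2, add_zero, sgn_zero, one_smul, mul_assoc,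
        hrel.c_anti c l (Ne.symm h2), mul_neg, ← mul_assoc, hrel.c_anti a l (Ne.symm h1), neg_mul,
        neg_neg, mul_assoc]

theorem pairOp_sq (hi : i₀ * i₀ = -1) (k : ℕ) (hk : 2 * k + 1 < r) :
    pairOp C i₀ d k hk * pairOp C i₀ d k hk = 1 := by
  have hne : d (2 * k) (by omega) ≠ d (2 * k + 1) hk := fun e => by
    have := hinj _ _ _ _ e; omega
  have h := pairOp_mul_c (i₀ := i₀) hrel hinj k hk (d (2 * k + 1) hk)
  rw [if_pos rfl, if_neg hne.symm, zero_add, sgn_one, neg_one_smul] at h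
  have h' : C (d (2 * k + 1) hk) * pairOp C i₀ d k hk =
      -(pairOp C i₀ d k hk * C (d (2 * k + 1) hk)) := by rw [h, neg_neg]
  conv_lhs => arg 1; rw [pairOp]
  rw [smul_mul_assoc, mul_assoc, h', pairOp, smul_mul_assoc, mul_assoc, hrel.c_sq, mul_one, mul_neg,
    mul_smul_comm, hrel.c_sq, smul_neg, smul_smul, hi, neg_one_smul, neg_neg]

theorem commute_pairOp (k l : ℕ) (hk : 2 * k + 1 < r) (hl : 2 * l + 1 < r) :
    Commute (pairOp C i₀ d k hk) (pairOp C i₀ d l hl) := by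
  by_cases hkl : k = l
  · subst hkl
    exact Commute.refl _
  · have h : ∀ p hp, p ≠ 2 * k → p ≠ 2 * k + 1 → Commute (pairOp C i₀ d k hk) (C (d p hp)) := by
      intro p hp h1 h2
      have := pairOp_mul_c (i₀ := i₀) hrel hinj k hk (d p hp)
      rwa [if_neg fun e => h1 (hinj _ _ _ _ e), if_neg fun e => h2 (hinj _ _ _ _ e), add_zero,
        sgn_zero, one_smul] at this
    exact ((h _ _ (by omega) (by omega)).mul_right (h _ _ (by omega) (by omega))).smul_right _

omit hinj in
theorem commute_pairOp_x (hX0 : ∀ p hp, X (d p hp) = 0) (k : ℕ) (hk : 2 * k + 1 < r) (i : Fin n) :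
    Commute (X i) (pairOp C i₀ d k hk) := by
  by_cases h : ∃ p hp, i = d p hp
  · obtain ⟨p, hp, rfl⟩ := h
    rw [hX0]
    exact Commute.zero_left _
  · push Not at h
    have h' : ∀ p hp, Commute (X i) (C (d p hp)) := fun p hp => hrel.x_c_of_ne i _ (h p hp)
    exact ((h' _ _).mul_right (h' _ _)).smul_right _

/-- Homogeneous polarized vectors exist. -/
theorem exists_isPolarized [Nontrivial M] {u : Fin n → K} {P : Module.End K M}
    (hi : i₀ * i₀ = -1) (hu : ∀ i, u i = 0 ↔ ∃ p hp, i = d p hp) (huA : ∀ i, A i = u i * u i)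
    (hX0 : ∀ i, u i = 0 → X i = 0) (hPP : P * P = 1) (hPX : ∀ i, P * X i = X i * P)
    (hPC : ∀ i, P * C i = -(C i * P)) :
    ∃ z : M, z ≠ 0 ∧ (P z = z ∨ P z = -z) ∧ IsPolarized A u X C i₀ d z := by
  classical
  have hX0' : ∀ p hp, X (d p hp) = 0 := fun p hp => hX0 _ ((hu _).2 ⟨p, hp, rfl⟩)
  obtain ⟨z, hz, hPz⟩ : ∃ z : M, z ≠ 0 ∧ (P z = z ∨ P z = -z) := by
    obtain ⟨z, hz⟩ := exists_ne (0 : M)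
    have hPPz : P (P z) = z := LinearMap.congr_fun hPP z
    by_cases h : z + P z = 0
    · exact ⟨z, hz, Or.inr (eq_neg_of_add_eq_zero_right h)⟩
    · exact ⟨z + P z, h, Or.inl (by rw [map_add, hPPz, add_comm])⟩
  have hPh : ∀ k hk, P * pairOp C i₀ d k hk = pairOp C i₀ d k hk * P := by
    intro k hk
    rw [pairOp, mul_smul_comm, ← mul_assoc, hPC, neg_mul, mul_assoc, hPC, mul_neg, neg_neg,
      smul_mul_assoc, mul_assoc]
  let J := {i : Fin n // u i ≠ 0} ⊕ Fin (r / 2)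
  have hlt : ∀ k : Fin (r / 2), 2 * k.val + 1 < r := fun k => by have := k.2; omega
  let T : J → Module.End K M := Sum.elim (fun i => X i.1) fun k => pairOp C i₀ d k.1 (hlt k)
  let F : J → Module.End K M :=
    Sum.elim (fun i => C i.1) fun k => C (d (2 * k.1) (by have := hlt k; omega))
  let τ : J → K := Sum.elim (fun i => u i.1) fun _ => 1
  have hoff : ∀ i : {i : Fin n // u i ≠ 0}, ∀ p hp, i.1 ≠ d p hp := fun i p hp e =>
    i.2 ((hu _).2 ⟨p, hp, e⟩)
  have hpc : ∀ k hk l, l ≠ d (2 * k) (by omega) → l ≠ d (2 * k + 1) hk →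
      pairOp C i₀ d k hk * C l = C l * pairOp C i₀ d k hk := by
    intro k hk l h1 h2
    have := pairOp_mul_c (i₀ := i₀) hrel hinj k hk l
    rwa [if_neg h1, if_neg h2, add_zero, sgn_zero, one_smul] at this
  obtain ⟨y, hy, hPy, hTy⟩ := exists_joint_eigenvector T F τ P
    (by
      rintro (i | k) z
      · have := LinearMap.congr_fun (hrel.x_sq i.1) z
        rw [huA] at this
        exact this
      · have := LinearMap.congr_fun (pairOp_sq hrel hinj hi k.1 (hlt k)) z
        exact this.trans (by simp [τ]))
    (by
      rintro (i | k) (j | l) z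
      · exact LinearMap.congr_fun (hrel.x_comm i.1 j.1) z
      · exact LinearMap.congr_fun (commute_pairOp_x hrel hX0' l.1 (hlt l) i.1).eq z
      · exact LinearMap.congr_fun (commute_pairOp_x hrel hX0' k.1 (hlt k) j.1).eq.symm z
      · exact LinearMap.congr_fun (commute_pairOp hrel hinj k.1 l.1 (hlt k) (hlt l)).eq z)
    (by
      rintro (i | k) z
      · exact LinearMap.congr_fun (hrel.c_sq i.1) z
      · exact LinearMap.congr_fun (hrel.c_sq _) z)
    (by
      rintro (i | k) z
      · exact LinearMap.congr_fun (hrel.x_c i.1) z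
      · have := pairOp_mul_c (i₀ := i₀) hrel hinj k.1 (hlt k) (d (2 * k.1) (by have := hlt k; omega))
        rw [if_pos rfl, if_neg fun e => by have := hinj _ _ _ _ e; omega, add_zero, sgn_one,
          neg_one_smul] at this
        exact LinearMap.congr_fun this z)
    (by
      rintro (i | k) (j | l) hne z
      · exact LinearMap.congr_fun (hrel.x_c_of_ne i.1 j.1 fun e => hne (congrArg _ (Subtype.ext e))) z
      · exact LinearMap.congr_fun (hrel.x_c_of_ne i.1 _ (hoff i _ _)) z
      · exact LinearMap.congr_fun (hpc k.1 (hlt k) j.1 (hoff j _ _) (hoff j _ _)) z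
      · have hkl : k.1 ≠ l.1 := fun e => hne (congrArg _ (Fin.ext e))
        exact LinearMap.congr_fun (hpc k.1 (hlt k) _
          (fun e => by have := hinj _ _ _ _ e; omega)
          (fun e => by have := hinj _ _ _ _ e; omega)) z)
    (by
      rintro (i | k) z
      · exact LinearMap.congr_fun (hPX i.1) z
      · exact LinearMap.congr_fun (hPh k.1 (hlt k)) z)
    (by
      rintro (i | k) z
      · exact LinearMap.congr_fun (hPC i.1) z
      · exact LinearMap.congr_fun (hPC _) z)
    hz hPz
  refine ⟨y, hy, hPy, hrel, hi, hinj, hu, fun i => ?_, fun k hk => ?_⟩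
  · by_cases h : u i = 0
    · rw [hX0 i h, h, zero_smul, LinearMap.zero_apply]
    · exact hTy (Sum.inl ⟨i, h⟩)
  · exact (hTy (Sum.inr ⟨k, by omega⟩)).trans (one_smul K y)

end PairOp

namespace IsPolarized

variable {A u : Fin n → K} {X C : Fin n → Module.End K M} {i₀ : K} {d : ∀ p, p < r → Fin n}
  {z : M} (h : IsPolarized A u X C i₀ d z)
include h

theorem x_mul_mon (i : Fin n) (β : Fin n → ZMod 2) :
    X i * mon C β = sgn K (β i) • (mon C β * X i) := by
  have := mul_mon (K := K) h.rel.c_sq h.rel.c_anti (Y := X i) (ε := fun k => if k = i then 1 else 0)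
    (fun k => by
      by_cases hk : k = i
      · rw [if_pos hk, sgn_one, neg_one_smul, hk, h.rel.x_c]
      · rw [if_neg hk, sgn_zero, one_smul, h.rel.x_c_of_ne i k (Ne.symm hk)]) β
  rw [this]
  simp

theorem x_bas (i : Fin n) (β : Fin n → ZMod 2) {α : Fin n → ZMod 2}
    (hα : ∀ k, α k ≠ 0 → u k = 0) :
    X i ((mon C β * mon C α) z) = (sgn K (β i) * u i) • (mon C β * mon C α) z := by
  have e : X i * (mon C β * mon C α) =
      (sgn K (β i) * sgn K (α i)) • (mon C β * mon C α * X i) := by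
    rw [← mul_assoc, h.x_mul_mon, smul_mul_assoc, mul_assoc, h.x_mul_mon, mul_smul_comm, smul_smul,
      mul_assoc]
  have e' := LinearMap.congr_fun e z
  rw [Module.End.mul_apply, LinearMap.smul_apply, Module.End.mul_apply _ (X i), h.x_apply, map_smul,
    smul_smul] at e'
  rw [e']
  congr 1
  by_cases hi : α i = 0
  · rw [hi, sgn_zero, mul_one]
  · rw [hα i hi, mul_zero, mul_zero]

/-- The action of `c_i`. For `i` among the indices `d(p)` the vector on the right leaves the basis,
and `c_bas_of_even` or `c_bas_of_odd` gives the expansion. -/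
theorem c_bas (i : Fin n) (β α : Fin n → ZMod 2) :
    C i ((mon C β * mon C α) z) =
      sgn K (sumLT β i) • (mon C (β + stdVec i) * mon C α) z := by
  rw [← Module.End.mul_apply, ← mul_assoc, c_mul_mon (K := K) h.rel.c_sq h.rel.c_anti,
    smul_mul_assoc, LinearMap.smul_apply]

theorem c_bas_of_even (i : Fin n) {β : Fin n → ZMod 2} (hβ : β i = 0) (α : Fin n → ZMod 2) :
    C i ((mon C β * mon C α) z) =
      sgn K (sumAll β + sumLT α i) • (mon C β * mon C (α + stdVec i)) z := by
  rw [← Module.End.mul_apply, ← mul_assoc, c_mul_mon_comm (K := K) h.rel.c_sq h.rel.c_anti β hβ,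
    smul_mul_assoc, mul_assoc, c_mul_mon (K := K) h.rel.c_sq h.rel.c_anti, mul_smul_comm, smul_smul,
    ← sgn_add, LinearMap.smul_apply]

/-- The two members of a pair act on `z` by proportional vectors. -/
theorem c_partner (k : ℕ) (hk : 2 * k + 1 < r) :
    C (d (2 * k + 1) hk) z = (-i₀) • C (d (2 * k) (by omega)) z := by
  have e := congrArg (C (d (2 * k) (by omega))) (h.pair k hk)
  rw [map_smul, ← Module.End.mul_apply, h.rel.c_sq, Module.End.one_apply] at e
  rw [← e, smul_smul, neg_mul, h.i₀_sq, neg_neg, one_smul]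

theorem c_bas_of_odd (k : ℕ) (hk : 2 * k + 1 < r) {β α : Fin n → ZMod 2}
    (hβ : β (d (2 * k + 1) hk) = 0) (hα : α (d (2 * k + 1) hk) = 0) :
    C (d (2 * k + 1) hk) ((mon C β * mon C α) z) =
      (-i₀ * sgn K (sumAll β + sumLE α (d (2 * k) (by omega)))) •
        (mon C β * mon C (α + stdVec (d (2 * k) (by omega)))) z := by
  have h1 := c_mul_mon_comm (K := K) h.rel.c_sq h.rel.c_anti β hβ
  have h2 := c_mul_mon_comm (K := K) h.rel.c_sq h.rel.c_anti α hα
  have h3 := h.c_partner k hk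
  generalize d (2 * k + 1) hk = i at *
  generalize d (2 * k) _ = j at *
  have h4 : mon C α * C j =
      sgn K (sumAll α + sumLE α j) • mon C (α + stdVec j) := by
    have h5 := mul_mon (K := K) h.rel.c_sq h.rel.c_anti (Y := C j)
      (ε := fun k => if k = j then 0 else 1) (fun k => by
        by_cases hk : k = j
        · rw [if_pos hk, sgn_zero, one_smul, hk]
        · rw [if_neg hk, sgn_one, neg_one_smul, h.rel.c_anti j k (Ne.symm hk)]) α
    have h6 : ∑ k, (if k = j then (0 : ZMod 2) else 1) * α k = sumAll α + α j := by
      rw [sumAll, ← Fintype.sum_ite_eq j α, ← Finset.sum_add_distrib]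
      refine Finset.sum_congr rfl fun k _ => ?_
      by_cases hk : k = j
      · rw [if_pos hk, if_pos hk.symm, zero_mul, CharTwo.add_self_eq_zero]
      · rw [if_neg hk, if_neg (Ne.symm hk), one_mul, add_zero]
    rw [h6, c_mul_mon (K := K) h.rel.c_sq h.rel.c_anti] at h5
    have h7 := congrArg (fun y => sgn K (sumAll α + α j) • y) h5
    simp only [smul_smul, sgn_mul_self, one_smul] at h7
    rw [← h7, ← sgn_add, sumLE_eq, add_assoc, add_comm (α j)]
  have e : C i * (mon C β * mon C α) =
      (sgn K (sumAll β) * sgn K (sumAll α)) • (mon C β * (mon C α * C i)) := by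
    rw [← mul_assoc, h1, smul_mul_assoc, mul_assoc, h2, mul_smul_comm, smul_smul]
  have e' : (mon C β * (mon C α * C i)) z = (-i₀) • (mon C β * (mon C α * C j)) z := by
    rw [Module.End.mul_apply, Module.End.mul_apply, h3, map_smul, map_smul]; rfl
  rw [← Module.End.mul_apply, e, LinearMap.smul_apply, e', h4, mul_smul_comm, LinearMap.smul_apply,
    smul_smul, smul_smul]
  congr 1
  rw [sgn_add, sgn_add]
  linear_combination (-i₀) * sgn K (sumAll β) * sgn K (sumLE α j) * sgn_mul_self (K := K) (sumAll α)

theorem bas_ne_zero (hz : z ≠ 0) (β α : Fin n → ZMod 2) : (mon C β * mon C α) z ≠ 0 := by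
  have key : ∀ (β : Fin n → ZMod 2) (y : M), mon C β y = 0 → y = 0 := by
    intro β
    refine vec_induction (p := fun β => ∀ y : M, mon C β y = 0 → y = 0) ?_ (fun β i ih y hy => ?_) β
    · intro y hy
      rwa [mon_zero, Module.End.one_apply] at hy
    · refine ih y ?_
      have e := congrArg (C i) hy
      rw [← Module.End.mul_apply, c_mul_mon (K := K) h.rel.c_sq h.rel.c_anti,
        add_stdVec_add_stdVec, LinearMap.smul_apply, map_zero] at e
      refine (smul_eq_zero.1 e).resolve_left fun h0 => ?_
      have := sgn_mul_self (K := K) (sumLT (β + stdVec i) i)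
      rw [h0, mul_zero] at this
      exact zero_ne_one this
  exact fun h0 => hz (key α z (key β _ h0))

theorem pairOp_bas (k : ℕ) (hk : 2 * k + 1 < r) {β α : Fin n → ZMod 2}
    (hβ : ∀ p hp, β (d p hp) = 0) (hα : α (d (2 * k + 1) hk) = 0) :
    pairOp C i₀ d k hk ((mon C β * mon C α) z) =
      sgn K (α (d (2 * k) (by omega))) • (mon C β * mon C α) z := by
  have key := mul_mon (K := K) h.rel.c_sq h.rel.c_anti (pairOp_mul_c (i₀ := i₀) h.rel h.inj k hk)
  have hs : ∀ γ : Fin n → ZMod 2, ∑ l, ((if l = d (2 * k) (by omega) then (1 : ZMod 2) else 0) +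
      if l = d (2 * k + 1) hk then 1 else 0) * γ l =
        γ (d (2 * k) (by omega)) + γ (d (2 * k + 1) hk) := by
    intro γ
    simp [add_mul, Finset.sum_add_distrib]
  have e : pairOp C i₀ d k hk * (mon C β * mon C α) =
      sgn K (α (d (2 * k) (by omega))) • (mon C β * mon C α * pairOp C i₀ d k hk) := by
    rw [← mul_assoc, key, hs, hβ, hβ, add_zero, sgn_zero, one_smul, mul_assoc, key, hs, hα, add_zero,
      mul_smul_comm, mul_assoc]
  have hp : pairOp C i₀ d k hk z = z := h.pair k hk
  rw [← Module.End.mul_apply, e, LinearMap.smul_apply, Module.End.mul_apply _ (pairOp C i₀ d k hk),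
    hp]

/-- The monomials are homogeneous. -/
theorem par_bas {P : Module.End K M} (hPC : ∀ i, P * C i = -(C i * P)) {ε : K} (hP : P z = ε • z)
    (β α : Fin n → ZMod 2) :
    P ((mon C β * mon C α) z) = (sgn K (sumAll β + sumAll α) * ε) • (mon C β * mon C α) z := by
  have key := mul_mon (K := K) h.rel.c_sq h.rel.c_anti (Y := P) (ε := fun _ => 1)
    (fun k => by rw [sgn_one, neg_one_smul, hPC])
  simp only [one_mul] at key
  have e : P * (mon C β * mon C α) =
      sgn K (sumAll β + sumAll α) • (mon C β * mon C α * P) := by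
    rw [← mul_assoc, key, smul_mul_assoc, mul_assoc, key, mul_smul_comm, smul_smul, ← sgn_add,
      mul_assoc]
    rfl
  rw [← Module.End.mul_apply, e, LinearMap.smul_apply, Module.End.mul_apply _ P, hP, map_smul,
    smul_smul]

omit h in
theorem sgn_injective (h2 : (2 : K) ≠ 0) : Function.Injective (sgn K) := by
  have h1 : (1 : K) ≠ -1 := fun e => h2 (by linear_combination e)
  intro a c hac
  rcases zmod_two_cases a with rfl | rfl <;> rcases zmod_two_cases c with rfl | rfl
  · rfl
  · rw [sgn_zero, sgn_one] at hac; exact absurd hac h1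
  · rw [sgn_zero, sgn_one] at hac; exact absurd hac.symm h1
  · rfl

/-- A homogeneous polarized vector of an irreducible module generates a basis of monomials. They
are linearly independent because the operators `X i`, `i₀ C_{d(2k)} C_{d(2k+1)}` and the parity,
for which they are joint eigenvectors, tell them apart; the last one is needed if the number of
indices with `u i = 0` is odd. -/
theorem exists_basis (h2 : (2 : K) ≠ 0) (hz : z ≠ 0) {P : Module.End K M}
    (hPC : ∀ i, P * C i = -(C i * P)) (hPz : P z = z ∨ P z = -z)
    (hirr : ∀ W : Submodule K M, (∀ i, ∀ y ∈ W, X i y ∈ W) → (∀ i, ∀ y ∈ W, C i y ∈ W) →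
      (∀ y ∈ W, P y ∈ W) → W ≠ ⊥ → W = ⊤)
    (pD pO : Fin n → Prop) (hD : ∀ i, pD i ↔ ∃ p hp, i = d p hp)
    (hO : ∀ i, pO i ↔ ∃ p hp, i = d (2 * p) hp) :
    ∃ B : Module.Basis ({β : Fin n → ZMod 2 // ∀ k, β k ≠ 0 → ¬ pD k} ×
        {α : Fin n → ZMod 2 // ∀ k, α k ≠ 0 → pO k}) K M,
      ∀ β α, B (β, α) = (mon C β.1 * mon C α.1) z := by
  obtain ⟨ε, hε, hPε⟩ : ∃ ε : K, ε ≠ 0 ∧ P z = ε • z := by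
    rcases hPz with e | e
    · exact ⟨1, one_ne_zero, by rw [e, one_smul]⟩
    · exact ⟨-1, neg_ne_zero.2 one_ne_zero, by rw [e, neg_one_smul]⟩
  let I := {β : Fin n → ZMod 2 // ∀ k, β k ≠ 0 → ¬ pD k} ×
    {α : Fin n → ZMod 2 // ∀ k, α k ≠ 0 → pO k}
  let w : I → M := fun y => (mon C y.1.1 * mon C y.2.1) z
  have hβ0 : ∀ (y : I) p hp, y.1.1 (d p hp) = 0 := fun y p hp =>
    by_contra fun e => y.1.2 _ e ((hD _).2 ⟨p, hp, rfl⟩)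
  have hα0 : ∀ (y : I) k (hk : 2 * k + 1 < r), y.2.1 (d (2 * k + 1) hk) = 0 := fun y k hk =>
    by_contra fun e => by
      obtain ⟨p, hp, e'⟩ := (hO _).1 (y.2.2 _ e)
      have := h.inj _ _ _ _ e'
      omega
  have hαu : ∀ (y : I) k, y.2.1 k ≠ 0 → u k = 0 := fun y k e => by
    obtain ⟨p, hp, e'⟩ := (hO _).1 (y.2.2 _ e)
    exact (h.u_eq_zero_iff k).2 ⟨_, hp, e'⟩
  have hlt : ∀ k : Fin (r / 2), 2 * k.val + 1 < r := fun k => by have := k.2; omega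
  have hindep : LinearIndependent K w := by
    refine linearIndependent_of_joint_eigenvectors (J := Fin n ⊕ Fin (r / 2) ⊕ Unit)
      (fun y => h.bas_ne_zero hz _ _)
      (Sum.elim X (Sum.elim (fun k => pairOp C i₀ d k.1 (hlt k)) fun _ => P))
      (fun y => Sum.elim (fun i => sgn K (y.1.1 i) * u i)
        (Sum.elim (fun k => sgn K (y.2.1 (d (2 * k.1) (by have := hlt k; omega))))
          fun _ => sgn K (sumAll y.1.1 + sumAll y.2.1) * ε)) ?_ ?_
    · rintro y (i | k | _)
      · exact h.x_bas i _ (hαu y)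
      · exact h.pairOp_bas k.1 (hlt k) (hβ0 y) (hα0 y k.1 (hlt k))
      · exact h.par_bas hPC hPε _ _
    · intro y y' e
      have e1 : ∀ i, sgn K (y.1.1 i) * u i = sgn K (y'.1.1 i) * u i := fun i =>
        congrFun e (Sum.inl i)
      have e2 : ∀ k : Fin (r / 2), sgn K (y.2.1 (d (2 * k.1) (by have := hlt k; omega))) =
          sgn K (y'.2.1 (d (2 * k.1) (by have := hlt k; omega))) := fun k =>
        congrFun e (Sum.inr (Sum.inl k))
      have e3 : sgn K (sumAll y.1.1 + sumAll y.2.1) * ε =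
          sgn K (sumAll y'.1.1 + sumAll y'.2.1) * ε := congrFun e (Sum.inr (Sum.inr ()))
      have f1 : y.1 = y'.1 := by
        refine Subtype.ext (funext fun i => ?_)
        by_cases hi : u i = 0
        · obtain ⟨p, hp, rfl⟩ := (h.u_eq_zero_iff i).1 hi
          rw [hβ0, hβ0]
        · exact sgn_injective h2 (mul_right_cancel₀ hi (e1 i))
      have f3 : sumAll y.2.1 = sumAll y'.2.1 := by
        have := sgn_injective h2 (mul_right_cancel₀ hε e3)
        rwa [f1, add_right_inj] at this
      have f2 : ∀ k, 2 * k + 1 < r → ∀ hk, y.2.1 (d (2 * k) hk) = y'.2.1 (d (2 * k) hk) :=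
        fun k hk _ => sgn_injective h2 (e2 ⟨k, by omega⟩)
      have f4 : ∀ l, (∀ p hp, l = d (2 * p) hp → 2 * p + 1 < r) → y.2.1 l = y'.2.1 l := by
        intro l hl
        by_cases hlO : pO l
        · obtain ⟨p, hp, rfl⟩ := (hO l).1 hlO
          exact f2 p (hl p hp rfl) hp
        · rw [by_contra fun e => hlO (y.2.2 l e), by_contra fun e => hlO (y'.2.2 l e)]
      have f5 : y.2 = y'.2 := by
        refine Subtype.ext (funext fun l => ?_)
        by_cases hl : ∀ p hp, l = d (2 * p) hp → 2 * p + 1 < r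
        · exact f4 l hl
        · push Not at hl
          obtain ⟨p, hp, rfl, hpr⟩ := hl
          rw [sumAll, sumAll, ← Finset.add_sum_erase _ _ (Finset.mem_univ (d (2 * p) hp)),
            ← Finset.add_sum_erase _ y'.2.1 (Finset.mem_univ (d (2 * p) hp)),
            Finset.sum_congr rfl (g := y'.2.1), add_left_inj] at f3
          · exact f3
          · intro l hl
            refine f4 l fun p' hp' e' => ?_
            have : p' ≠ p := by
              rintro rfl
              exact (Finset.mem_erase.1 hl).1 e'
            omega
      exact Prod.ext f1 f5
  have hspan : Submodule.span K (Set.range w) = ⊤ := by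
    have hmem : ∀ y, w y ∈ Submodule.span K (Set.range w) := fun y => Submodule.subset_span ⟨y, rfl⟩
    have hstable : ∀ f : Module.End K M, (∀ y, f (w y) ∈ Submodule.span K (Set.range w)) →
        ∀ y ∈ Submodule.span K (Set.range w), f y ∈ Submodule.span K (Set.range w) := by
      intro f hf y hy
      have : Submodule.span K (Set.range w) ≤ (Submodule.span K (Set.range w)).comap f := by
        rw [Submodule.span_le]
        rintro _ ⟨y, rfl⟩
        exact hf y
      exact this hy
    have hadd : ∀ (pr : Fin n → Prop) (β : Fin n → ZMod 2) (i : Fin n), (∀ k, β k ≠ 0 → pr k) →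
        pr i → ∀ k, (β + stdVec i) k ≠ 0 → pr k := by
      intro pr β i hβ hi k hk
      by_cases e : k = i
      · rwa [e]
      · rw [Pi.add_apply, stdVec_of_ne e, add_zero] at hk
        exact hβ k hk
    refine hirr _ (fun i => hstable _ fun y => ?_) (fun i => hstable _ fun y => ?_)
      (hstable _ fun y => ?_) ?_
    · rw [h.x_bas i _ (hαu y)]
      exact Submodule.smul_mem _ _ (hmem y)
    · by_cases hi : pD i
      · obtain ⟨p, hp, rfl⟩ := (hD i).1 hi
        obtain ⟨k, rfl | rfl⟩ := Nat.even_or_odd' p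
        · rw [h.c_bas_of_even _ (hβ0 y _ _)]
          exact Submodule.smul_mem _ _ (hmem ⟨y.1, ⟨_, hadd pO _ _ y.2.2 ((hO _).2 ⟨k, hp, rfl⟩)⟩⟩)
        · rw [h.c_bas_of_odd k hp (hβ0 y _ _) (hα0 y _ _)]
          exact Submodule.smul_mem _ _
            (hmem ⟨y.1, ⟨_, hadd pO _ _ y.2.2 ((hO _).2 ⟨k, by omega, rfl⟩)⟩⟩)
      · rw [h.c_bas]
        exact Submodule.smul_mem _ _ (hmem ⟨⟨_, hadd (fun k => ¬ pD k) _ _ y.1.2 hi⟩, y.2⟩)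
    · rw [h.par_bas hPC hPε]
      exact Submodule.smul_mem _ _ (hmem y)
    · rw [Submodule.ne_bot_iff]
      let y0 : I := ⟨⟨0, fun k hk => absurd rfl hk⟩, ⟨0, fun k hk => absurd rfl hk⟩⟩
      exact ⟨w y0, hmem y0, h.bas_ne_zero hz _ _⟩
  refine ⟨Module.Basis.mk hindep hspan.ge, fun β α => ?_⟩
  rw [Module.Basis.mk_apply]

end IsPolarized

end Polarized

/-! ### The action of the simple transpositions on the basis -/

section PolarizedAction

variable {K M : Type*} [Field K] [AddCommGroup M] [Module K M] {n r : ℕ}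

namespace IsPolarized

variable {A u : Fin n → K} {X C : Fin n → Module.End K M} {i₀ : K} {d : ∀ p, p < r → Fin n}
  {z : M} (h : IsPolarized A u X C i₀ d z)
include h

/-- Renumbering the operators. -/
theorem comp_perm (e : Equiv.Perm (Fin n)) :
    IsPolarized (fun k => A (e k)) (fun k => u (e k)) (fun k => X (e k)) (fun k => C (e k)) i₀
      (fun p hp => e.symm (d p hp)) z where
  rel :=
    { x_comm := fun i j => h.rel.x_comm _ _
      x_sq := fun i => h.rel.x_sq _
      c_sq := fun i => h.rel.c_sq _
      c_anti := fun i j hij => h.rel.c_anti _ _ fun he => hij (e.injective he)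
      x_c := fun i => h.rel.x_c _
      x_c_of_ne := fun i j hij => h.rel.x_c_of_ne _ _ fun he => hij (e.injective he) }
  i₀_sq := h.i₀_sq
  inj p hp p' hp' he := h.inj p hp p' hp' (e.symm.injective he)
  u_eq_zero_iff i := by
    rw [h.u_eq_zero_iff]
    simp only [Equiv.eq_symm_apply]
  x_apply i := h.x_apply _
  pair k hk := by
    simp only [Equiv.apply_symm_apply]
    exact h.pair k hk

/-- On a vector of the basis, `x_a` and `x_b` are the scalars `U` and `V` and
`A a - A b = (U - V) (U + V)`. -/
theorem xiOp_bas (hA : ∀ i, A i = u i * u i) {a c : Fin n} (hac : A a ≠ A c)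
    (β : Fin n → ZMod 2) {α : Fin n → ZMod 2} (hα : ∀ k, α k ≠ 0 → u k = 0) :
    xiOp A X C a c ((mon C β * mon C α) z) =
      -(1 / (sgn K (β a) * u a - sgn K (β c) * u c)) • (mon C β * mon C α) z -
        (1 / (sgn K (β a) * u a + sgn K (β c) * u c)) • C a (C c ((mon C β * mon C α) z)) := by
  have hne : a ≠ c := fun e => hac (congrArg A e)
  have hU := h.x_bas a β hα
  have hV := h.x_bas c β hα
  have hUV : A a - A c = (sgn K (β a) * u a - sgn K (β c) * u c) *
      (sgn K (β a) * u a + sgn K (β c) * u c) := by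
    rw [hA, hA]
    linear_combination (-u a * u a) * sgn_mul_self (K := K) (β a) +
      u c * u c * sgn_mul_self (K := K) (β c)
  have h0 : A a - A c ≠ 0 := sub_ne_zero.2 hac
  rw [xiOp, h.rel.yOp_eq a c hne, hUV]
  rw [hUV] at h0
  generalize sgn K (β a) * u a = U at *
  generalize sgn K (β c) * u c = V at *
  generalize (mon C β * mon C α) z = w at *
  obtain ⟨h1, h2⟩ := mul_ne_zero_iff.1 h0
  simp only [LinearMap.smul_apply, LinearMap.add_apply, Module.End.mul_apply, LinearMap.sub_apply,
    hU, hV, ← sub_smul, map_smul]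
  match_scalars <;> field_simp

/-! The value of `c_i c_{i+1}` on a vector of the basis, in the cases that neither `i` nor `i + 1`
is one of the `d(p)`, that `i` is one, and that `i + 1` is one. -/

theorem c_lo_c_hi_bas (i : Fin (n - 1)) (β α : Fin n → ZMod 2) :
    C (lo i) (C (hi i) ((mon C β * mon C α) z)) =
      sgn K (β (lo i)) • (mon C (β + stdVec (lo i) + stdVec (hi i)) * mon C α) z := by
  have hlt : lo i ≤ hi i := by rw [Fin.le_def, val_lo, val_hi]; omega
  rw [h.c_bas, map_smul, h.c_bas, smul_smul, ← sgn_add, sumLT_add, sumLT_stdVec_of_le hlt,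
    sumLT_hi, add_zero, add_right_comm (sumLT β (lo i)), CharTwo.add_self_eq_zero, zero_add,
    add_right_comm β]

theorem c_lo_c_hi_bas_of_even_lo (i : Fin (n - 1)) {β : Fin n → ZMod 2} (hβ : β (lo i) = 0)
    (α : Fin n → ZMod 2) :
    C (lo i) (C (hi i) ((mon C β * mon C α) z)) =
      sgn K (1 + sumGT β (lo i) + sumLT α (lo i)) •
        (mon C (β + stdVec (hi i)) * mon C (α + stdVec (lo i))) z := by
  have hβ' : (β + stdVec (hi i)) (lo i) = 0 := by
    rw [Pi.add_apply, hβ, stdVec_of_ne (lo_ne_hi i), add_zero]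
  rw [h.c_bas, map_smul, h.c_bas_of_even _ hβ', smul_smul, ← sgn_add, sumAll_add, sumAll_stdVec,
    sumLT_hi, ← sumLE_eq, sumAll_eq β (lo i)]
  congr 2
  linear_combination CharTwo.add_self_eq_zero (sumLE β (lo i))

theorem c_lo_c_hi_bas_of_odd_lo (i : Fin (n - 1)) (k : ℕ) (hk : 2 * k + 1 < r)
    (hlo : lo i = d (2 * k + 1) hk) {β α : Fin n → ZMod 2} (hβ : β (lo i) = 0)
    (hα : α (lo i) = 0) :
    C (lo i) (C (hi i) ((mon C β * mon C α) z)) =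
      (-i₀ * sgn K (1 + sumGT β (lo i) + sumLE α (d (2 * k) (by omega)))) •
        (mon C (β + stdVec (hi i)) * mon C (α + stdVec (d (2 * k) (by omega)))) z := by
  have hβ' : (β + stdVec (hi i)) (lo i) = 0 := by
    rw [Pi.add_apply, hβ, stdVec_of_ne (lo_ne_hi i), add_zero]
  have e : ∀ {β α : Fin n → ZMod 2}, β (lo i) = 0 → α (lo i) = 0 →
      C (lo i) ((mon C β * mon C α) z) =
        (-i₀ * sgn K (sumAll β + sumLE α (d (2 * k) (by omega)))) •
          (mon C β * mon C (α + stdVec (d (2 * k) (by omega)))) z := by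
    rw [hlo]
    exact h.c_bas_of_odd k hk
  rw [h.c_bas, map_smul, e hβ' hα, smul_smul, mul_left_comm, ← sgn_add, sumAll_add, sumAll_stdVec,
    sumLT_hi, ← sumLE_eq, sumAll_eq β (lo i)]
  congr 3
  linear_combination CharTwo.add_self_eq_zero (sumLE β (lo i))

theorem c_lo_c_hi_bas_of_even_hi (i : Fin (n - 1)) {β : Fin n → ZMod 2} (hβ : β (hi i) = 0)
    (α : Fin n → ZMod 2) :
    C (lo i) (C (hi i) ((mon C β * mon C α) z)) =
      sgn K (sumGE β (lo i) + sumLT α (hi i)) •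
        (mon C (β + stdVec (lo i)) * mon C (α + stdVec (hi i))) z := by
  rw [h.c_bas_of_even _ hβ, map_smul, h.c_bas, smul_smul, ← sgn_add, sumAll_eq' β (lo i)]
  congr 2
  linear_combination CharTwo.add_self_eq_zero (sumLT β (lo i))

theorem c_lo_c_hi_bas_of_odd_hi (i : Fin (n - 1)) (k : ℕ) (hk : 2 * k + 1 < r)
    (hhi : hi i = d (2 * k + 1) hk) {β α : Fin n → ZMod 2} (hβ : β (hi i) = 0)
    (hα : α (hi i) = 0) :
    C (lo i) (C (hi i) ((mon C β * mon C α) z)) =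
      (-i₀ * sgn K (sumGE β (lo i) + sumLE α (d (2 * k) (by omega)))) •
        (mon C (β + stdVec (lo i)) * mon C (α + stdVec (d (2 * k) (by omega)))) z := by
  rw [hhi] at hβ hα
  rw [hhi, h.c_bas_of_odd k hk hβ hα, map_smul, h.c_bas, smul_smul, mul_assoc, ← sgn_add,
    sumAll_eq' β (lo i)]
  congr 3
  linear_combination CharTwo.add_self_eq_zero (sumLT β (lo i))

end IsPolarized

/-- A linear map that intertwines the generators intertwines the ordered monomials. -/
theorem algHom_ofFn_prod_apply {R : Type*} [Semiring R] [Algebra K R] (Φ : R →ₐ[K] Module.End K M)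
    {N : Type*} [AddCommGroup N] [Module K N] (f : N →ₗ[K] M) {g : Fin n → R}
    {C : Fin n → Module.End K N} (hC : ∀ i y, Φ (g i) (f y) = f (C i y)) (β : Fin n → ZMod 2)
    (y : N) : Φ (List.ofFn fun i => g i ^ (β i).val).prod (f y) = f (mon C β y) := by
  induction n with
  | zero => simp [mon]
  | succ n ih =>
    rw [mon_succ, List.ofFn_succ, List.prod_cons, map_mul, Module.End.mul_apply,
      ih fun i => hC i.succ, Module.End.mul_apply]
    rcases zmod_two_cases (β 0) with e | e
    · simp [e]
    · simp [e, ZMod.val_one, hC]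

/-- A product of elements that all act on `w` by `a`. -/
theorem list_prod_apply {R : Type*} [Semiring R] [Algebra K R] (Φ : R →ₐ[K] Module.End K M) {w : M}
    {a : K} (l : List R) (hl : ∀ y ∈ l, Φ y w = a • w) : Φ l.prod w = a ^ l.length • w := by
  induction l with
  | nil => simp
  | cons y l ih =>
    rw [List.prod_cons, map_mul, Module.End.mul_apply, ih fun y hy => hl y (List.mem_cons_of_mem _ hy),
      map_smul, hl y List.mem_cons_self, smul_smul, List.length_cons, pow_succ]

end PolarizedAction

/-! ### Polarized vectors of the summands -/

section Vectors

variable {b : Kind} {m n : ℕ} {K : Type*} [Field K] {rt : K → K} {Q : Fin m → K} {μ : Shape b m n}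
  {L : IrrComponent rt (res Q (initial μ))}

theorem uPlus_mul_self (hrt : ∀ a : K, rt a ^ 2 = a) (a : K) :
    uPlus rt a * uPlus rt a = q a := by
  rw [uPlus, ← sq, hrt]

theorem uPlus_eq_zero_iff (hrt : ∀ a : K, rt a ^ 2 = a) (a : K) : uPlus rt a = 0 ↔ q a = 0 := by
  rw [← uPlus_mul_self hrt, mul_self_eq_zero]

theorem mem_diag_iff_exists_dSeq (t : Tab μ) (k : Fin n) :
    k ∈ diag t ↔ ∃ p hp, k = dSeq t p hp := by
  have hr : (dperm t).symm k ∈ diag (initial μ) ↔ (dperm t).symm k ∈ Set.range (diagSeq μ) := by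
    have e : Set.range (diagSeq μ) = diag (initial μ) := Finset.range_orderEmbOfFin _ rfl
    rw [e, Finset.mem_coe]
  rw [mem_diag_iff_initial, hr]
  constructor
  · rintro ⟨p, hp⟩
    exact ⟨p.1, p.2, by rw [dSeq, hp, Equiv.apply_symm_apply]⟩
  · rintro ⟨p, hp, rfl⟩
    exact ⟨⟨p, hp⟩, by rw [dSeq, Equiv.symm_apply_apply]⟩

theorem oddDiag_subset_diag {t : Tab μ} {k : Fin n} (h : k ∈ oddDiag t) : k ∈ diag t := by
  obtain ⟨p, hp, rfl⟩ := h
  exact (mem_diag_iff_exists_dSeq t _).2 ⟨_, hp, rfl⟩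

theorem dSeq_injective (t : Tab μ) (p : ℕ) (hp : p < numDiag μ) (p' : ℕ) (hp' : p' < numDiag μ)
    (h : dSeq t p hp = dSeq t p' hp') : p = p' :=
  Fin.mk.inj_iff.1 ((diagSeq μ).injective ((dperm t).injective h))

variable (hrt : ∀ a : K, rt a ^ 2 = a) (hsep : ∀ ν : Shape b m (n + 1), Separate Q ν)

/-- The vector `z^{d(t, t₀)}` of the twist `L^{d(t, t₀)}` is polarized: as twisting only renumbers
the operators, this is a condition on `z` itself. -/
abbrev IsPolarizedAt (L : IrrComponent rt (res Q (initial μ))) (t : Tab μ) (z : L.space) : Prop :=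
  IsPolarized (fun k => qInit Q μ (pos t k)) (uTab rt Q t) (fun k => L.x (pos t k))
    (fun k => L.c (pos t k)) (rt (-1)) (dSeq t) z

include hrt hsep in
/-- A single vector `z` of `L(res t₀)` has twists that are polarized in all the summands. -/
theorem exists_isPolarizedAt : ∃ z : L.space, z ≠ 0 ∧ (L.par z = z ∨ L.par z = -z) ∧
    ∀ t : Tab μ, IsPolarizedAt L t z := by
  have := L.nontrivial
  have hinit := isStd_initial μ
  obtain ⟨z, hz, hP, h⟩ := exists_isPolarized (M := L.space) (i₀ := rt (-1)) (r := numDiag μ)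
    (d := fun p hp => diagSeq μ ⟨p, hp⟩) (A := qInit Q μ)
    (u := fun a => uPlus rt (res Q (initial μ) a)) (L.xcRel hrt)
    (fun p hp p' hp' e => Fin.mk.inj_iff.1 ((diagSeq μ).injective e))
    (by rw [← sq, hrt])
    (fun i => by
      rw [uPlus_eq_zero_iff hrt, q_res_eq_zero_iff hsep hinit, mem_diag_iff_exists_dSeq]
      have : dperm (initial μ) = 1 := Equiv.symm_trans_self _
      simp only [dSeq, this, Equiv.Perm.one_apply])
    (fun i => (uPlus_mul_self hrt _).symm)
    (fun i hi => L.x_eq_zero hrt ((uPlus_eq_zero_iff hrt _).1 hi)) L.par_sq L.par_mul_x L.par_mul_c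
  refine ⟨z, hz, hP, fun t => ?_⟩
  have ht := h.comp_perm (dperm t).symm
  have hu : (fun k => uPlus rt (res Q (initial μ) ((dperm t).symm k))) = uTab rt Q t :=
    funext fun k => by rw [uTab, res_eq_res_initial t]
  rw [hu] at ht
  exact ht

include hrt hsep in
theorem uTab_ne {t : Tab μ} (ht : IsStd t) (i : Fin (n - 1)) :
    uTab rt Q t (lo i) ≠ uTab rt Q t (hi i) ∧ uTab rt Q t (lo i) ≠ -uTab rt Q t (hi i) := by
  have h := q_res_lo_ne_hi hsep ht i
  rw [← uPlus_mul_self hrt, ← uPlus_mul_self hrt (res Q t (hi i))] at h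
  constructor
  · intro e
    rw [uTab, uTab] at e
    exact h (by rw [e])
  · intro e
    rw [uTab, uTab] at e
    exact h (by rw [e, neg_mul_neg])

include hrt hsep in
theorem cCoef_eq {t : Tab μ} (ht : IsStd t) (i : Fin (n - 1)) :
    cCoef rt Q t i = omegaSq (qInit Q μ) (pos t (lo i)) (pos t (hi i)) := by
  obtain ⟨h1, h2⟩ := uTab_ne hrt hsep ht i
  rw [omegaSq, qInit_pos, qInit_pos, ← uPlus_mul_self hrt, ← uPlus_mul_self hrt (res Q t (hi i)),
    cCoef]
  change uTab rt Q t (lo i) ≠ -uTab rt Q t (hi i) at h2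
  rw [← uTab, ← uTab]
  generalize uTab rt Q t (lo i) = U at *
  generalize uTab rt Q t (hi i) = V at *
  have h3 : U - V ≠ 0 := sub_ne_zero.2 h1
  have h4 : U + V ≠ 0 := fun e => h2 (eq_neg_of_add_eq_zero_left e)
  have h5 : U * U - V * V = (U - V) * (U + V) := by ring
  rw [h5]
  field_simp
  ring

variable {Φ : CycSergeev b Q n →ₐ[K] Module.End K (DMod L)} (hΦ : IsDRep L Φ)

include hΦ in
theorem map_cMon_emb (t : Tab μ) (β : Fin n → ZMod 2) (z : L.space) :
    Φ (cMon b Q β) (emb L t z) = emb L t (mon (fun k => L.c (pos t k)) β z) := by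
  exact algHom_ofFn_prod_apply (M := DMod L) Φ (emb L t) (g := gc b Q)
    (C := fun k => L.c (pos t k)) (fun i y => by rw [hΦ.map_c, dc_emb]) β z

include hΦ in
theorem bvec_eq (z : L.space) (t : Std μ) (β α : Fin n → ZMod 2) :
    bvec Φ (fun _ => z) t β α =
      emb L t.1 ((mon (fun k => L.c (pos t.1 k)) β * mon (fun k => L.c (pos t.1 k)) α) z) := by
  rw [bvec, single_eq_emb, map_mul, Module.End.mul_apply, map_cMon_emb hΦ, map_cMon_emb hΦ]
  rfl

include hΦ in
theorem gc_bvec (z : L.space) (t : Std μ) (β α : Fin n → ZMod 2) (i : Fin n) :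
    Φ (gc b Q i) (bvec Φ (fun _ => z) t β α) =
      emb L t.1 (L.c (pos t.1 i)
        ((mon (fun k => L.c (pos t.1 k)) β * mon (fun k => L.c (pos t.1 k)) α) z)) := by
  rw [bvec_eq hΦ, hΦ.map_c, dc_emb]

include hΦ in
theorem gx_bvec (z : L.space) (t : Std μ) (β α : Fin n → ZMod 2) (i : Fin n) :
    Φ (gx b Q i) (bvec Φ (fun _ => z) t β α) =
      emb L t.1 (L.x (pos t.1 i)
        ((mon (fun k => L.c (pos t.1 k)) β * mon (fun k => L.c (pos t.1 k)) α) z)) := by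
  rw [bvec_eq hΦ, hΦ.map_x, dx_emb]

include hΦ in
theorem gammaT_apply (h2 : (2 : K) ≠ 0) {z : L.space} (t : Std μ) (h : IsPolarizedAt L t.1 z) :
    Φ (gammaT rt Q t.1) (Finsupp.single t z) = Finsupp.single t z := by
  -- each of the factors of `γ_t` acts on the vector by `2`
  have hprod := list_prod_apply (M := DMod L) Φ (w := Finsupp.single t z) (a := 2)
    (List.ofFn fun k : Fin (numDiag μ / 2) =>
      1 + rt (-1) • (gc b Q (dSeq t.1 (2 * k.1) (by have := k.2; omega)) *
        gc b Q (dSeq t.1 (2 * k.1 + 1) (by have := k.2; omega)))) ?_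
  · rw [gammaT, map_smul, LinearMap.smul_apply, hprod, List.length_ofFn, smul_smul, ← mul_pow,
      inv_mul_cancel₀ h2, one_pow, one_smul]
  intro y hy
  obtain ⟨k, rfl⟩ := (List.mem_ofFn' _ _).1 hy
  have hk := k.2
  have e : Φ (rt (-1) • (gc b Q (dSeq t.1 (2 * k.1) (by omega)) *
      gc b Q (dSeq t.1 (2 * k.1 + 1) (by omega)))) (Finsupp.single t z) = Finsupp.single t z := by
    rw [map_smul, map_mul, hΦ.map_c, hΦ.map_c, LinearMap.smul_apply, Module.End.mul_apply,
      single_eq_emb, dc_emb, dc_emb, ← map_smul]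
    exact congrArg (emb L t.1) (h.pair k.1 (by omega))
  rw [map_add, map_one, LinearMap.add_apply, Module.End.one_apply, e, two_smul]

variable {t : Std μ} {β α : Fin n → ZMod 2} (hβ : ∀ k, β k ≠ 0 → k ∉ diag t.1)
  (hα : ∀ k, α k ≠ 0 → k ∈ oddDiag t.1)

include hβ in
theorem offDiag_eq_zero {k : Fin n} (hk : k ∈ diag t.1) : β k = 0 :=
  by_contra fun e => hβ k e hk

include hα in
theorem oddDiag_dSeq_eq_zero (p : ℕ) (hp : 2 * p + 1 < numDiag μ) :
    α (dSeq t.1 (2 * p + 1) hp) = 0 :=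
  by_contra fun e => by
    obtain ⟨p', hp', e'⟩ := hα _ e
    have := dSeq_injective _ _ _ _ _ e'
    omega

include hrt hsep hα in
theorem uTab_eq_zero_of_ne {k : Fin n} (hk : α k ≠ 0) : uTab rt Q t.1 k = 0 :=
  (uPlus_eq_zero_iff hrt _).2 ((q_res_eq_zero_iff hsep t.2).2 (oddDiag_subset_diag (hα k hk)))

include hsep in
theorem not_lo_mem_and_hi_mem (ht : IsStd t.1) (i : Fin (n - 1)) :
    lo i ∉ diag t.1 ∨ hi i ∉ diag t.1 := by
  by_contra! h
  refine q_res_lo_ne_hi hsep ht i ?_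
  rw [(q_res_eq_zero_iff hsep ht).2 h.1, (q_res_eq_zero_iff hsep ht).2 h.2]

include hΦ hβ hα hsep in
/-- The expansion of `c_i c_{i+1} c^β c^α v_t` in the basis. -/
theorem rValue {z : L.space} (h : IsPolarizedAt L t.1 z) (i : Fin (n - 1)) :
    RValue Φ (fun _ => z) i β α t
      (emb L t.1 (L.c (pos t.1 (lo i)) (L.c (pos t.1 (hi i))
        ((mon (fun k => L.c (pos t.1 k)) β * mon (fun k => L.c (pos t.1 k)) α) z)))) := by
  by_cases hlo : lo i ∈ diag t.1
  · have hhi := (not_lo_mem_and_hi_mem hsep t.2 i).resolve_left fun e => e hlo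
    have hβ0 := offDiag_eq_zero hβ hlo
    obtain ⟨p, hp, e⟩ := (mem_diag_iff_exists_dSeq t.1 _).1 hlo
    obtain ⟨k, rfl | rfl⟩ := Nat.even_or_odd' p
    · rw [h.c_lo_c_hi_bas_of_even_lo i hβ0, map_smul, ← bvec_eq hΦ]
      exact RValue.lo_odd k hp e hhi
    · rw [h.c_lo_c_hi_bas_of_odd_lo i k hp e hβ0 (by rw [e]; exact oddDiag_dSeq_eq_zero hα k hp),
        map_smul, ← bvec_eq hΦ]
      exact RValue.lo_even k hp e hhi
  · by_cases hhi : hi i ∈ diag t.1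
    · have hβ0 := offDiag_eq_zero hβ hhi
      obtain ⟨p, hp, e⟩ := (mem_diag_iff_exists_dSeq t.1 _).1 hhi
      obtain ⟨k, rfl | rfl⟩ := Nat.even_or_odd' p
      · rw [h.c_lo_c_hi_bas_of_even_hi i hβ0, map_smul, ← bvec_eq hΦ]
        exact RValue.hi_odd k hp e hlo
      · rw [h.c_lo_c_hi_bas_of_odd_hi i k hp e hβ0
          (by rw [e]; exact oddDiag_dSeq_eq_zero hα k hp), map_smul, ← bvec_eq hΦ]
        exact RValue.hi_even k hp e hlo
    · rw [h.c_lo_c_hi_bas i, map_smul, ← bvec_eq hΦ]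
      exact RValue.off hlo hhi

include hΦ hrt hsep hα in
/-- The sign in the last term comes from reordering `c_{i+1}` and `c_i` in `c^β`; in `c^α` at most
one of them occurs. -/
theorem swapTerm_eq (z : L.space) (i : Fin (n - 1)) :
    swapTerm Φ (fun _ => z) i β α t =
      rt (omegaSq (qInit Q μ) (pos t.1 (lo i)) (pos t.1 (hi i))) •
        emb L (permTab (simple i) t.1)
          ((mon (fun k => L.c (pos t.1 k)) β * mon (fun k => L.c (pos t.1 k)) α) z) := by
  by_cases ht : IsStd (permTab (simple i) t.1)
  · have hrel : XCRel (qInit Q μ) L.x L.c := L.xcRel hrt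
    have hαα : α (lo i) * α (hi i) = 0 := by
      rcases not_lo_mem_and_hi_mem hsep t.2 i with e | e
      · rw [by_contra fun e' => e (oddDiag_subset_diag (hα _ e')), zero_mul]
      · rw [by_contra fun e' => e (oddDiag_subset_diag (hα (hi i) e')), mul_zero]
    have hmon := mon_comp_simple (K := K) (C := fun k => L.c (pos t.1 k))
      (fun k => hrel.c_sq _) (fun k l hkl => hrel.c_anti _ _ fun e => hkl (pos_injective t.1 e)) i
    have hα' := hmon α
    rw [hαα, sgn_zero, one_smul] at hα'
    have hβ' := hmon β
    rw [swapTerm, dif_pos ht, bvec_eq hΦ, cCoef_eq hrt hsep t.2]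
    simp only [pos_permTab, simple_symm]
    rw [hα', hβ', smul_mul_assoc, LinearMap.smul_apply, map_smul, smul_smul]
    congr 1
    linear_combination rt (omegaSq (qInit Q μ) (pos t.1 (lo i)) (pos t.1 (hi i))) *
      sgn_mul_self (K := K) (β (lo i) * β (hi i))
  · rw [swapTerm, dif_neg ht, emb_of_not_isStd L ht, smul_zero]

include hΦ hrt hsep hα in
theorem gs_bvec {z : L.space} (h : IsPolarizedAt L t.1 z) (i : Fin (n - 1)) :
    Φ (gs b Q i) (bvec Φ (fun _ => z) t β α) =
      -(1 / (sgn K (β (lo i)) * uTab rt Q t.1 (lo i)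
            - sgn K (β (hi i)) * uTab rt Q t.1 (hi i))) • bvec Φ (fun _ => z) t β α
      - (1 / (sgn K (β (lo i)) * uTab rt Q t.1 (lo i)
            + sgn K (β (hi i)) * uTab rt Q t.1 (hi i))) •
          (emb L t.1 (L.c (pos t.1 (lo i)) (L.c (pos t.1 (hi i))
            ((mon (fun k => L.c (pos t.1 k)) β * mon (fun k => L.c (pos t.1 k)) α) z))))
      + swapTerm Φ (fun _ => z) i β α t := by
  have e := h.xiOp_bas (fun k => by rw [qInit_pos, uTab, uPlus_mul_self hrt])
    (qInit_pos_ne hsep t.2 i) β (fun k => uTab_eq_zero_of_ne hrt hsep hα)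
  have e' : xiOp (qInit Q μ) L.x L.c (pos t.1 (lo i)) (pos t.1 (hi i)) =
    xiOp (fun k => qInit Q μ (pos t.1 k)) (fun k => L.x (pos t.1 k))
      (fun k => L.c (pos t.1 k)) (lo i) (hi i) := rfl
  rw [swapTerm_eq hrt hsep hΦ hα, bvec_eq hΦ, hΦ.map_s, ds_emb L hrt hsep, e', e, map_sub, map_smul,
    map_smul]

theorem exists_basis_summand (h2 : (2 : K) ≠ 0) {z : L.space} (hz : z ≠ 0)
    (hP : L.par z = z ∨ L.par z = -z) (t : Std μ) (h : IsPolarizedAt L t.1 z) :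
    ∃ B : Module.Basis (OffDiagVec t.1 × OddDiagVec t.1) K L.space, ∀ β α, B (β, α) =
      (mon (fun k => L.c (pos t.1 k)) β.1 * mon (fun k => L.c (pos t.1 k)) α.1) z := by
  have hpos : ∀ a, pos t.1 (dperm t.1 a) = a := fun a => Equiv.symm_apply_apply _ _
  refine h.exists_basis h2 hz (P := L.par) (fun i => L.par_mul_c _) hP (fun W hx hc hp hne => ?_)
    (fun k => k ∈ diag t.1) (fun k => k ∈ oddDiag t.1) (mem_diag_iff_exists_dSeq t.1)
    fun i => Iff.rfl
  refine L.eq_top (fun a y hy => ?_) (fun a y hy => ?_) hp hne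
  · have := hx (dperm t.1 a) y hy
    rwa [hpos] at this
  · have := hc (dperm t.1 a) y hy
    rwa [hpos] at this

end Vectors

end Sergeev

end

theorem mainTheorem9 {K : Type*} [Field K] [IsAlgClosed K] (h2 : (2 : K) ≠ 0)
    (rt : K → K) (hrt : ∀ a : K, rt a ^ 2 = a)
    (b : Kind) (m n : ℕ) (hn : 1 ≤ n) (Q : Fin m → K)
    (hsep : ∀ ν : Shape b m (n + 1), Separate Q ν)
    (μ : Shape b m n) (L : IrrComponent rt (res Q (initial μ))) :
    -- the prescribed operators make `D(μ)` a simple supermodule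
    ∃ Φ : CycSergeev b Q n →ₐ[K] Module.End K (DMod L),
      IsDRep L Φ ∧ IsSimpleSuper (M := DMod L) Φ (dpar L) ∧
      ∃ v : Std μ → L.space,
        -- the basis of `D(μ)`
        (∃ B : Module.Basis (Σ t : Std μ, OffDiagVec t.1 × OddDiagVec t.1) K (DMod L),
          ∀ t β α, B ⟨t, β, α⟩ = bvec Φ v t β.1 α.1) ∧
        -- the part of it that belongs to `t` is a basis of the summand of `t`
        (∀ t : Std μ, ∃ B : Module.Basis (OffDiagVec t.1 × OddDiagVec t.1) K L.space,
          ∀ β α, Finsupp.single t (B (β, α)) = bvec Φ v t β.1 α.1) ∧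
        ∀ t : Std μ,
          -- the denominators below do not vanish
          (∀ i : Fin (n - 1), uTab rt Q t.1 (lo i) ≠ uTab rt Q t.1 (hi i) ∧
            uTab rt Q t.1 (lo i) ≠ -uTab rt Q t.1 (hi i)) ∧
          -- the idempotent `γ_t` fixes `v_t`
          Φ (gammaT rt Q t.1) (Finsupp.single t (v t)) = Finsupp.single t (v t) ∧
          ∀ (β : OffDiagVec t.1) (α : OddDiagVec t.1),
            -- the action of `x_i`
            (∀ i : Fin n, Φ (gx b Q i) (bvec Φ v t β.1 α.1) =
              (sgn K (β.1 i) * uTab rt Q t.1 i) • bvec Φ v t β.1 α.1) ∧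
            -- the action of `c_i`
            (∀ i : Fin n, i ∉ diag t.1 → Φ (gc b Q i) (bvec Φ v t β.1 α.1) =
              sgn K (sumLT β.1 i) • bvec Φ v t (β.1 + stdVec i) α.1) ∧
            (∀ (p : ℕ) (hp : 2 * p < numDiag μ) (i : Fin n), i = dSeq t.1 (2 * p) hp →
              Φ (gc b Q i) (bvec Φ v t β.1 α.1) =
                sgn K (sumAll β.1 + sumLT α.1 i) • bvec Φ v t β.1 (α.1 + stdVec i)) ∧
            (∀ (p : ℕ) (hp : 2 * p + 1 < numDiag μ) (i j : Fin n),
              i = dSeq t.1 (2 * p + 1) hp → j = dSeq t.1 (2 * p) (by omega) →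
              Φ (gc b Q i) (bvec Φ v t β.1 α.1) =
                (-rt (-1) * sgn K (sumAll β.1 + sumLE α.1 j)) •
                  bvec Φ v t β.1 (α.1 + stdVec j)) ∧
            -- the action of `s_i`
            (∀ i : Fin (n - 1), ∃ r : DMod L, RValue Φ v i β.1 α.1 t r ∧
              Φ (gs b Q i) (bvec Φ v t β.1 α.1) =
                -(1 / (sgn K (β.1 (lo i)) * uTab rt Q t.1 (lo i)
                      - sgn K (β.1 (hi i)) * uTab rt Q t.1 (hi i))) • bvec Φ v t β.1 α.1
                - (1 / (sgn K (β.1 (lo i)) * uTab rt Q t.1 (lo i)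
                      + sgn K (β.1 (hi i)) * uTab rt Q t.1 (hi i))) • r
                + swapTerm Φ v i β.1 α.1 t) := by
  obtain ⟨Φ, hΦ⟩ := exists_isDRep L hrt hsep
  refine ⟨Φ, hΦ, hΦ.isSimpleSuper hrt hsep, ?_⟩
  obtain ⟨z, hz, hP, hpol⟩ := exists_isPolarizedAt (L := L) hrt hsep
  choose B hB using fun t : Std μ => exists_basis_summand h2 hz hP t (hpol t.1)
  refine ⟨fun _ => z, ⟨Finsupp.basis B, fun t β α => ?_⟩, fun t => ⟨B t, fun β α => ?_⟩,
    fun t => ⟨uTab_ne hrt hsep t.2, gammaT_apply hΦ h2 t (hpol t.1), fun β α => ⟨fun i => ?_,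
      fun i _ => ?_, fun p hp i hi => ?_, fun p hp i j hi hj => ?_,
      fun i => ⟨_, rValue hsep hΦ β.2 α.2 (hpol t.1) i, gs_bvec hrt hsep hΦ α.2 (hpol t.1) i⟩⟩⟩⟩
  · rw [Finsupp.coe_basis]
    change Finsupp.single t (B t (β, α)) = _
    rw [hB, bvec_eq hΦ, single_eq_emb]
  · rw [hB, bvec_eq hΦ, single_eq_emb]
  · rw [gx_bvec hΦ, (hpol t.1).x_bas i β.1 fun k => uTab_eq_zero_of_ne hrt hsep α.2, map_smul,
      bvec_eq hΦ]
  · rw [gc_bvec hΦ, (hpol t.1).c_bas, map_smul, bvec_eq hΦ]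
  · have hβ := offDiag_eq_zero β.2 ((mem_diag_iff_exists_dSeq t.1 i).2 ⟨_, hp, hi⟩)
    rw [gc_bvec hΦ, (hpol t.1).c_bas_of_even i hβ, map_smul, bvec_eq hΦ]
  · subst hi hj
    have hβ := offDiag_eq_zero β.2 ((mem_diag_iff_exists_dSeq t.1 _).2 ⟨_, hp, rfl⟩)
    rw [gc_bvec hΦ, (hpol t.1).c_bas_of_odd p hp hβ (oddDiag_dSeq_eq_zero α.2 p hp), map_smul,
      bvec_eq hΦ]
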